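/- **Setting.** Let $s>1$ and $h>0$, and let $x_j=jh$, $j\in\mathbb Z$. A piecewise linear function on this grid, possibly discontinuous at the nodes, is described by its averages $A_j=\tfrac12(u(x_j^+)+u(x_j^-))$ and jumps $J_j=u(x_j^-)-u(x_j^+)$; write $U=(A_j,J_j)_{j\in\mathbb Z}\in\ell^2$ (real or complex). Let $M_h$ and $R_h^s$ be the mass matrix and the stiffness matrix of the symmetric interior penalty form $$a_h^s(u,v)=\sum_{j}\Big[\int_{x_j}^{x_{j+1}}u_xv_x\,dx-[u](x_j)\{v_x\}(x_j)-[v](x_j)\{u_x\}(x_j)+\frac sh[u](x_j)[v](x_j)\Big].$$ Explicitly, $(M_hU)_j$ has components $$\tfrac h6A_{j-1}-\tfrac h{12}J_{j-1}+\tfrac{2h}3A_j+\tfrac h6A_{j+1}+\tfrac h{12}J_{j+1},\qquad \tfrac h{12}A_{j-1}-\tfrac h{24}J_{j-1}+\tfrac h6J_j-\tfrac h{12}A_{j+1}-\tfrac h{24}J_{j+1},$$ and $(R_h^sU)_j$ has components $\frac{-A_{j-1}+2A_j-A_{j+1}}h$ and $\frac{-J_{j-1}+(4s-2)J_j-J_{j+1}}{4h}$.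 Consider in $\ell^2$ the semi-discrete wave equation $$M_hU''+R_h^sU=0,\quad t\ge 0,\qquad U(0)=U^0,\quad U'(0)=U^1,$$ with total energy $E_h^s(U^0,U^1)=\frac12\big(\langle R_h^sU^0,U^0\rangle+\langle M_hU^1,U^1\rangle\big)$. Let $\Omega=\mathbb R\setminus(-1,1)$. The form $a_h^s$ is a sum over the cells $K_j=[x_j,x_{j+1}]$: in $\{v_x\}(x_j)$ each of the two cells meeting at $x_j$ carries its own slope with weight $\frac12$, and each penalty term is shared equally by these two cells. Let $a_{\Omega,h}^s$ be the sum of the contributions of the cells $K_j\subset\Omega$, let $m_{\Omega,h}(u,v)=\sum_{K_j\subset\Omega}\int_{K_j}uv\,dx$, and let $R_{\Omega,h}^s$, $M_{\Omega,h}$ be the corresponding matrices. The energy concentrated in $\Omega$ is $$E_{\Omega,h}^s(t)=\tfrac12\big(a_{\Omega,h}^s(U(t),\overline{U(t)})+m_{\Omega,h}(U'(t),\overline{U'(t)})\big).$$ The bi-grid space $X_h$ is the set of $U\in\ell^2$ with $J_j=0$ and $A_{2j}=\frac12(A_{2j+1}+A_{2j-1})$ for all $j\in\mathbb Z$. **Statement.**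 For every $s>1$ there is $T_0>0$, independent of $h$, such that for every $T>T_0$ there is a constant $C>0$, depending only on $s$ and $T$, for which the following holds for all $h\in(0,1]$. 1. (Uniform observability.) Every solution with $U^0,U^1\in X_h$ satisfies $$E_h^s(U^0,U^1)\le C\int_0^TE_{\Omega,h}^s(t)\,dt .$$ 2. (Uniform controllability of a projection.) Let $(Y_0,Z_0)$ and $(Y_1,Z_1)$ be pairs in $\ell^2\times\ell^2$ and let $K\in\mathbb R$ be such that, for $i=0,1$, $$\langle M_hY_i,Y_i\rangle\le K^2,\qquad |\langle M_hZ_i,W\rangle|^2\le K^2\langle R_h^sW,W\rangle\quad\text{for all }W\in\ell^2$$ (discrete $L^2$ norm of $Y_i$ and discrete $\dot H^{-1}$ norm of $Z_i$ at most $|K|$). Then there are measurable controls $F,G$, with values in the coefficient vectors, with cost $$\int_0^T\big(a_{\Omega,h}^s(G,\overline G)+m_{\Omega,h}(F,\overline F)\big)dt\le CK^2,$$ such that the system, in integrated form, $$M_hY'=M_hZ+M_{\Omega,h}F,\qquad M_hZ'+R_h^sY=R_{\Omega,h}^sG,\qquad Y(0)=Y_0,\quad Z(0)=Z_0,$$ has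 a solution $Y,Z\in C([0,T];\ell^2)$ with $$\pi_hY(T)=\pi_hY_1,\qquad \pi_hZ(T)=\pi_hZ_1,$$ where $\pi_h$ is the $L^2(\mathbb R)$-orthogonal projection onto $X_h$, i.e. $\langle M_h(Y(T)-Y_1),\Phi\rangle=\langle M_h(Z(T)-Z_1),\Phi\rangle=0$ for all $\Phi\in X_h$. -/

import Mathlib

namespace DGWave

open Set MeasureTheory

variable {𝕜 : Type*} [RCLike 𝕜]

/-- A (not necessarily square-summable) coefficient vector of a piecewise linear, possibly
discontinuous function on the grid `x_j = j h`: the entry `(j, 0)` is the average `A_j` and the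
entry `(j, 1)` is the jump `J_j` (left limit minus right limit) at the node `x_j`. -/
abbrev Coeffs (𝕜 : Type*) := ℤ × Fin 2 → 𝕜

/-- The Hilbert space `ℓ²` of square-summable coefficient vectors. -/
abbrev EllTwo (𝕜 : Type*) [RCLike 𝕜] := lp (fun _ : ℤ × Fin 2 => 𝕜) 2

/-- The `ℓ²` pairing `∑ u_k conj(v_k)`. -/
noncomputable def pairing (u v : Coeffs 𝕜) : 𝕜 := ∑' k, u k * star (v k)

/-- The mass matrix `M_h`, given by its block tridiagonal stencil. -/
noncomputable def massOp (h : ℝ) (u : Coeffs 𝕜) : Coeffs 𝕜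
  | (j, 0) => (h / 6) • u (j - 1, 0) - (h / 12) • u (j - 1, 1) + (2 * h / 3) • u (j, 0)
      + (h / 6) • u (j + 1, 0) + (h / 12) • u (j + 1, 1)
  | (j, 1) => (h / 12) • u (j - 1, 0) - (h / 24) • u (j - 1, 1) + (h / 6) • u (j, 1)
      - (h / 12) • u (j + 1, 0) - (h / 24) • u (j + 1, 1)

/-- The stiffness matrix `R_h^s`, given by its block tridiagonal stencil. -/
noncomputable def stiffOp (s h : ℝ) (u : Coeffs 𝕜) : Coeffs 𝕜
  | (j, 0) => (-(1 / h)) • u (j - 1, 0) + (2 / h) • u (j, 0) - (1 / h) • u (j + 1, 0)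
  | (j, 1) => (-(1 / (4 * h))) • u (j - 1, 1) + ((2 * s - 1) / (2 * h)) • u (j, 1)
      - (1 / (4 * h)) • u (j + 1, 1)

/-- The total discrete energy `(⟨R_h^s U⁰, U⁰⟩ + ⟨M_h U¹, U¹⟩) / 2`. -/
noncomputable def totalEnergy (s h : ℝ) (U₀ U₁ : Coeffs 𝕜) : ℝ :=
  (1 / 2) * RCLike.re (pairing (stiffOp s h U₀) U₀ + pairing (massOp h U₁) U₁)

/-- `U` is a solution on `[0, ∞)`, with velocity `V`, of `M_h U'' + R_h^s U = 0` in `ℓ²`. -/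
def IsSolution (s h : ℝ) (U V : ℝ → EllTwo 𝕜) : Prop :=
  (∀ t ∈ Ici (0 : ℝ), HasDerivWithinAt U (V t) (Ici 0) t) ∧
  ∃ W : ℝ → EllTwo 𝕜, ∀ t ∈ Ici (0 : ℝ), HasDerivWithinAt V (W t) (Ici 0) t ∧
    ∀ k, massOp h (W t) k + stiffOp s h (U t) k = 0

/-! ### Cell contributions

On the cell `[x_j, x_{j+1}]` a function with coefficient vector `u` is affine. -/

/-- The trace of `u` at the left end of the cell `[x_j, x_{j+1}]`. -/
noncomputable def leftTrace (u : Coeffs 𝕜) (j : ℤ) : 𝕜 := u (j, 0) - u (j, 1) / 2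

/-- The trace of `u` at the right end of the cell `[x_j, x_{j+1}]`. -/
noncomputable def rightTrace (u : Coeffs 𝕜) (j : ℤ) : 𝕜 := u (j + 1, 0) + u (j + 1, 1) / 2

/-- The slope of `u` on the cell `[x_j, x_{j+1}]`. -/
noncomputable def slope (h : ℝ) (u : Coeffs 𝕜) (j : ℤ) : 𝕜 :=
  (1 / h) • (rightTrace u j - leftTrace u j)

/-- The integral of the product `u v` over the cell `[x_j, x_{j+1}]`. -/
noncomputable def cellMass (h : ℝ) (j : ℤ) (u v : Coeffs 𝕜) : 𝕜 :=
  (h / 6) • (2 * (leftTrace u j * leftTrace v j) + leftTrace u j * rightTrace v j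
    + rightTrace u j * leftTrace v j + 2 * (rightTrace u j * rightTrace v j))

/-- The contribution of the cell `[x_j, x_{j+1}]` to the symmetric interior penalty form
`∑ (∫ u_x v_x - [u]{v_x} - [v]{u_x} + (s/h) [u][v])`: in the averages `{u_x}`, `{v_x}` at the two
end points the cell carries its own slope with weight `1/2`, and each penalty term is shared
equally by the two cells that meet at the node. -/
noncomputable def cellStiff (s h : ℝ) (j : ℤ) (u v : Coeffs 𝕜) : 𝕜 :=
  h • (slope h u j * slope h v j)
    - (1 / 2 : ℝ) • ((u (j, 1) + u (j + 1, 1)) * slope h v j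
        + (v (j, 1) + v (j + 1, 1)) * slope h u j)
    + (s / (2 * h)) • (u (j, 1) * v (j, 1) + u (j + 1, 1) * v (j + 1, 1))

/-- The energy carried by the cell `[x_j, x_{j+1}]`, for the displacement `u` and the velocity `v`;
summed over all cells it is the total energy. -/
noncomputable def cellEnergy (s h : ℝ) (j : ℤ) (u v : Coeffs 𝕜) : ℝ :=
  (1 / 2) * RCLike.re (cellStiff s h j u (star u) + cellMass h j v (star v))

/-- The cell `[j h, (j+1) h]` lies in the observation region `Ω = ℝ \ (-1, 1)`. -/
def CellInOmega (h : ℝ) (j : ℤ) : Prop := 1 ≤ (j : ℝ) * h ∨ ((j : ℝ) + 1) * h ≤ -1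

open Classical in
/-- The discrete energy concentrated in `Ω`: the sum of the energies of the cells in `Ω`. -/
noncomputable def localEnergy (s h : ℝ) (u v : Coeffs 𝕜) : ℝ :=
  ∑' j : ℤ, if CellInOmega h j then cellEnergy s h j u v else 0

/-- Bi-grid data: the jumps vanish, and the averages at the even nodes are interpolated from those
at the neighbouring odd nodes. -/
def IsBigrid (u : Coeffs 𝕜) : Prop :=
  (∀ j : ℤ, u (j, 1) = 0) ∧
  ∀ j : ℤ, u (2 * j, 0) = (u (2 * j + 1, 0) + u (2 * j - 1, 0)) / 2

/-! ### The controlled system -/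

open Classical in
/-- The load vector `∫_Ω F φ_k` (over the cells in `Ω`), where `φ_k` is the `k`-th basis function;
only the two cells around its node contribute. -/
noncomputable def massLoad (h : ℝ) (F : Coeffs 𝕜) (k : ℤ × Fin 2) : 𝕜 :=
  ∑ j ∈ ({k.1 - 1, k.1} : Finset ℤ),
    if CellInOmega h j then cellMass h j F (Pi.single k 1) else 0

open Classical in
/-- The load vector of `G` for the interior penalty form restricted to the cells in `Ω`. -/
noncomputable def stiffLoad (s h : ℝ) (G : Coeffs 𝕜) (k : ℤ × Fin 2) : 𝕜 :=
  ∑ j ∈ ({k.1 - 1, k.1} : Finset ℤ),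
    if CellInOmega h j then cellStiff s h j G (Pi.single k 1) else 0

open Classical in
/-- The cost `∫₀ᵀ (a_Ω(G, G) + ∫_Ω |F|²) dt`, twice the energy in `Ω` of the pair `(G, F)`. -/
noncomputable def controlCost (s h T : ℝ) (F G : ℝ → Coeffs 𝕜) : ENNReal :=
  ∫⁻ t in Icc (0 : ℝ) T, ∑' j : ℤ,
    if CellInOmega h j then ENNReal.ofReal (2 * cellEnergy s h j (G t) (F t)) else 0

/-- The pair `(Y, Z)` solves on `[0, T]`, in integrated form and tested with every basis function,
the system controlled from `Ω` by `(F, G)`: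
`M_h Y' = M_h Z + M_{Ω,h} F`, `M_h Z' + R_h^s Y = R_{Ω,h}^s G`. -/
def IsControlled (s h T : ℝ) (F G : ℝ → Coeffs 𝕜) (Y Z : ℝ → EllTwo 𝕜) : Prop :=
  ContinuousOn Y (Icc 0 T) ∧ ContinuousOn Z (Icc 0 T) ∧
  ∀ t ∈ Icc (0 : ℝ) T, ∀ k : ℤ × Fin 2,
    massOp h (Y t) k = massOp h (Y 0) k
      + ∫ τ in (0 : ℝ)..t, (massOp h (Z τ) k + massLoad h (F τ) k) ∧
    massOp h (Z t) k = massOp h (Z 0) k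
      + ∫ τ in (0 : ℝ)..t, (-stiffOp s h (Y τ) k + stiffLoad s h (G τ) k)

/-- The state `(Y, Z)` has discrete `L² × Ḣ⁻¹` norm at most `K` in each component, the norm of
`Z` being the one dual to `⟨R_h^s W, W⟩^{1/2}`. -/
def DualNormLe (s h K : ℝ) (Y Z : EllTwo 𝕜) : Prop :=
  RCLike.re (pairing (massOp h Y) Y) ≤ K ^ 2 ∧
  ∀ W : EllTwo 𝕜,
    ‖pairing (massOp h Z) W‖ ^ 2 ≤ K ^ 2 * RCLike.re (pairing (stiffOp s h W) W)

/-- `Y` and `Y'` have the same `L²(ℝ)`-orthogonal projection onto the bi-grid space, i.e. their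
difference is `L²(ℝ)`-orthogonal to every bi-grid function. -/
def SameBigridProjection (h : ℝ) (Y Y' : EllTwo 𝕜) : Prop :=
  ∀ Φ : EllTwo 𝕜, IsBigrid (Φ : Coeffs 𝕜) →
    pairing (massOp h ((Y - Y' : EllTwo 𝕜) : Coeffs 𝕜)) Φ = 0

end DGWave

set_option linter.unusedSimpArgs false

/-! Observability is a virial argument on the grid. All the operators are Laurent polynomials in the
shift `S`, with `cs` and `sn` in the roles of `cos ξ` and `i sin ξ`. Up to scaling, the symbol of
the mass matrix has constant determinant 12, so its inverse is again a finite-difference operator.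
The wave equation therefore becomes `z' = h⁻¹ gen z` with Laurent polynomial entries, where `z = (D,
J, v, y)` consists of the differences of the averages, the jumps, and `h` times the two velocities.
The commutator of the position with such an operator is, up to sign, the operator with symbol `S ∂ₛ
p` (`hasCommutator_eulerD`). Truncating the position at `±N` adds errors that live only at sites
near or beyond `±N`.

For well-chosen multipliers the form `virWeight`, of size `O(N ‖z‖²)`, has derivative `h⁻¹ (virForm
+ exterior terms)` (`virial_identity`, `exists_virWeight_deriv`). Here `virForm` is the energy
weighted by `symP₀` plus the energy of `gen z` weighted by `symP₁`; like the energy, it is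
conserved. If it dominates the energy at one time, it does so at all times. Integrating with `N`
comparable to `1/h` then bounds `T` times the energy by a fixed multiple of the energy plus the
exterior terms (`observability`). For `s > 1` every cell energy is a sum of squares
(`cellEnergy_eq`), and so the local energy controls the exterior terms.

Both weights contain the factor `1 + cs`, so `virForm` degenerates at frequency `π` and cannot
dominate the energy on all data. Bi-grid averages are `(1 + cs) g` with `g` supported on the odd
sites. In terms of `g`, the difference between `virForm` and a multiple of the energy is a sum of
squares plus a symbol odd under `S ↦ -S`. The latter maps odd sites to even ones and contributes
nothing (`IsBigridState.energy_le_virForm`).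

Controllability follows by duality. The symplectic pairing of a controlled with a free solution
changes by the integral of the local energy form (`sympOp_controlOp`, `sympOp_steer_sub`). By
observability the Gramian is coercive on the closure of the bi-grid states, and Lax–Milgram
(`exists_of_coercive_on_closure`) yields the final state `ψ` of a free solution that serves as
control. The bi-grid condition is now imposed at time `T`, which is harmless because of the
conservation laws. -/

namespace DGWave

open Set MeasureTheory LaurentPolynomial
open scoped RealInnerProductSpace

/-! ### Bounded operators on square-summable families -/

section Operators

variable {ι κ E : Type*} [NormedAddCommGroup E] [InnerProductSpace ℝ E]

omit [InnerProductSpace ℝ E] in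
theorem memℓp_two_iff {f : ι → E} :
    Memℓp f 2 ↔ Summable fun i => ‖f i‖ ^ 2 := by
  rw [memℓp_gen_iff (by simp)]
  simp

omit [InnerProductSpace ℝ E] in
theorem summable_norm_sq (f : lp (fun _ : ι => E) 2) : Summable fun i => ‖f i‖ ^ 2 :=
  memℓp_two_iff.1 (lp.memℓp f)

theorem norm_sq_eq_tsum (f : lp (fun _ : ι => E) 2) : ‖f‖ ^ 2 = ∑' i, ‖f i‖ ^ 2 := by
  rw [← real_inner_self_eq_norm_sq, lp.inner_eq_tsum]
  simp

/-- Restriction of a square-summable family along an injective map of index sets. -/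
noncomputable def pull (e : ι → κ) (he : Function.Injective e) :
    lp (fun _ : κ => E) 2 →L[ℝ] lp (fun _ : ι => E) 2 :=
  LinearMap.mkContinuous
    { toFun := fun f => ⟨fun i => f (e i),
        memℓp_two_iff.2 ((summable_norm_sq f).comp_injective he)⟩
      map_add' := fun _ _ => rfl
      map_smul' := fun _ _ => rfl } 1 fun f => by
    rw [one_mul]
    refine le_of_sq_le_sq ?_ (norm_nonneg _)
    rw [norm_sq_eq_tsum, norm_sq_eq_tsum]
    exact tsum_comp_le_tsum_of_inj (summable_norm_sq f) (fun _ => sq_nonneg _) he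

@[simp] theorem pull_apply (e : ι → κ) (he : Function.Injective e) (f : lp (fun _ : κ => E) 2)
    (i : ι) : pull e he f i = f (e i) := rfl

/-- Multiplication of a square-summable family by a bounded real weight. -/
noncomputable def mulWeight (w : ι → ℝ) (C : ℝ) (hw : ∀ i, |w i| ≤ C) :
    lp (fun _ : ι => E) 2 →L[ℝ] lp (fun _ : ι => E) 2 :=
  have key : ∀ (f : lp (fun _ : ι => E) 2) (i : ι), ‖w i • f i‖ ^ 2 ≤ C ^ 2 * ‖f i‖ ^ 2 := by
    intro f i
    rw [norm_smul, mul_pow, Real.norm_eq_abs]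
    gcongr
    exact hw i
  LinearMap.mkContinuous
    { toFun := fun f => ⟨fun i => w i • f i,
        memℓp_two_iff.2 (Summable.of_nonneg_of_le (fun _ => sq_nonneg _) (key f)
          ((summable_norm_sq f).mul_left _))⟩
      map_add' := fun f g => by ext i; exact smul_add _ _ _
      map_smul' := fun r f => by ext i; exact smul_comm _ _ _ } |C| fun f => by
    refine le_of_sq_le_sq ?_ (by positivity)
    rw [mul_pow, sq_abs, norm_sq_eq_tsum, norm_sq_eq_tsum, ← tsum_mul_left]
    exact Summable.tsum_le_tsum (key f) (Summable.of_nonneg_of_le (fun _ => sq_nonneg _) (key f)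
          ((summable_norm_sq f).mul_left _)) ((summable_norm_sq f).mul_left _)

@[simp] theorem mulWeight_apply (w : ι → ℝ) (C : ℝ) (hw : ∀ i, |w i| ≤ C)
    (f : lp (fun _ : ι => E) 2) (i : ι) : mulWeight w C hw f i = w i • f i := rfl

theorem norm_mulWeight_le (w : ι → ℝ) (C : ℝ) (hw : ∀ i, |w i| ≤ C) (f : lp (fun _ : ι => E) 2) :
    ‖mulWeight w C hw f‖ ≤ |C| * ‖f‖ := by
  refine (mulWeight w C hw).le_of_opNorm_le ?_ f
  unfold mulWeight
  exact LinearMap.mkContinuous_norm_le _ (abs_nonneg _) _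

theorem inner_mulWeight_comm (w : ι → ℝ) (C : ℝ) (hw : ∀ i, |w i| ≤ C)
    (f g : lp (fun _ : ι => E) 2) :
    ⟪mulWeight w C hw f, g⟫ = ⟪f, mulWeight w C hw g⟫ := by
  rw [lp.inner_eq_tsum, lp.inner_eq_tsum]
  simp [real_inner_smul_left, real_inner_smul_right]

end Operators

/-! ### Square-summable sequences on the grid and finite-difference operators -/

section Shift

/-- Square-summable `E`-valued sequences on `ℤ`. -/
abbrev Seq (E : Type*) [NormedAddCommGroup E] := lp (fun _ : ℤ => E) 2

variable {E : Type*} [NormedAddCommGroup E] [InnerProductSpace ℝ E]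

/-- The translation `(shift n f) j = f (j + n)`. -/
noncomputable def shift (n : ℤ) : Seq E →L[ℝ] Seq E :=
  pull (fun j => j + n) (add_left_injective n)

@[simp] theorem shift_apply (n : ℤ) (f : Seq E) (j : ℤ) : shift n f j = f (j + n) := rfl

theorem inner_shift (n : ℤ) (f g : Seq E) : ⟪shift n f, g⟫ = ⟪f, shift (-n) g⟫ := by
  rw [lp.inner_eq_tsum, lp.inner_eq_tsum,
    ← (Equiv.addRight n).tsum_eq (fun j => ⟪f j, shift (-n) g j⟫)]
  simp

variable (E) in
/-- Translations as a representation of `ℤ`. -/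
noncomputable def shiftHom : Multiplicative ℤ →* (Seq E →L[ℝ] Seq E) where
  toFun n := shift n.toAdd
  map_one' := by ext f j; simp
  map_mul' m n := by
    ext f j
    simp [add_assoc]

variable (E) in
/-- The finite-difference operator with symbol a real Laurent polynomial. -/
noncomputable def ev : ℝ[T;T⁻¹] →ₐ[ℝ] (Seq E →L[ℝ] Seq E) :=
  AddMonoidAlgebra.lift ℝ (Seq E →L[ℝ] Seq E) ℤ (shiftHom E)

@[simp] theorem ev_T (n : ℤ) : ev E (T n) = shift n := by
  rw [ev, T, AddMonoidAlgebra.lift_single, one_smul]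
  rfl

@[simp] theorem ev_C (r : ℝ) : ev E (C r) = r • 1 := by
  rw [show C r = algebraMap ℝ ℝ[T;T⁻¹] r from rfl, AlgHom.commutes, Algebra.algebraMap_eq_smul_one]

theorem ev_mul_apply (p q : ℝ[T;T⁻¹]) (f : Seq E) : ev E (p * q) f = ev E p (ev E q f) := by
  rw [map_mul]; rfl

theorem ev_add_apply (p q : ℝ[T;T⁻¹]) (f : Seq E) : ev E (p + q) f = ev E p f + ev E q f := by
  rw [map_add]; rfl

theorem inner_ev (p : ℝ[T;T⁻¹]) (f g : Seq E) : ⟪ev E p f, g⟫ = ⟪f, ev E (invert p) g⟫ := by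
  induction p using LaurentPolynomial.induction_on' generalizing f g with
  | add p q hp hq => simp [inner_add_left, inner_add_right, hp, hq]
  | C_mul_T n a =>
    simp [inner_shift, real_inner_smul_left, real_inner_smul_right]

end Shift
end DGWave
namespace DGWave

open Set MeasureTheory LaurentPolynomial
open scoped RealInnerProductSpace

/-! ### The mass carried by sites far from the origin -/

section Exterior

variable {E : Type*} [NormedAddCommGroup E] [InnerProductSpace ℝ E]

/-- The part of the squared norm carried by the sites `|j| ≥ n`. -/
noncomputable def extNormSq (n : ℤ) (f : Seq E) : ℝ :=
  ∑' j : ℤ, if n ≤ |j| then ‖f j‖ ^ 2 else 0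

omit [InnerProductSpace ℝ E] in
theorem summable_ite_norm_sq (p : ℤ → Prop) [DecidablePred p] (f : Seq E) :
    Summable fun j : ℤ => if p j then ‖f j‖ ^ 2 else 0 := by
  refine Summable.of_nonneg_of_le (fun j => ?_) (fun j => ?_) (summable_norm_sq f)
  · split_ifs <;> positivity
  · split_ifs
    · exact le_rfl
    · positivity

omit [InnerProductSpace ℝ E] in
theorem extNormSq_nonneg (n : ℤ) (f : Seq E) : 0 ≤ extNormSq n f :=
  tsum_nonneg fun j => by split_ifs <;> positivity

omit [InnerProductSpace ℝ E] in
theorem extNormSq_anti {m n : ℤ} (h : m ≤ n) (f : Seq E) : extNormSq n f ≤ extNormSq m f := by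
  refine Summable.tsum_le_tsum (fun j => ?_) (summable_ite_norm_sq _ f) (summable_ite_norm_sq _ f)
  by_cases h1 : n ≤ |j|
  · rw [if_pos h1, if_pos (h.trans h1)]
  · rw [if_neg h1]
    split_ifs <;> positivity

omit [InnerProductSpace ℝ E] in
theorem extNormSq_add_le (n : ℤ) (f g : Seq E) :
    extNormSq n (f + g) ≤ 2 * extNormSq n f + 2 * extNormSq n g := by
  unfold extNormSq
  rw [← tsum_mul_left, ← tsum_mul_left, ← Summable.tsum_add
    ((summable_ite_norm_sq _ f).mul_left 2) ((summable_ite_norm_sq _ g).mul_left 2)]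
  refine Summable.tsum_le_tsum (fun j => ?_) (summable_ite_norm_sq _ _)
    (((summable_ite_norm_sq _ f).mul_left 2).add ((summable_ite_norm_sq _ g).mul_left 2))
  split_ifs
  · have h : ‖(f + g) j‖ ≤ ‖f j‖ + ‖g j‖ := norm_add_le _ _
    nlinarith [sq_nonneg (‖f j‖ - ‖g j‖), norm_nonneg ((f + g) j), norm_nonneg (f j),
      norm_nonneg (g j)]
  · simp

theorem extNormSq_smul (n : ℤ) (r : ℝ) (f : Seq E) :
    extNormSq n (r • f) = r ^ 2 * extNormSq n f := by
  unfold extNormSq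
  rw [← tsum_mul_left]
  refine tsum_congr fun j => ?_
  simp [norm_smul, mul_pow]

theorem extNormSq_shift_le (n k : ℤ) (f : Seq E) :
    extNormSq n (shift k f) ≤ extNormSq (n - |k|) f := by
  have hs := (add_left_injective k : Function.Injective fun j : ℤ => j + k)
  have h1 : Summable fun j : ℤ => if n - |k| ≤ |j + k| then ‖f (j + k)‖ ^ 2 else 0 :=
    (summable_ite_norm_sq (fun j => n - |k| ≤ |j|) f).comp_injective hs
  have h2 : extNormSq (n - |k|) f =
      ∑' j : ℤ, if n - |k| ≤ |j + k| then ‖f (j + k)‖ ^ 2 else 0 :=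
    ((Equiv.addRight k).tsum_eq (fun j => if n - |k| ≤ |j| then ‖f j‖ ^ 2 else 0)).symm
  rw [h2]
  refine Summable.tsum_le_tsum (fun j => ?_) (summable_ite_norm_sq _ _) h1
  rw [shift_apply]
  by_cases h : n ≤ |j|
  · have : n - |k| ≤ |j + k| := by
      have := abs_sub_abs_le_abs_sub j (-k)
      rw [abs_neg, sub_neg_eq_add] at this
      omega
    rw [if_pos h, if_pos this]
  · rw [if_neg h]
    split_ifs <;> positivity

/-- A Laurent polynomial has finitely many terms, so its operator has finite range: the values
outside a ball depend only on the values outside a slightly smaller ball. -/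
theorem exists_extNormSq_ev_le (p : ℝ[T;T⁻¹]) : ∃ (C : ℝ) (ρ : ℤ), 0 ≤ C ∧ 0 ≤ ρ ∧
    ∀ (n : ℤ) (f : Seq E), extNormSq n (ev E p f) ≤ C * extNormSq (n - ρ) f := by
  induction p using LaurentPolynomial.induction_on' with
  | add p q hp hq =>
    obtain ⟨C, ρ, hC, hρ, h⟩ := hp
    obtain ⟨C', ρ', hC', hρ', h'⟩ := hq
    refine ⟨2 * C + 2 * C', max ρ ρ', by positivity, by positivity, fun n f => ?_⟩
    rw [ev_add_apply]
    refine (extNormSq_add_le _ _ _).trans ?_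
    have h1 := extNormSq_anti (show n - max ρ ρ' ≤ n - ρ by omega) f
    have h2 := extNormSq_anti (show n - max ρ ρ' ≤ n - ρ' by omega) f
    have := h n f
    have := h' n f
    nlinarith [mul_le_mul_of_nonneg_left h1 hC, mul_le_mul_of_nonneg_left h2 hC']
  | C_mul_T n a =>
    refine ⟨a ^ 2, |n|, by positivity, by positivity, fun m f => ?_⟩
    rw [ev_mul_apply, ev_C, ev_T]
    change extNormSq m (a • shift n f) ≤ _
    rw [extNormSq_smul]
    gcongr
    exact extNormSq_shift_le _ _ _

end Exterior

/-! ### Truncated position weights -/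

section Weight

variable {E : Type*} [NormedAddCommGroup E] [InnerProductSpace ℝ E]

/-- The position `j`, truncated to `[-N, N]`. -/
def truncPos (N : ℕ) (j : ℤ) : ℝ := ((max (-(N : ℤ)) (min j N) : ℤ) : ℝ)

theorem abs_truncPos_le (N : ℕ) (j : ℤ) : |truncPos N j| ≤ N := by
  rw [truncPos, ← Int.cast_abs]
  have : |max (-(N : ℤ)) (min j N)| ≤ (N : ℤ) := by
    rw [abs_le]; omega
  exact_mod_cast this

/-- Truncation is 1-Lipschitz, so both the true increment and the increment `k` of the untruncated
position are at most `|k|` in absolute value. -/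
theorem abs_truncPos_diff_le (N : ℕ) (j k : ℤ) :
    |truncPos N j - truncPos N (j + k) + k| ≤ 2 * |(k : ℝ)| := by
  rw [truncPos, truncPos]
  have : |max (-(N : ℤ)) (min j N) - max (-(N : ℤ)) (min (j + k) N) + k| ≤ 2 * |k| := by
    rcases abs_cases k with ⟨h, _⟩ | ⟨h, _⟩ <;> rw [h, abs_le] <;> omega
  exact_mod_cast this

/-- If one of the sites lies deeper than `|k|` inside `[-N, N]`, both lie in the range where
truncation is the identity. -/
theorem truncPos_diff_eq_zero (N : ℕ) (j k : ℤ) (h : |j| < N - |k| ∨ |j + k| < N - |k|) :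
    truncPos N j - truncPos N (j + k) + k = 0 := by
  rw [truncPos, truncPos]
  have : max (-(N : ℤ)) (min j N) - max (-(N : ℤ)) (min (j + k) N) + k = 0 := by
    rcases abs_cases k with ⟨h1, _⟩ | ⟨h1, _⟩ <;>
    rcases abs_cases j with ⟨h2, _⟩ | ⟨h2, _⟩ <;>
    rcases abs_cases (j + k) with ⟨h3, _⟩ | ⟨h3, _⟩ <;> rw [h1, h2, h3] at h <;> omega
  exact_mod_cast this

/-- Multiplication by the truncated position. -/
noncomputable def posMul (N : ℕ) : Seq E →L[ℝ] Seq E := mulWeight (truncPos N) N (abs_truncPos_le N)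

theorem norm_posMul_le (N : ℕ) (f : Seq E) : ‖posMul N f‖ ≤ N * ‖f‖ := by
  have := norm_mulWeight_le (truncPos N) N (abs_truncPos_le N) f
  rwa [Nat.abs_cast] at this

theorem inner_posMul_comm (N : ℕ) (f g : Seq E) : ⟪posMul N f, g⟫ = ⟪posMul N g, f⟫ := by
  rw [posMul, inner_mulWeight_comm, real_inner_comm]

/-- Where the truncation is inactive, the commutator of the position with a translation by `k` is
exactly `-k` times that translation. The remainder sits near or beyond `±N`. One `|k|` of margin is
lost to the truncation and another to undoing the translation of `f`. -/
theorem abs_comm_shift_le (N : ℕ) (k : ℤ) (f g : Seq E) :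
    |⟪posMul N (shift k f), g⟫ - ⟪posMul N f, shift (-k) g⟫ + (k : ℝ) * ⟪shift k f, g⟫| ≤
      |(k : ℝ)| * (extNormSq (N - 2 * |k|) f + extNormSq (N - 2 * |k|) g) := by
  have e : ⟪posMul N (shift k f), g⟫ - ⟪posMul N f, shift (-k) g⟫ + (k : ℝ) * ⟪shift k f, g⟫ =
      ∑' j : ℤ, (truncPos N j - truncPos N (j + k) + k) * ⟪f (j + k), g j⟫ := by
    rw [← inner_shift]
    have s1 := lp.hasSum_inner (𝕜 := ℝ) (posMul N (shift k f)) g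
    have s2 := lp.hasSum_inner (𝕜 := ℝ) (shift k (posMul N f)) g
    have s3 := (lp.hasSum_inner (𝕜 := ℝ) (shift k f) g).mul_left (k : ℝ)
    rw [← ((s1.sub s2).add s3).tsum_eq]
    refine tsum_congr fun j => ?_
    simp only [posMul, mulWeight_apply, shift_apply, real_inner_smul_left]
    ring
  have key : ∀ j : ℤ, ‖(truncPos N j - truncPos N (j + k) + k) * ⟪f (j + k), g j⟫‖ ≤
      |(k : ℝ)| * ((if (N : ℤ) - |k| ≤ |j| then ‖shift k f j‖ ^ 2 else 0) +
        (if (N : ℤ) - |k| ≤ |j| then ‖g j‖ ^ 2 else 0)) := by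
    intro j
    by_cases h : (N : ℤ) - |k| ≤ |j|
    · rw [if_pos h, if_pos h, norm_mul, Real.norm_eq_abs, Real.norm_eq_abs, shift_apply]
      have h1 := abs_truncPos_diff_le N j k
      have h2 := abs_real_inner_le_norm (f (j + k)) (g j)
      -- The factor 2 is absorbed by `2ab ≤ a² + b²`.
      calc _ ≤ (2 * |(k : ℝ)|) * (‖f (j + k)‖ * ‖g j‖) := by gcongr
        _ ≤ _ := by
          nlinarith [mul_nonneg (abs_nonneg (k : ℝ)) (sq_nonneg (‖f (j + k)‖ - ‖g j‖))]
    · rw [truncPos_diff_eq_zero N j k (Or.inl (by omega)), if_neg h, if_neg h]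
      simp
  have hs := ((summable_ite_norm_sq (fun j => (N : ℤ) - |k| ≤ |j|) (shift k f)).add
    (summable_ite_norm_sq (fun j => (N : ℤ) - |k| ≤ |j|) g)).mul_left |(k : ℝ)|
  rw [e, ← Real.norm_eq_abs]
  refine (tsum_of_norm_bounded hs.hasSum key).trans ?_
  rw [tsum_mul_left, Summable.tsum_add (summable_ite_norm_sq _ _) (summable_ite_norm_sq _ _)]
  have h1 := extNormSq_shift_le ((N : ℤ) - |k|) k f
  rw [show (N : ℤ) - |k| - |k| = N - 2 * |k| by ring] at h1
  have h2 := extNormSq_anti (show (N : ℤ) - 2 * |k| ≤ N - |k| by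
    have := abs_nonneg k; omega) g
  exact mul_le_mul_of_nonneg_left (add_le_add h1 h2) (abs_nonneg _)

variable (E) in
/-- `p'` is the derivative `S ∂ₛ p` of the symbol `p`, in the sense that commutators with the
truncated position equal `p'` up to terms carried by the sites beyond the truncation. -/
def HasCommutator (p p' : ℝ[T;T⁻¹]) : Prop :=
  ∃ (C : ℝ) (ρ : ℤ), 0 ≤ C ∧ 0 ≤ ρ ∧ ∀ (N : ℕ) (f g : Seq E),
    |⟪posMul N (ev E p f), g⟫ - ⟪posMul N f, ev E (invert p) g⟫ + ⟪ev E p' f, g⟫| ≤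
      C * (extNormSq (N - ρ) f + extNormSq (N - ρ) g)

theorem hasCommutator_T (k : ℤ) : HasCommutator E (T k) (C (k : ℝ) * T k) := by
  refine ⟨|(k : ℝ)|, 2 * |k|, abs_nonneg _, by positivity, fun N f g => ?_⟩
  rw [ev_mul_apply, ev_C, ev_T, invert_T, ev_T, smul_apply,
    one_apply_eq_self, real_inner_smul_left]
  exact abs_comm_shift_le N k f g

theorem HasCommutator.add {p p' q q' : ℝ[T;T⁻¹]} (hp : HasCommutator E p p')
    (hq : HasCommutator E q q') : HasCommutator E (p + q) (p' + q') := by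
  obtain ⟨C, ρ, hC, hρ, h⟩ := hp
  obtain ⟨C', ρ', hC', hρ', h'⟩ := hq
  refine ⟨C + C', max ρ ρ', by positivity, by positivity, fun N f g => ?_⟩
  have h1 := extNormSq_anti (E := E) (show (N : ℤ) - max ρ ρ' ≤ N - ρ by omega)
  have h2 := extNormSq_anti (E := E) (show (N : ℤ) - max ρ ρ' ≤ N - ρ' by omega)
  have e1 := (h N f g).trans (mul_le_mul_of_nonneg_left (add_le_add (h1 f) (h1 g)) hC)
  have e2 := (h' N f g).trans (mul_le_mul_of_nonneg_left (add_le_add (h2 f) (h2 g)) hC')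
  rw [abs_le] at e1 e2 ⊢
  simp only [map_add, add_apply, inner_add_left, inner_add_right]
  constructor <;> linarith [e1.1, e1.2, e2.1, e2.2]

end Weight

/-! ### The Euler derivation as commutator with the position -/

section Euler

/-- The Euler derivation `S ∂ₛ` of Laurent polynomials, as a linear map. -/
noncomputable def eulerLinear : ℝ[T;T⁻¹] →ₗ[ℝ] ℝ[T;T⁻¹] where
  toFun p := p.coeff.sum fun n a => C (n * a) * T n
  map_add' p q := by
    rw [AddMonoidAlgebra.coeff_add, Finsupp.sum_add_index']
    · simp
    · intro n a b
      rw [mul_add, map_add, add_mul]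
  map_smul' r p := by
    rw [AddMonoidAlgebra.coeff_smul, Finsupp.sum_smul_index', Finsupp.smul_sum]
    · refine Finsupp.sum_congr fun n _ => ?_
      rw [smul_eq_mul, RingHom.id_apply, smul_eq_C_mul]
      simp only [map_mul]
      ring
    · simp

theorem eulerLinear_C_mul_T (n : ℤ) (a : ℝ) : eulerLinear (C a * T n) = C (n * a) * T n := by
  rw [← single_eq_C_mul_T]
  change Finsupp.sum (AddMonoidAlgebra.single n a).coeff (fun n a => C (n * a) * T n) = _
  rw [AddMonoidAlgebra.coeff_single, Finsupp.sum_single_index (by simp)]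

/-- The Euler derivation `S ∂ₛ` of Laurent polynomials. -/
noncomputable def eulerD : Derivation ℝ ℝ[T;T⁻¹] ℝ[T;T⁻¹] :=
  Derivation.mk' eulerLinear fun p q => by
    induction p using LaurentPolynomial.induction_on' with
    | add p p' h h' => rw [add_mul, map_add, h, h', map_add]; simp only [smul_eq_mul]; ring
    | C_mul_T m a =>
      induction q using LaurentPolynomial.induction_on' with
      | add q q' h h' => rw [mul_add, map_add, h, h', map_add]; simp only [smul_eq_mul]; ring
      | C_mul_T n b =>
        rw [show (C a * T m * (C b * T n) : ℝ[T;T⁻¹]) = C (a * b) * T (m + n) by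
          rw [map_mul, T_add]; ring, eulerLinear_C_mul_T, eulerLinear_C_mul_T,
          eulerLinear_C_mul_T, T_add]
        simp only [smul_eq_mul, map_mul, Int.cast_add, map_add]
        ring

theorem eulerD_C_mul_T (n : ℤ) (a : ℝ) : eulerD (C a * T n) = C (n * a) * T n :=
  eulerLinear_C_mul_T n a

variable {E : Type*} [NormedAddCommGroup E] [InnerProductSpace ℝ E]

theorem HasCommutator.const_mul {p p' : ℝ[T;T⁻¹]} (a : ℝ) (hp : HasCommutator E p p') :
    HasCommutator E (C a * p) (C a * p') := by
  obtain ⟨K, ρ, hK, hρ, h⟩ := hp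
  refine ⟨|a| * K, ρ, by positivity, hρ, fun N f g => ?_⟩
  have e := mul_le_mul_of_nonneg_left (h N f g) (abs_nonneg a)
  rw [← abs_mul] at e
  rw [mul_assoc]
  refine le_of_eq_of_le (congrArg _ ?_) e
  simp only [map_mul (invert (R := ℝ)), ev_mul_apply, invert_C, ev_C, smul_apply,
    one_apply_eq_self, map_smul, real_inner_smul_left, real_inner_smul_right]
  ring

/-- Everything is linear in the symbol, so monomials suffice, and these are multiples of single
translations. -/
theorem hasCommutator_eulerD (p : ℝ[T;T⁻¹]) : HasCommutator E p (eulerD p) := by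
  induction p using LaurentPolynomial.induction_on' with
  | add p q hp hq => rw [map_add]; exact hp.add hq
  | C_mul_T n a =>
    rw [eulerD_C_mul_T, mul_comm (n : ℝ), map_mul, mul_assoc]
    exact (hasCommutator_T n).const_mul a

end Euler
end DGWave
namespace DGWave

open Set MeasureTheory LaurentPolynomial
open scoped RealInnerProductSpace

/-! ### Weighted identities modulo exterior terms -/

section Negligible

variable {E : Type*} [NormedAddCommGroup E] [InnerProductSpace ℝ E]

/-- The part of the squared norm of a quadruple carried by the sites `|j| ≥ n`. -/
noncomputable def extSum (n : ℤ) (D J v y : Seq E) : ℝ :=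
  extNormSq n D + extNormSq n J + extNormSq n v + extNormSq n y

omit [InnerProductSpace ℝ E] in
theorem extSum_anti {m n : ℤ} (h : m ≤ n) (D J v y : Seq E) :
    extSum n D J v y ≤ extSum m D J v y := by
  unfold extSum
  gcongr <;> exact extNormSq_anti h _

/-- A family of functions of a quadruple of sequences which is controlled, uniformly, by the part
of the quadruple outside a fixed enlargement of the complement of `[-N, N]`. -/
def Negligible (F : ℕ → Seq E → Seq E → Seq E → Seq E → ℝ) : Prop :=
  ∃ (C : ℝ) (ρ : ℤ), 0 ≤ C ∧ 0 ≤ ρ ∧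
    ∀ N D J v y, |F N D J v y| ≤ C * extSum (N - ρ) D J v y

omit [InnerProductSpace ℝ E] in
theorem Negligible.add {F G : ℕ → Seq E → Seq E → Seq E → Seq E → ℝ} (hF : Negligible F)
    (hG : Negligible G) : Negligible fun N D J v y => F N D J v y + G N D J v y := by
  obtain ⟨C, ρ, hC, hρ, h⟩ := hF
  obtain ⟨C', ρ', hC', hρ', h'⟩ := hG
  refine ⟨C + C', max ρ ρ', by positivity, by positivity, fun N D J v y => ?_⟩
  have h1 := mul_le_mul_of_nonneg_left
    (extSum_anti (show (N : ℤ) - max ρ ρ' ≤ N - ρ by omega) D J v y) hC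
  have h2 := mul_le_mul_of_nonneg_left
    (extSum_anti (show (N : ℤ) - max ρ ρ' ≤ N - ρ' by omega) D J v y) hC'
  have := abs_add_le (F N D J v y) (G N D J v y)
  linarith [h N D J v y, h' N D J v y]

omit [InnerProductSpace ℝ E] in
theorem Negligible.const_mul {F : ℕ → Seq E → Seq E → Seq E → Seq E → ℝ} (a : ℝ)
    (hF : Negligible F) : Negligible fun N D J v y => a * F N D J v y := by
  obtain ⟨C, ρ, hC, hρ, h⟩ := hF
  refine ⟨|a| * C, ρ, by positivity, hρ, fun N D J v y => ?_⟩
  rw [abs_mul, mul_assoc]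
  exact mul_le_mul_of_nonneg_left (h N D J v y) (abs_nonneg a)

/-- A coordinate of a quadruple of sequences, bounded by the quadruple outside every ball. -/
def IsCoord (X : Seq E → Seq E → Seq E → Seq E → Seq E) : Prop :=
  ∀ n D J v y, extNormSq n (X D J v y) ≤ extSum n D J v y

variable {X Y : Seq E → Seq E → Seq E → Seq E → Seq E}

/-- This brings weighted terms to a normal form with no operator under the weight: moving `p` to the
other factor costs a commutator, and the commutator carries no weight any more. -/
theorem negligible_weighted (hX : IsCoord X) (hY : IsCoord Y) (p q : ℝ[T;T⁻¹]) :
    Negligible fun N D J v y =>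
      ⟪posMul N (ev E p (X D J v y)), ev E q (Y D J v y)⟫
        - ⟪posMul N (X D J v y), ev E (invert p * q) (Y D J v y)⟫
        + ⟪X D J v y, ev E (invert (eulerD p) * q) (Y D J v y)⟫ := by
  obtain ⟨C, ρ, hC, hρ, h⟩ := hasCommutator_eulerD (E := E) p
  obtain ⟨C', ρ', hC', hρ', h'⟩ := exists_extNormSq_ev_le (E := E) q
  refine ⟨C * (1 + C'), ρ + ρ', by positivity, by positivity, fun N D J v y => ?_⟩
  beta_reduce
  rw [ev_mul_apply, ev_mul_apply, ← inner_ev (eulerD p)]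
  refine (h N _ _).trans ?_
  rw [mul_assoc]
  refine mul_le_mul_of_nonneg_left ?_ hC
  have h1 := (hX (N - ρ) D J v y).trans
    (extSum_anti (show (N : ℤ) - (ρ + ρ') ≤ N - ρ by omega) D J v y)
  have h2 := (h' (N - ρ) (Y D J v y)).trans
    (mul_le_mul_of_nonneg_left (hY (N - ρ - ρ') D J v y) hC')
  rw [show (N : ℤ) - ρ - ρ' = N - (ρ + ρ') by ring] at h2
  linarith

/-- For an antisymmetric symbol the adjoint move returns minus the same term, so the weighted term
is half a commutator. This is how the large weight disappears from the diagonal blocks. -/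
theorem negligible_weighted_antisymm (hX : IsCoord X) {q : ℝ[T;T⁻¹]} (hq : invert q = -q) :
    Negligible fun N D J v y =>
      2 * ⟪posMul N (X D J v y), ev E q (X D J v y)⟫
        + ⟪X D J v y, ev E (invert (eulerD q)) (X D J v y)⟫ := by
  obtain ⟨C, ρ, hC, hρ, h⟩ := negligible_weighted hX hX q 1
  refine ⟨C, ρ, hC, hρ, fun N D J v y => ?_⟩
  refine le_of_eq_of_le (congrArg _ ?_) (h N D J v y)
  beta_reduce
  rw [mul_one, mul_one, hq, map_neg, map_one, inner_posMul_comm N (ev E q _)]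
  simp only [one_apply_eq_self, neg_apply, inner_neg_right]
  ring

end Negligible

/-! ### Quadratic forms with Laurent polynomial symbols and the virial identity -/

section Forms

variable {E : Type*} [NormedAddCommGroup E] [InnerProductSpace ℝ E]

theorem inner_ev_ev (p q : ℝ[T;T⁻¹]) (f g : Seq E) :
    ⟪ev E p f, ev E q g⟫ = ⟪f, ev E (invert p * q) g⟫ := by
  rw [inner_ev, ev_mul_apply]

theorem inner_ev_swap (p : ℝ[T;T⁻¹]) (f g : Seq E) :
    ⟪f, ev E p g⟫ = ⟪g, ev E (invert p) f⟫ := by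
  rw [real_inner_comm, inner_ev]

/-- A quadratic form sees only the symmetric part of its symbol. For this reason the conditions
`tDD`, `tJJ`, `tVV`, `tYY` of `virial_identity` are imposed only modulo antisymmetric symbols. -/
theorem inner_ev_self_eq_zero {p : ℝ[T;T⁻¹]} (hp : p + invert p = 0) (f : Seq E) :
    ⟪f, ev E p f⟫ = 0 := by
  have h := inner_ev_swap p f f
  rw [eq_neg_of_add_eq_zero_right hp, map_neg, neg_apply, inner_neg_right] at h
  linarith

theorem invert_invert (p : ℝ[T;T⁻¹]) : invert (invert p) = p := involutive_invert p

/-- The virial identity for the system `D' = δ v`, `J' = y`, `v' = α D + γ J`, `y' = φ D + ψ J`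
with finite-difference symbols: under algebraic conditions on the symbols, the derivative of the
position-weighted form with symbols `kᵢ` plus the translation-invariant form with symbols `nᵢ` is
the form with symbols `eᵢⱼ`, up to exterior terms. -/
theorem virial_identity {δ α γ φ ψ k₁ k₂ k₃ k₄ n₁ n₂ n₃ n₄ eDD eJJ eDJ eVV eYY eVY : ℝ[T;T⁻¹]}
    (aDD : invert (invert α * k₁ + invert φ * k₃) = -(invert α * k₁ + invert φ * k₃))
    (aJJ : invert (invert γ * k₂ + invert ψ * k₄) = -(invert γ * k₂ + invert ψ * k₄))
    (aDJ : invert α * k₂ + invert k₁ * γ + invert φ * k₄ + invert k₃ * ψ = 0)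
    (aVV : invert (k₁ * δ) = -(k₁ * δ)) (aYY : invert k₄ = -k₄)
    (aVY : k₂ + invert (k₃ * δ) = 0)
    (tDD : ∀ q, q = -2 * invert (eulerD (invert α * k₁ + invert φ * k₃))
        - 4 * (invert (eulerD α) * k₁ + invert (eulerD φ) * k₃)
        + (invert α * n₁ + invert φ * n₃) - eDD → q + invert q = 0)
    (tJJ : ∀ q, q = -2 * invert (eulerD (invert γ * k₂ + invert ψ * k₄))
        - 4 * (invert (eulerD γ) * k₂ + invert (eulerD ψ) * k₄)
        + (invert γ * n₂ + invert ψ * n₄) - eJJ → q + invert q = 0)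
    (tDJ : -4 * (invert (eulerD α) * k₂ + invert (eulerD k₁) * γ + invert (eulerD φ) * k₄
        + invert (eulerD k₃) * ψ)
        + (invert α * n₂ + invert n₁ * γ + invert φ * n₄ + invert n₃ * ψ) - eDJ = 0)
    (tVV : ∀ q, q = -2 * invert (eulerD (k₁ * δ)) + n₁ * δ - eVV → q + invert q = 0)
    (tYY : ∀ q, q = -2 * invert (eulerD k₄) + n₄ - eYY → q + invert q = 0)
    (tVY : -4 * invert (eulerD (k₃ * δ)) + n₂ + invert (n₃ * δ) - eVY = 0) :
    Negligible fun N D J v y =>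
      4 * (⟪posMul N (ev E α D + ev E γ J), ev E k₁ D + ev E k₂ J⟫
          + ⟪posMul N v, ev E k₁ (ev E δ v) + ev E k₂ y⟫
          + ⟪posMul N (ev E φ D + ev E ψ J), ev E k₃ D + ev E k₄ J⟫
          + ⟪posMul N y, ev E k₃ (ev E δ v) + ev E k₄ y⟫)
        + (⟪ev E α D + ev E γ J, ev E n₁ D + ev E n₂ J⟫
          + ⟪v, ev E n₁ (ev E δ v) + ev E n₂ y⟫
          + ⟪ev E φ D + ev E ψ J, ev E n₃ D + ev E n₄ J⟫
          + ⟪y, ev E n₃ (ev E δ v) + ev E n₄ y⟫)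
        - (⟪D, ev E eDD D⟫ + ⟪J, ev E eJJ J⟫ + ⟪D, ev E eDJ J⟫
          + ⟪v, ev E eVV v⟫ + ⟪y, ev E eYY y⟫ + ⟪v, ev E eVY y⟫) := by
  have cD : IsCoord (E := E) fun D _ _ _ => D := fun n D J v y => by
    have := extNormSq_nonneg n J
    have := extNormSq_nonneg n v
    have := extNormSq_nonneg n y
    unfold extSum; linarith
  have cJ : IsCoord (E := E) fun _ J _ _ => J := fun n D J v y => by
    have := extNormSq_nonneg n D
    have := extNormSq_nonneg n v
    have := extNormSq_nonneg n y
    unfold extSum; linarith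
  have cV : IsCoord (E := E) fun _ _ v _ => v := fun n D J v y => by
    have := extNormSq_nonneg n D
    have := extNormSq_nonneg n J
    have := extNormSq_nonneg n y
    unfold extSum; linarith
  have cY : IsCoord (E := E) fun _ _ _ y => y := fun n D J v y => by
    have := extNormSq_nonneg n D
    have := extNormSq_nonneg n J
    have := extNormSq_nonneg n v
    unfold extSum; linarith
  -- These moves normalise the weighted products that occur. The mixed weights then cancel by `aDJ`
  -- and `aVY`, and the diagonal ones are antisymmetric.
  have main := ((((negligible_weighted cD cD α k₁).add (negligible_weighted cD cD φ k₃)).add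
    (((negligible_weighted cD cJ α k₂).add (negligible_weighted cD cJ k₁ γ)).add
      ((negligible_weighted cD cJ φ k₄).add (negligible_weighted cD cJ k₃ ψ)))).add
    (((negligible_weighted cJ cJ γ k₂).add (negligible_weighted cJ cJ ψ k₄)).add
      (negligible_weighted cV cY (k₃ * δ) 1))).const_mul 4
  -- The factor is 2 here against 4 above because the antisymmetric lemma already concerns twice the
  -- weighted term.
  have main2 := (((negligible_weighted_antisymm cD aDD).add
    (negligible_weighted_antisymm cJ aJJ)).add
    ((negligible_weighted_antisymm cV aVV).add (negligible_weighted_antisymm cY aYY))).const_mul 2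
  obtain ⟨C, ρ, hC, hρ, h⟩ := main.add main2
  refine ⟨C, ρ, hC, hρ, fun N D J v y => ?_⟩
  refine le_of_eq_of_le (congrArg _ ?_) (h N D J v y)
  have zDD := inner_ev_self_eq_zero (tDD _ rfl) D
  have zJJ := inner_ev_self_eq_zero (tJJ _ rfl) J
  have zVV := inner_ev_self_eq_zero (tVV _ rfl) v
  have zYY := inner_ev_self_eq_zero (tYY _ rfl) y
  have zDJ := congrArg (fun p => ⟪D, ev E p J⟫) tDJ
  have zVY := congrArg (fun p => ⟪v, ev E p y⟫) tVY
  have wDJ := congrArg (fun p => ⟪posMul N D, ev E p J⟫) aDJ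
  have wVY := congrArg (fun p => ⟪posMul N v, ev E p y⟫) aVY
  have s1 : ⟪posMul N (ev E γ J), ev E k₁ D⟫ = ⟪posMul N (ev E k₁ D), ev E γ J⟫ :=
    inner_posMul_comm _ _ _
  have s2 : ⟪posMul N (ev E ψ J), ev E k₃ D⟫ = ⟪posMul N (ev E k₃ D), ev E ψ J⟫ :=
    inner_posMul_comm _ _ _
  have s3 : ⟪posMul N y, ev E k₃ (ev E δ v)⟫ = ⟪posMul N (ev E (k₃ * δ) v), y⟫ := by
    rw [inner_posMul_comm, ev_mul_apply]
  have s4 : ⟪ev E γ J, ev E n₁ D⟫ = ⟪D, ev E (invert n₁ * γ) J⟫ := by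
    rw [real_inner_comm, inner_ev_ev]
  have s5 : ⟪ev E ψ J, ev E n₃ D⟫ = ⟪D, ev E (invert n₃ * ψ) J⟫ := by
    rw [real_inner_comm, inner_ev_ev]
  have s6 : ⟪y, ev E n₃ (ev E δ v)⟫ = ⟪v, ev E (invert (n₃ * δ)) y⟫ := by
    rw [← ev_mul_apply, inner_ev_swap]
  have s7 : ∀ f : Seq E, ev E k₁ (ev E δ f) = ev E (k₁ * δ) f := fun f => (ev_mul_apply _ _ _).symm
  have s8 : ∀ f : Seq E, ev E n₁ (ev E δ f) = ev E (n₁ * δ) f := fun f => (ev_mul_apply _ _ _).symm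
  have c2 : ∀ (p : ℝ[T;T⁻¹]) (f : Seq E), ev E (-2 * p) f = (-2 : ℝ) • ev E p f := fun p f => by
    rw [show (-2 : ℝ[T;T⁻¹]) = LaurentPolynomial.C (-2) by rw [map_neg, map_ofNat], ev_mul_apply, ev_C]; rfl
  have c4 : ∀ (p : ℝ[T;T⁻¹]) (f : Seq E), ev E (4 * p) f = (4 : ℝ) • ev E p f := fun p f => by
    rw [show (4 : ℝ[T;T⁻¹]) = LaurentPolynomial.C 4 by rw [map_ofNat], ev_mul_apply, ev_C]; rfl
  have c4' : ∀ (p : ℝ[T;T⁻¹]) (f : Seq E), ev E (-4 * p) f = (-4 : ℝ) • ev E p f := fun p f => by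
    rw [show (-4 : ℝ[T;T⁻¹]) = LaurentPolynomial.C (-4) by rw [map_neg, map_ofNat], ev_mul_apply, ev_C]; rfl
  simp only [map_add, map_sub, map_zero, add_apply, sub_apply, zero_apply, c2, c4, c4',
    inner_add_right, inner_sub_right, inner_add_left, real_inner_smul_right, inner_zero_right,
    mul_one, map_one, one_apply_eq_self, s1, s2, s3, s4, s5, s6, s7, s8, inner_ev_ev]
    at zDD zJJ zVV zYY zDJ zVY wDJ wVY ⊢
  linarith

end Forms
end DGWave
namespace DGWave

open Set MeasureTheory LaurentPolynomial
open scoped RealInnerProductSpace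

/-! ### The symbols of the interior penalty wave equation -/

section Symbols

/-- The symbol `(S + S⁻¹) / 2`. -/
noncomputable def cs : ℝ[T;T⁻¹] := C (1 / 2) * T 1 + C (1 / 2) * T (-1)

/-- The symbol `(S - S⁻¹) / 2`. -/
noncomputable def sn : ℝ[T;T⁻¹] := C (1 / 2) * T 1 - C (1 / 2) * T (-1)

theorem half_add_half : (C (1 / 2) + C (1 / 2) : ℝ[T;T⁻¹]) = 1 := by
  rw [← map_add, add_halves, map_one]

theorem cs_add_sn : cs + sn = T 1 := by
  rw [cs, sn]; linear_combination (T 1) * half_add_half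

theorem cs_sub_sn : cs - sn = T (-1) := by
  rw [cs, sn]; linear_combination (T (-1)) * half_add_half

/-- This is `cos² + sin² = 1`, the relation modulo which the symbol identities below are checked. -/
theorem cs_sq_sub_sn_sq : cs ^ 2 - sn ^ 2 - 1 = 0 := by
  have h : (T 1 * T (-1) : ℝ[T;T⁻¹]) = 1 := by rw [← T_add]; simp
  linear_combination h + cs_add_sn * (cs - sn) + cs_sub_sn * T 1

@[simp] theorem invert_cs : invert cs = cs := by
  simp [cs, add_comm]

@[simp] theorem invert_sn : invert sn = -sn := by
  simp [sn]

@[simp] theorem eulerD_cs : eulerD cs = sn := by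
  rw [cs, sn]
  simp only [map_add, map_sub, eulerD_C_mul_T]
  simp [sub_eq_add_neg]

@[simp] theorem eulerD_sn : eulerD sn = cs := by
  rw [cs, sn]
  simp only [map_add, map_sub, eulerD_C_mul_T]
  simp [sub_eq_add_neg]

@[simp] theorem eulerD_C (r : ℝ) : eulerD (C r) = 0 :=
  eulerD.map_algebraMap r


/-! With `s` the penalty parameter, the first-order form of the equation for the differences `D` of
the averages, the jumps `J` and the scaled velocities `v`, `y` is `D' = δ v`, `J' = y`,
`v' = α D + γ J`, `y' = φ D + ψ J`. -/

variable (s : ℝ)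

/-- The symbol of twice the jump block of the stiffness matrix. -/
noncomputable def symR : ℝ[T;T⁻¹] :=
  2 * C s - 1 - cs

/-- The symbol `δ`. -/
noncomputable def symDelta : ℝ[T;T⁻¹] :=
  cs + sn - 1

/-- The symbol `α`. -/
noncomputable def symAlpha : ℝ[T;T⁻¹] :=
  (2 - cs) * (1 - cs + sn)

/-- The symbol `γ`. -/
noncomputable def symGamma : ℝ[T;T⁻¹] :=
  sn * symR s

/-- The symbol `φ`. -/
noncomputable def symPhi : ℝ[T;T⁻¹] :=
  2 * sn * (1 - cs + sn)

/-- The symbol `ψ`. -/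
noncomputable def symPsi : ℝ[T;T⁻¹] :=
  -2 * (2 + cs) * symR s

/-- An auxiliary factor of the multipliers. -/
noncomputable def symB : ℝ[T;T⁻¹] :=
  2 * C s + (C s - 3) * cs

/-- A symbol of the position-weighted multiplier. -/
noncomputable def symK₁ : ℝ[T;T⁻¹] :=
  (1 + cs - sn) * (symR s * (12 * (1 - cs) - 4 * symB s * (2 + cs)))

/-- A symbol of the position-weighted multiplier. -/
noncomputable def symK₂ : ℝ[T;T⁻¹] :=
  -4 * symR s * symB s * (cs * cs - 1)

/-- A symbol of the position-weighted multiplier. -/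
noncomputable def symK₃ : ℝ[T;T⁻¹] :=
  (1 + cs - sn) * (2 * symR s * symB s * sn)

/-- A symbol of the position-weighted multiplier. -/
noncomputable def symK₄ : ℝ[T;T⁻¹] :=
  sn * symR s * (6 * symR s - 2 * symB s * (2 - cs))

/-- A symbol of the translation-invariant correction. -/
noncomputable def symN₁ : ℝ[T;T⁻¹] :=
  -(1 - cs + sn) * (-28 * cs ^ 3 * C s + 84 * cs ^ 3 + 48 * cs ^ 2 * C s ^ 2 - 264 * cs ^ 2 * C s + 204 * cs ^ 2 + 152 * cs * C s ^ 2
    - 392 * cs * C s + 192 * cs + 112 * C s ^ 2 - 180 * C s + 72)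

/-- A symbol of the translation-invariant correction. -/
noncomputable def symN₂ : ℝ[T;T⁻¹] :=
  sn * (28 * cs ^ 3 * C s - 84 * cs ^ 3 - 48 * cs ^ 2 * C s ^ 2 + 180 * cs ^ 2 * C s - 36 * cs ^ 2 - 8 * cs * C s ^ 2 - 100 * cs * C s + 84 * cs + 56 * C s ^ 2
    - 108 * C s + 36)

/-- A symbol of the translation-invariant correction. -/
noncomputable def symN₃ : ℝ[T;T⁻¹] :=
  (1 + cs - sn) * (-14 * cs ^ 3 * C s + 42 * cs ^ 3 + 24 * cs ^ 2 * C s ^ 2 - 106 * cs ^ 2 * C s + 42 * cs ^ 2 + 36 * cs * C s ^ 2 - 22 * cs * C s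
    - 18 * cs - 12 * C s ^ 2 + 46 * C s - 18)

/-- A symbol of the translation-invariant correction. -/
noncomputable def symN₄ : ℝ[T;T⁻¹] :=
  -14 * cs ^ 4 * C s + 42 * cs ^ 4 + 24 * cs ^ 3 * C s ^ 2 - 78 * cs ^ 3 * C s - 12 * cs ^ 2 * C s ^ 2 + 64 * cs ^ 2 * C s - 42 * cs ^ 2 + 18 * cs * C s + 12 * cs
    + 12 * C s ^ 2 - 38 * C s + 12

/-- The multiplier of the energy in the virial form. -/
noncomputable def symP₀ : ℝ[T;T⁻¹] :=
  2 * (1 + cs) * (6 * (C s - 1) ^ 2 + (C s - 1) * (1 - cs) * (5 + cs) + 2 * (1 - cs) ^ 2)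

/-- The multiplier of the energy of the time derivative in the virial form. -/
noncomputable def symP₁ : ℝ[T;T⁻¹] :=
  -((1 + cs) * (C s - 1 + (1 - cs)))

/-- The `DD` symbol of the virial form. -/
noncomputable def virDD : ℝ[T;T⁻¹] :=
  12 * (symP₀ s + symP₁ s * (2 * (2 - cs) * (1 - cs)))

/-- The `JJ` symbol of the virial form. -/
noncomputable def virJJ : ℝ[T;T⁻¹] :=
  6 * symP₀ s * symR s + 12 * symP₁ s * (2 + cs) * symR s * symR s

/-- The `DJ` symbol of the virial form. -/
noncomputable def virDJ : ℝ[T;T⁻¹] :=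
  24 * symP₁ s * (1 - cs - sn) * sn * symR s

/-- The `VV` symbol of the virial form. -/
noncomputable def virVV : ℝ[T;T⁻¹] :=
  4 * symP₀ s * (2 + cs) + 24 * symP₁ s * (1 - cs)

/-- The `YY` symbol of the virial form. -/
noncomputable def virYY : ℝ[T;T⁻¹] :=
  symP₀ s * (2 - cs) + 6 * symP₁ s * symR s

/-- The `VY` symbol of the virial form. -/
noncomputable def virVY : ℝ[T;T⁻¹] :=
  4 * symP₀ s * sn

@[simp] theorem eulerD_ofNat (n : ℕ) [n.AtLeastTwo] :
    eulerD (ofNat(n) : ℝ[T;T⁻¹]) = 0 :=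
  eulerD.map_natCast n

/-- The six `virial_weight` identities express that the position weight survives only in
commutators: the diagonal blocks are antisymmetric and the mixed blocks vanish. -/
theorem virial_weight_DD :
    invert (invert symAlpha * (symK₁ s) + invert symPhi * (symK₃ s)) + (invert symAlpha * (symK₁ s) + invert symPhi * (symK₃ s)) = 0 := by
  have h := cs_sq_sub_sn_sq
  simp only [symR, symAlpha, symPhi, symB, symK₁, symK₃, map_add, map_sub, map_neg, map_mul, map_pow,
    map_one, map_ofNat, invert_cs, invert_sn, invert_C, map_zero]
  -- What remains is a polynomial identity in free variables modulo `c² - d² = 1`; the coefficient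
  -- of `h` is the quotient by this relation.
  generalize cs = c at h ⊢
  generalize sn = d at h ⊢
  generalize (C s : ℝ[T;T⁻¹]) = k
  linear_combination (
    8 * c ^ 4 * k - 24 * c ^ 4 - 16 * c ^ 3 * k ^ 2 + 72 * c ^ 3 * k - 8 * c ^ 2 * d ^ 2 * k
      + 24 * c ^ 2 * d ^ 2 - 32 * c ^ 2 * k ^ 2 - 64 * c ^ 2 * k + 48 * c ^ 2 + 16 * c * d ^
      2 * k ^ 2 - 72 * c * d ^ 2 * k + 24 * c * d ^ 2 + 64 * c * k ^ 2 - 144 * c * k + 72 *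
      c + 32 * d ^ 2 * k ^ 2 - 16 * d ^ 2 * k + 128 * k ^ 2 - 160 * k + 48) * h

theorem virial_weight_JJ :
    invert (invert (symGamma s) * (symK₂ s) + invert (symPsi s) * (symK₄ s)) + (invert (symGamma s) * (symK₂ s) + invert (symPsi s) * (symK₄ s)) = 0 := by
  have h := cs_sq_sub_sn_sq
  simp only [symR, symGamma, symPsi, symB, symK₂, symK₄, map_add, map_sub, map_neg, map_mul, map_pow,
    map_one, map_ofNat, invert_cs, invert_sn, invert_C, map_zero]
  generalize cs = c at h ⊢
  generalize sn = d at h ⊢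
  generalize (C s : ℝ[T;T⁻¹]) = k
  ring

theorem virial_weight_DJ :
    invert symAlpha * (symK₂ s) + invert (symK₁ s) * (symGamma s) + invert symPhi * (symK₄ s) + invert (symK₃ s) * (symPsi s) = 0 := by
  have h := cs_sq_sub_sn_sq
  simp only [symR, symAlpha, symGamma, symPhi, symPsi, symB, symK₁, symK₂, symK₃, symK₄, map_add,
    map_sub, map_neg, map_mul, map_pow, map_one, map_ofNat, invert_cs, invert_sn, invert_C,
    map_zero]
  generalize cs = c at h ⊢
  generalize sn = d at h ⊢
  generalize (C s : ℝ[T;T⁻¹]) = k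
  linear_combination (
    4 * c ^ 4 * k - 12 * c ^ 4 + 4 * c ^ 3 * d * k - 12 * c ^ 3 * d - 8 * c ^ 3 * k ^ 2 + 24
      * c ^ 3 * k + 24 * c ^ 3 - 8 * c ^ 2 * d * k ^ 2 + 28 * c ^ 2 * d * k + 8 * c ^ 2 * k
      ^ 2 - 92 * c ^ 2 * k + 12 * c ^ 2 - 16 * c * d * k + 32 * c * k ^ 2 + 48 * c * k - 24
      * c - 16 * d * k ^ 2 + 32 * d * k - 12 * d - 32 * k ^ 2 + 16 * k) * h

/-- The factor `1 + cs - sn` of `symK₁` is `1 + S⁻¹`, and `(1 + S⁻¹)(S - 1) = 2 sn`. Hence the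
product is `sn` times a symmetric symbol. -/
theorem virial_weight_VV :
    invert ((symK₁ s) * symDelta) + (symK₁ s) * symDelta = 0 := by
  have h := cs_sq_sub_sn_sq
  simp only [symR, symDelta, symB, symK₁, map_add, map_sub, map_neg, map_mul, map_pow, map_one,
    map_ofNat, invert_cs, invert_sn, invert_C, map_zero]
  generalize cs = c at h ⊢
  generalize sn = d at h ⊢
  generalize (C s : ℝ[T;T⁻¹]) = k
  linear_combination (
    8 * c ^ 3 * k - 24 * c ^ 3 - 16 * c ^ 2 * k ^ 2 + 88 * c ^ 2 * k - 48 * c ^ 2 - 64 * c *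
      k ^ 2 + 112 * c * k - 48 * c - 64 * k ^ 2 + 80 * k - 24) * h

theorem virial_weight_YY :
    invert (symK₄ s) + (symK₄ s) = 0 := by
  have h := cs_sq_sub_sn_sq
  simp only [symR, symB, symK₄, map_add, map_sub, map_neg, map_mul, map_pow, map_one, map_ofNat,
    invert_cs, invert_sn, invert_C, map_zero]
  generalize cs = c at h ⊢
  generalize sn = d at h ⊢
  generalize (C s : ℝ[T;T⁻¹]) = k
  ring

/-- By the same factorisation `symK₃ * symDelta` equals `4 sn² symR symB`, which is symmetric, and
`symK₂` is its negative because `cs² - 1 = sn²`. -/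
theorem virial_weight_VY :
    (symK₂ s) + invert ((symK₃ s) * symDelta) = 0 := by
  have h := cs_sq_sub_sn_sq
  simp only [symR, symDelta, symB, symK₂, symK₃, map_add, map_sub, map_neg, map_mul, map_pow, map_one,
    map_ofNat, invert_cs, invert_sn, invert_C, map_zero]
  generalize cs = c at h ⊢
  generalize sn = d at h ⊢
  generalize (C s : ℝ[T;T⁻¹]) = k
  linear_combination (
    2 * c ^ 2 * d * k - 6 * c ^ 2 * d + 4 * c ^ 2 * k - 12 * c ^ 2 - 4 * c * d * k ^ 2 + 18
      * c * d * k - 6 * c * d - 8 * c * k ^ 2 + 36 * c * k - 12 * c - 8 * d * k ^ 2 + 4 * d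
      * k - 16 * k ^ 2 + 8 * k) * h

/-- The `virial_symbol` identities match what the commutators and the correction `symN₁`, …, `symN₄`
leave over with the symbols of the virial form. Mixed blocks have to agree exactly. -/
theorem virial_symbol_DJ :
    -4 * (invert (eulerD symAlpha) * (symK₂ s) + invert (eulerD (symK₁ s)) * (symGamma s) + invert (eulerD symPhi) * (symK₄ s)
        + invert (eulerD (symK₃ s)) * (symPsi s))
        + (invert symAlpha * (symN₂ s) + invert (symN₁ s) * (symGamma s) + invert symPhi * (symN₄ s) + invert (symN₃ s) * (symPsi s)) - (virDJ s) = 0 := by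
  have h := cs_sq_sub_sn_sq
  simp only [symR, symAlpha, symGamma, symPhi, symPsi, symB, symK₁, symK₂, symK₃, symK₄, symN₁, symN₂,
    symN₃, symN₄, symP₁, virDJ, map_add, map_sub, map_neg, map_mul, map_pow, map_one,
    map_ofNat, invert_cs, invert_sn, invert_C, map_zero, Derivation.leibniz, Derivation.leibniz_pow, eulerD_cs, eulerD_sn, eulerD_C,
    eulerD_ofNat, Derivation.map_one_eq_zero, smul_eq_mul, nsmul_eq_mul,
    Nat.cast_ofNat, Nat.reduceSub, mul_zero]
  generalize cs = c at h ⊢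
  generalize sn = d at h ⊢
  generalize (C s : ℝ[T;T⁻¹]) = k
  linear_combination (
    4 * c ^ 4 * k - 12 * c ^ 4 + 32 * c ^ 3 * d * k - 96 * c ^ 3 * d + 8 * c ^ 3 * k ^ 2 -
      76 * c ^ 3 * k + 228 * c ^ 3 - 96 * c ^ 2 * d * k ^ 2 + 368 * c ^ 2 * d * k - 32 * c ^
      2 * k ^ 3 + 280 * c ^ 2 * k ^ 2 - 900 * c ^ 2 * k + 420 * c ^ 2 + 64 * c * d * k ^ 3 -
      384 * c * d * k ^ 2 - 80 * c * d * k + 48 * c * d - 112 * c * k ^ 3 + 736 * c * k ^ 2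
      - 860 * c * k + 252 * c + 128 * d * k ^ 3 + 64 * d * k - 48 * d - 96 * k ^ 3 + 416 * k
      ^ 2 - 328 * k + 72) * h

theorem virial_symbol_VY :
    -4 * invert (eulerD ((symK₃ s) * symDelta)) + (symN₂ s) + invert ((symN₃ s) * symDelta) - (virVY s) = 0 := by
  have h := cs_sq_sub_sn_sq
  simp only [symR, symDelta, symB, symK₃, symN₂, symN₃, symP₀, virVY, map_add, map_sub, map_neg,
    map_mul, map_pow, map_one, map_ofNat, invert_cs, invert_sn, invert_C, map_zero, Derivation.leibniz, Derivation.leibniz_pow, eulerD_cs, eulerD_sn, eulerD_C,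
    eulerD_ofNat, Derivation.map_one_eq_zero, smul_eq_mul, nsmul_eq_mul,
    Nat.cast_ofNat, Nat.reduceSub, mul_zero]
  generalize cs = c at h ⊢
  generalize sn = d at h ⊢
  generalize (C s : ℝ[T;T⁻¹]) = k
  linear_combination (
    -6 * c ^ 3 * k + 18 * c ^ 3 + 8 * c ^ 2 * k ^ 2 - 34 * c ^ 2 * k + 18 * c ^ 2 + 16 * c *
      d ^ 2 * k - 48 * c * d ^ 2 + 32 * c * d * k - 96 * c * d + 4 * c * k ^ 2 - 6 * c * k -
      18 * c - 16 * d ^ 2 * k ^ 2 + 72 * d ^ 2 * k - 24 * d ^ 2 - 32 * d * k ^ 2 + 144 * d *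
      k - 48 * d - 12 * k ^ 2 + 46 * k - 18) * h

/-- On a diagonal block agreement is needed only up to an antisymmetric symbol, hence the sum of the
defect and its adjoint. -/
theorem virial_symbol_DD :
    (-2 * invert (eulerD (invert symAlpha * (symK₁ s) + invert symPhi * (symK₃ s)))
        - 4 * (invert (eulerD symAlpha) * (symK₁ s) + invert (eulerD symPhi) * (symK₃ s))
        + (invert symAlpha * (symN₁ s) + invert symPhi * (symN₃ s)) - (virDD s))
        + invert (-2 * invert (eulerD (invert symAlpha * (symK₁ s) + invert symPhi * (symK₃ s)))
        - 4 * (invert (eulerD symAlpha) * (symK₁ s) + invert (eulerD symPhi) * (symK₃ s))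
        + (invert symAlpha * (symN₁ s) + invert symPhi * (symN₃ s)) - (virDD s)) = 0 := by
  have h := cs_sq_sub_sn_sq
  simp only [symR, symAlpha, symPhi, symB, symK₁, symK₃, symN₁, symN₃, symP₀, symP₁, virDD, map_add,
    map_sub, map_neg, map_mul, map_pow, map_one, map_ofNat, invert_cs, invert_sn, invert_C,
    map_zero, Derivation.leibniz, Derivation.leibniz_pow, eulerD_cs, eulerD_sn, eulerD_C,
    eulerD_ofNat, Derivation.map_one_eq_zero, smul_eq_mul, nsmul_eq_mul,
    Nat.cast_ofNat, Nat.reduceSub, mul_zero]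
  generalize cs = c at h ⊢
  generalize sn = d at h ⊢
  generalize (C s : ℝ[T;T⁻¹]) = k
  linear_combination (
    -24 * c ^ 4 * k + 72 * c ^ 4 + 32 * c ^ 3 * k ^ 2 - 16 * c ^ 3 * k - 264 * c ^ 3 - 32 *
      c ^ 2 * d ^ 2 * k + 96 * c ^ 2 * d ^ 2 - 208 * c ^ 2 * k ^ 2 + 768 * c ^ 2 * k - 192 *
      c ^ 2 + 64 * c * d ^ 2 * k ^ 2 - 352 * c * d ^ 2 * k + 288 * c * d ^ 2 - 224 * c * k ^
      2 - 248 * c * k + 288 * c + 192 * d ^ 2 * k ^ 2 - 352 * d ^ 2 * k + 96 * d ^ 2 + 736 *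
      k ^ 2 - 1152 * k + 432) * h

theorem virial_symbol_JJ :
    (-2 * invert (eulerD (invert (symGamma s) * (symK₂ s) + invert (symPsi s) * (symK₄ s)))
        - 4 * (invert (eulerD (symGamma s)) * (symK₂ s) + invert (eulerD (symPsi s)) * (symK₄ s))
        + (invert (symGamma s) * (symN₂ s) + invert (symPsi s) * (symN₄ s)) - (virJJ s))
        + invert (-2 * invert (eulerD (invert (symGamma s) * (symK₂ s) + invert (symPsi s) * (symK₄ s)))
        - 4 * (invert (eulerD (symGamma s)) * (symK₂ s) + invert (eulerD (symPsi s)) * (symK₄ s))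
        + (invert (symGamma s) * (symN₂ s) + invert (symPsi s) * (symN₄ s)) - (virJJ s)) = 0 := by
  have h := cs_sq_sub_sn_sq
  simp only [symR, symGamma, symPsi, symB, symK₂, symK₄, symN₂, symN₄, symP₀, symP₁, virJJ, map_add,
    map_sub, map_neg, map_mul, map_pow, map_one, map_ofNat, invert_cs, invert_sn, invert_C,
    map_zero, Derivation.leibniz, Derivation.leibniz_pow, eulerD_cs, eulerD_sn, eulerD_C,
    eulerD_ofNat, Derivation.map_one_eq_zero, smul_eq_mul, nsmul_eq_mul,
    Nat.cast_ofNat, Nat.reduceSub, mul_zero]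
  generalize cs = c at h ⊢
  generalize sn = d at h ⊢
  generalize (C s : ℝ[T;T⁻¹]) = k
  linear_combination (
    -24 * c ^ 4 * k + 72 * c ^ 4 + 80 * c ^ 3 * k ^ 2 - 304 * c ^ 3 * k + 240 * c ^ 3 - 64 *
      c ^ 2 * k ^ 3 + 320 * c ^ 2 * k ^ 2 - 640 * c ^ 2 * k + 96 * c ^ 2 - 32 * c * k ^ 3 +
      208 * c * k ^ 2 + 400 * c * k - 240 * c + 288 * k ^ 3 - 992 * k ^ 2 + 760 * k - 168) * h

theorem virial_symbol_VV :
    (-2 * invert (eulerD ((symK₁ s) * symDelta)) + (symN₁ s) * symDelta - (virVV s))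
        + invert (-2 * invert (eulerD ((symK₁ s) * symDelta)) + (symN₁ s) * symDelta - (virVV s)) = 0 := by
  have h := cs_sq_sub_sn_sq
  simp only [symR, symDelta, symB, symK₁, symN₁, symP₀, symP₁, virVV, map_add, map_sub, map_neg,
    map_mul, map_pow, map_one, map_ofNat, invert_cs, invert_sn, invert_C, map_zero, Derivation.leibniz, Derivation.leibniz_pow, eulerD_cs, eulerD_sn, eulerD_C,
    eulerD_ofNat, Derivation.map_one_eq_zero, smul_eq_mul, nsmul_eq_mul,
    Nat.cast_ofNat, Nat.reduceSub, mul_zero]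
  generalize cs = c at h ⊢
  generalize sn = d at h ⊢
  generalize (C s : ℝ[T;T⁻¹]) = k
  linear_combination (
    -56 * c ^ 3 * k + 168 * c ^ 3 + 96 * c ^ 2 * k ^ 2 - 432 * c ^ 2 * k + 120 * c ^ 2 + 176
      * c * k ^ 2 - 80 * c * k - 32 * k ^ 2 + 88 * k - 48) * h

theorem virial_symbol_YY :
    (-2 * invert (eulerD (symK₄ s)) + (symN₄ s) - (virYY s))
        + invert (-2 * invert (eulerD (symK₄ s)) + (symN₄ s) - (virYY s)) = 0 := by
  have h := cs_sq_sub_sn_sq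
  simp only [symR, symB, symK₄, symN₄, symP₀, symP₁, virYY, map_add, map_sub, map_neg, map_mul,
    map_pow, map_one, map_ofNat, invert_cs, invert_sn, invert_C, map_zero, Derivation.leibniz, Derivation.leibniz_pow, eulerD_cs, eulerD_sn, eulerD_C,
    eulerD_ofNat, Derivation.map_one_eq_zero, smul_eq_mul, nsmul_eq_mul,
    Nat.cast_ofNat, Nat.reduceSub, mul_zero]
  generalize cs = c at h ⊢
  generalize sn = d at h ⊢
  generalize (C s : ℝ[T;T⁻¹]) = k
  linear_combination (
    -24 * c ^ 2 * k + 72 * c ^ 2 + 32 * c * k ^ 2 - 112 * c * k + 32 * k) * h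

end Symbols
end DGWave
namespace DGWave

open Set MeasureTheory LaurentPolynomial
open scoped RealInnerProductSpace

/-! ### Conservation of the virial form and of the energy, on the level of symbols -/

section Symbols

variable (s : ℝ)

/-- Behind these identities: translation-invariant multipliers commute with the flow, so the energy
of `z` weighted by `symP₀` and the energy of `gen z` weighted by `symP₁` are both conserved. Each
identity is the vanishing of one mixed coefficient in the time derivative. -/
theorem virial_cons_Dv :
    2 * (virDD s) * symDelta + 2 * invert symAlpha * (virVV s) + invert symPhi * invert (virVY s) = 0 := by
  have h := cs_sq_sub_sn_sq
  simp only [symDelta, symAlpha, symPhi, symP₀, symP₁, virDD, virVV, virVY, map_add, map_sub, map_neg,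
    map_mul, map_pow, map_one, map_ofNat, invert_cs, invert_sn, invert_C, map_zero]
  generalize cs = c at h ⊢
  generalize sn = d at h ⊢
  generalize (C s : ℝ[T;T⁻¹]) = k
  linear_combination (
    -16 * c ^ 4 * k + 48 * c ^ 4 - 16 * c ^ 3 * d * k + 48 * c ^ 3 * d - 64 * c ^ 3 * k - 80
      * c ^ 2 * d * k + 48 * c ^ 2 * d + 96 * c ^ 2 * k ^ 2 - 96 * c ^ 2 * k + 96 * c * d *
      k ^ 2 - 176 * c * d * k + 48 * c * d + 64 * c * k + 96 * d * k ^ 2 - 112 * d * k + 48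
      * d - 96 * k ^ 2 + 112 * k - 48) * h

theorem virial_cons_Dy :
    (virDJ s) + 2 * invert symPhi * (virYY s) + invert symAlpha * (virVY s) = 0 := by
  have h := cs_sq_sub_sn_sq
  simp only [symR, symAlpha, symPhi, symP₀, symP₁, virDJ, virYY, virVY, map_add, map_sub, map_neg,
    map_mul, map_pow, map_one, map_ofNat, invert_cs, invert_sn, invert_C, map_zero]
  generalize cs = c at h ⊢
  generalize sn = d at h ⊢
  generalize (C s : ℝ[T;T⁻¹]) = k
  ring

theorem virial_cons_Jv :
    invert (virDJ s) * symDelta + 2 * invert (symGamma s) * (virVV s) + invert (symPsi s) * invert (virVY s) = 0 := by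
  have h := cs_sq_sub_sn_sq
  simp only [symR, symDelta, symGamma, symPsi, symP₀, symP₁, virDJ, virVV, virVY, map_add, map_sub,
    map_neg, map_mul, map_pow, map_one, map_ofNat, invert_cs, invert_sn, invert_C, map_zero]
  generalize cs = c at h ⊢
  generalize sn = d at h ⊢
  generalize (C s : ℝ[T;T⁻¹]) = k
  linear_combination (
    -24 * c ^ 3 * d + 72 * c ^ 2 * d * k - 48 * c ^ 2 * d - 48 * c * d * k ^ 2 + 96 * c * d
      * k - 24 * c * d - 48 * d * k ^ 2 + 24 * d * k) * h

theorem virial_cons_Jy :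
    2 * (virJJ s) + 2 * invert (symPsi s) * (virYY s) + invert (symGamma s) * (virVY s) = 0 := by
  have h := cs_sq_sub_sn_sq
  simp only [symR, symGamma, symPsi, symP₀, symP₁, virJJ, virYY, virVY, map_add, map_sub, map_neg,
    map_mul, map_pow, map_one, map_ofNat, invert_cs, invert_sn, invert_C, map_zero]
  generalize cs = c at h ⊢
  generalize sn = d at h ⊢
  generalize (C s : ℝ[T;T⁻¹]) = k
  linear_combination (
    8 * c ^ 4 * k - 24 * c ^ 4 - 16 * c ^ 3 * k ^ 2 + 96 * c ^ 3 * k - 48 * c ^ 3 - 128 * c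
      ^ 2 * k ^ 2 + 176 * c ^ 2 * k - 48 * c ^ 2 + 96 * c * k ^ 3 - 272 * c * k ^ 2 + 192 *
      c * k - 48 * c + 96 * k ^ 3 - 160 * k ^ 2 + 104 * k - 24) * h

/-- The same mixed coefficients for the plain energy, that is, with multipliers `1` and `0` in place
of `symP₀` and `symP₁`. -/
theorem energy_cons_Dv :
    2 * 12 * symDelta + 2 * invert symAlpha * (4 * (2 + cs)) + invert symPhi * invert (4 * sn) = 0 := by
  have h := cs_sq_sub_sn_sq
  simp only [symDelta, symAlpha, symPhi, map_add, map_sub, map_neg, map_mul, map_pow, map_one,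
    map_ofNat, invert_cs, invert_sn, invert_C, map_zero]
  generalize cs = c at h ⊢
  generalize sn = d at h ⊢
  linear_combination (
    8 * c + 8 * d - 8) * h

theorem energy_cons_Dy :
    0 + 2 * invert symPhi * (2 - cs) + invert symAlpha * (4 * sn) = 0 := by
  have h := cs_sq_sub_sn_sq
  simp only [symAlpha, symPhi, map_add, map_sub, map_neg, map_mul, map_pow, map_one, map_ofNat,
    invert_cs, invert_sn, invert_C, map_zero]
  generalize cs = c at h ⊢
  generalize sn = d at h ⊢
  ring

theorem energy_cons_Jv :
    invert 0 * symDelta + 2 * invert (symGamma s) * (4 * (2 + cs)) + invert (symPsi s) * invert (4 * sn) = 0 := by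
  have h := cs_sq_sub_sn_sq
  simp only [symR, symDelta, symGamma, symPsi, map_add, map_sub, map_neg, map_mul, map_pow, map_one,
    map_ofNat, invert_cs, invert_sn, invert_C, map_zero]
  generalize cs = c at h ⊢
  generalize sn = d at h ⊢
  generalize (C s : ℝ[T;T⁻¹]) = k
  ring

theorem energy_cons_Jy :
    2 * (6 * symR s) + 2 * invert (symPsi s) * (2 - cs) + invert (symGamma s) * (4 * sn) = 0 := by
  have h := cs_sq_sub_sn_sq
  simp only [symR, symGamma, symPsi, map_add, map_sub, map_neg, map_mul, map_pow, map_one, map_ofNat,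
    invert_cs, invert_sn, invert_C, map_zero]
  generalize cs = c at h ⊢
  generalize sn = d at h ⊢
  generalize (C s : ℝ[T;T⁻¹]) = k
  linear_combination (
    -4 * c + 8 * k - 4) * h

theorem invert_virDD :
    invert (virDD s) = virDD s := by
  simp only [symP₀, symP₁, virDD, map_add, map_sub, map_neg, map_mul, map_pow, map_one, map_ofNat, invert_cs, invert_sn, invert_C, map_zero]

theorem invert_virJJ :
    invert (virJJ s) = virJJ s := by
  simp only [symR, symP₀, symP₁, virJJ, map_add, map_sub, map_neg, map_mul, map_pow, map_one, map_ofNat, invert_cs, invert_sn, invert_C, map_zero]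

theorem invert_virVV :
    invert (virVV s) = virVV s := by
  simp only [symP₀, symP₁, virVV, map_add, map_sub, map_neg, map_mul, map_pow, map_one, map_ofNat, invert_cs, invert_sn, invert_C, map_zero]

theorem invert_virYY :
    invert (virYY s) = virYY s := by
  simp only [symR, symP₀, symP₁, virYY, map_add, map_sub, map_neg, map_mul, map_pow, map_one, map_ofNat, invert_cs, invert_sn, invert_C, map_zero]

end Symbols
end DGWave
namespace DGWave

open Set MeasureTheory LaurentPolynomial
open scoped RealInnerProductSpace

/-! ### The first-order system -/

section State

variable {E : Type*} [NormedAddCommGroup E] [InnerProductSpace ℝ E]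

/-- States `(D, J, v, y)` of the first-order system. -/
abbrev State (E : Type*) [NormedAddCommGroup E] := PiLp 2 fun _ : Fin 4 => Seq E

/-- The state-valued operator with given components. -/
noncomputable def mkState {X : Type*} [NormedAddCommGroup X] [NormedSpace ℝ X]
    (a b c d : X →L[ℝ] Seq E) : X →L[ℝ] State E :=
  (PiLp.continuousLinearEquiv 2 ℝ fun _ : Fin 4 => Seq E).symm.toContinuousLinearMap ∘L
    ContinuousLinearMap.pi ![a, b, c, d]

section
variable {X : Type*} [NormedAddCommGroup X] [NormedSpace ℝ X] (a b c d : X →L[ℝ] Seq E) (x : X)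
@[simp] theorem mkState_apply_zero : mkState a b c d x 0 = a x := rfl
@[simp] theorem mkState_apply_one : mkState a b c d x 1 = b x := rfl
@[simp] theorem mkState_apply_two : mkState a b c d x 2 = c x := rfl
@[simp] theorem mkState_apply_three : mkState a b c d x 3 = d x := rfl
end

variable (E) in
/-- The `i`-th component of a state. -/
noncomputable def comp (i : Fin 4) : State E →L[ℝ] Seq E := PiLp.proj 2 (fun _ : Fin 4 => Seq E) i

@[simp] theorem comp_apply (i : Fin 4) (z : State E) : comp E i z = z i := rfl

variable (E) in
/-- The generator of the first-order system. -/
noncomputable def gen (s : ℝ) : State E →L[ℝ] State E :=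
  mkState (ev E symDelta ∘L comp E 2) (comp E 3)
    (ev E symAlpha ∘L comp E 0 + ev E (symGamma s) ∘L comp E 1)
    (ev E symPhi ∘L comp E 0 + ev E (symPsi s) ∘L comp E 1)

@[simp] theorem gen_zero (s : ℝ) (z : State E) : gen E s z 0 = ev E symDelta (z 2) := rfl
@[simp] theorem gen_one (s : ℝ) (z : State E) : gen E s z 1 = z 3 := rfl
@[simp] theorem gen_two (s : ℝ) (z : State E) :
    gen E s z 2 = ev E symAlpha (z 0) + ev E (symGamma s) (z 1) := rfl
@[simp] theorem gen_three (s : ℝ) (z : State E) :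
    gen E s z 3 = ev E symPhi (z 0) + ev E (symPsi s) (z 1) := rfl

/-- The translation-invariant quadratic form with given symbols. -/
noncomputable def symForm (a b c e f g : ℝ[T;T⁻¹]) (z : State E) : ℝ :=
  ⟪z 0, ev E a (z 0)⟫ + ⟪z 1, ev E b (z 1)⟫ + ⟪z 0, ev E c (z 1)⟫
    + ⟪z 2, ev E e (z 2)⟫ + ⟪z 3, ev E f (z 3)⟫ + ⟪z 2, ev E g (z 3)⟫

theorem _root_.HasDerivWithinAt.mapCLM {X Y : Type*} [NormedAddCommGroup X] [NormedSpace ℝ X]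
    [NormedAddCommGroup Y] [NormedSpace ℝ Y] (L : X →L[ℝ] Y) {f : ℝ → X} {f' : X} {I : Set ℝ}
    {t : ℝ} (h : HasDerivWithinAt f f' I t) : HasDerivWithinAt (fun t => L (f t)) (L f') I t :=
  L.hasFDerivAt.comp_hasDerivWithinAt t h

/-- The generator exchanges `(D, J)` with `(v, y)`, so the derivative contains only products of one
of `D`, `J` with one of `v`, `y`. The four hypotheses kill these four products. -/
theorem symForm_deriv {s : ℝ} {a b c e f g : ℝ[T;T⁻¹]} (ha : invert a = a) (hb : invert b = b)
    (he : invert e = e) (hf : invert f = f)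
    (hDv : 2 * a * symDelta + 2 * invert symAlpha * e + invert symPhi * invert g = 0)
    (hDy : c + 2 * invert symPhi * f + invert symAlpha * g = 0)
    (hJv : invert c * symDelta + 2 * invert (symGamma s) * e + invert (symPsi s) * invert g = 0)
    (hJy : 2 * b + 2 * invert (symPsi s) * f + invert (symGamma s) * g = 0)
    {h : ℝ} {I : Set ℝ} {t : ℝ} {z : ℝ → State E}
    (hz : HasDerivWithinAt z (h⁻¹ • gen E s (z t)) I t) :
    HasDerivWithinAt (fun t => symForm a b c e f g (z t)) 0 I t := by
  have hc := fun i => hz.mapCLM (comp E i)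
  have h0 := hc 0
  have h1 := hc 1
  have h2 := hc 2
  have h3 := hc 3
  simp only [comp_apply, PiLp.smul_apply, gen_zero, gen_one, gen_two, gen_three] at h0 h1 h2 h3
  have main := (((((h0.inner ℝ (h0.mapCLM (ev E a))).add (h1.inner ℝ (h1.mapCLM (ev E b)))).add
    (h0.inner ℝ (h1.mapCLM (ev E c)))).add (h2.inner ℝ (h2.mapCLM (ev E e)))).add
    (h3.inner ℝ (h3.mapCLM (ev E f)))).add (h2.inner ℝ (h3.mapCLM (ev E g)))
  refine main.congr_deriv ?_
  clear main hc h0 h1 h2 h3 hz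
  generalize z t = w
  have z1 := congrArg (fun p => ⟪w 0, ev E p (w 2)⟫) hDv
  have z2 := congrArg (fun p => ⟪w 0, ev E p (w 3)⟫) hDy
  have z3 := congrArg (fun p => ⟪w 1, ev E p (w 2)⟫) hJv
  have z4 := congrArg (fun p => ⟪w 1, ev E p (w 3)⟫) hJy
  have c2 : ∀ (p : ℝ[T;T⁻¹]) (f : Seq E), ev E (2 * p) f = (2 : ℝ) • ev E p f := fun p f => by
    rw [show (2 : ℝ[T;T⁻¹]) = LaurentPolynomial.C 2 by rw [map_ofNat], ev_mul_apply, ev_C]; rfl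
  have s1 : ⟪ev E symDelta (w 2), ev E a (w 0)⟫ = ⟪w 0, ev E (a * symDelta) (w 2)⟫ := by
    rw [real_inner_comm, inner_ev_ev, ha]
  have s2 : ⟪w 3, ev E b (w 1)⟫ = ⟪w 1, ev E b (w 3)⟫ := by rw [inner_ev_swap, hb]
  have s3 : ⟪ev E symDelta (w 2), ev E c (w 1)⟫ = ⟪w 1, ev E (invert c * symDelta) (w 2)⟫ := by
    rw [real_inner_comm, inner_ev_ev]
  have s4 : ∀ p : ℝ[T;T⁻¹], ∀ u : Seq E,
      ⟪w 2, ev E e (ev E p u)⟫ = ⟪u, ev E (invert p * e) (w 2)⟫ := fun p u => by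
    rw [inner_ev_swap, he, inner_ev_ev]
  have s5 : ∀ p : ℝ[T;T⁻¹], ∀ u : Seq E,
      ⟪w 3, ev E f (ev E p u)⟫ = ⟪u, ev E (invert p * f) (w 3)⟫ := fun p u => by
    rw [inner_ev_swap, hf, inner_ev_ev]
  have s6 : ∀ p : ℝ[T;T⁻¹], ∀ u : Seq E,
      ⟪w 2, ev E g (ev E p u)⟫ = ⟪u, ev E (invert p * invert g) (w 2)⟫ := fun p u => by
    rw [inner_ev_swap, real_inner_comm, ← inner_ev_ev, real_inner_comm]
  have s7 : ev E a (ev E symDelta (w 2)) = ev E (a * symDelta) (w 2) := (ev_mul_apply _ _ _).symm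
  simp only [mul_assoc, map_add, map_smul, map_zero, add_apply, zero_apply, c2, smul_add,
    inner_add_right, inner_add_left, real_inner_smul_right, real_inner_smul_left,
    inner_zero_right, s1, s2, s3, s4, s5, s6, s7, inner_ev_ev] at z1 z2 z3 z4 ⊢
  linear_combination h⁻¹ * (z1 + z2 + z3 + z4)

theorem eq_initial_of_deriv_zero {f : ℝ → ℝ} {T : ℝ}
    (hf : ∀ t ∈ Icc (0 : ℝ) T, HasDerivWithinAt f 0 (Icc 0 T) t) {t : ℝ} (ht : t ∈ Icc (0 : ℝ) T) :
    f t = f 0 :=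
  constant_of_has_deriv_right_zero (fun t ht => (hf t ht).continuousWithinAt)
    (fun x hx => ((hf x ⟨hx.1, hx.2.le⟩).mono_of_mem_nhdsWithin
      (Icc_mem_nhdsGE_of_mem hx))) t ht

/-- The restriction of the energy form (the sum over the cells of the polarized cell energies,
scaled) by an operator `W` on cell-indexed sequences. -/
noncomputable def cellForm (s : ℝ) (W : Seq E →L[ℝ] Seq E) (z w : State E) : ℝ :=
  ⟪W (z 0), w 0⟫ + (s - 1) / 2 * (⟪W (z 1), w 1⟫ + ⟪W (shift 1 (z 1)), shift 1 (w 1)⟫)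
    + 1 / 4 * ⟪W (z 1 - shift 1 (z 1)), w 1 - shift 1 (w 1)⟫
    + 1 / 6 * (⟪W (z 2 - (1 / 2 : ℝ) • z 3), w 2 - (1 / 2 : ℝ) • w 3⟫
      + ⟪W (shift 1 (z 2 + (1 / 2 : ℝ) • z 3)), shift 1 (w 2 + (1 / 2 : ℝ) • w 3)⟫
      + ⟪W (z 2 - (1 / 2 : ℝ) • z 3 + shift 1 (z 2 + (1 / 2 : ℝ) • z 3)),
          w 2 - (1 / 2 : ℝ) • w 3 + shift 1 (w 2 + (1 / 2 : ℝ) • w 3)⟫)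

/-- The scaled energy. -/
noncomputable def energy (s : ℝ) (z : State E) : ℝ := cellForm s 1 z z

/-- The scaled virial form. -/
noncomputable def virForm (s : ℝ) (z : State E) : ℝ :=
  symForm (virDD s) (virJJ s) (virDJ s) (virVV s) (virYY s) (virVY s) z

/-- With the identity as weight, the translations by one cell drop out because translation preserves
inner products; the factor 12 clears denominators. -/
theorem symForm_energy (s : ℝ) (z : State E) :
    symForm 12 (6 * symR s) 0 (4 * (2 + cs)) (2 - cs) (4 * sn) z = 12 * energy s z := by
  have hs : ∀ f : Seq E, shift 1 f = ev E (T 1) f := fun f => by rw [ev_T]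
  have n : ∀ (k : ℕ) [k.AtLeastTwo] (p : ℝ[T;T⁻¹]) (f : Seq E),
      ev E (ofNat(k) * p) f = (ofNat(k) : ℝ) • ev E p f := fun k _ p f => by
    rw [show (ofNat(k) : ℝ[T;T⁻¹]) = LaurentPolynomial.C ofNat(k) by rw [map_ofNat], ev_mul_apply,
      ev_C]; rfl
  have n' : ∀ (k : ℕ) [k.AtLeastTwo] (f : Seq E),
      ev E (ofNat(k)) f = (ofNat(k) : ℝ) • f := fun k _ f => by
    simpa using n k 1 f
  have i1 : ∀ f g : Seq E, ⟪shift 1 f, shift 1 g⟫ = ⟪f, g⟫ := fun f g => by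
    rw [inner_shift]; congr 1; ext j; simp
  have hC : ∀ (r : ℝ) (p : ℝ[T;T⁻¹]) (f : Seq E), ev E (C r * p) f = r • ev E p f := fun r p f => by
    rw [ev_mul_apply, ev_C]; rfl
  have i2 : ∀ f g : Seq E, ⟪shift 1 f, g⟫ = ⟪g, shift 1 f⟫ := fun f g => real_inner_comm _ _
  have i3 : ∀ f g : Seq E, ⟪f, shift (-1) g⟫ = ⟪g, shift 1 f⟫ := fun f g => by
    rw [← inner_shift, real_inner_comm]
  have i4 : ⟪z 3, z 2⟫ = ⟪z 2, z 3⟫ := real_inner_comm _ _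
  rw [energy, symForm, cellForm]
  simp only [symR, cs, sn, mul_add, mul_sub, map_add, map_sub, map_smul, add_apply,
    sub_apply, n, n', hC, ev_T, ev_C, map_zero, zero_apply, one_apply_eq_self, inner_add_right,
    mul_one, smul_apply,
    inner_add_left, inner_sub_left, inner_sub_right, real_inner_smul_left, real_inner_smul_right,
    inner_zero_right, i1, i2, i3, i4]
  ring

theorem energy_eq_initial {s h T : ℝ} {z : ℝ → State E}
    (hz : ∀ t ∈ Icc (0 : ℝ) T, HasDerivWithinAt z (h⁻¹ • gen E s (z t)) (Icc 0 T) t)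
    {t : ℝ} (ht : t ∈ Icc (0 : ℝ) T) : energy s (z t) = energy s (z 0) := by
  have h1 := eq_initial_of_deriv_zero
    (f := fun t => symForm 12 (6 * symR s) 0 (4 * (2 + cs)) (2 - cs) (4 * sn) (z t))
    (fun t ht => symForm_deriv (map_ofNat _ _)
      (by simp only [symR, map_mul, map_sub, map_ofNat, map_one, invert_C, invert_cs])
      (by simp only [map_mul, map_add, map_ofNat, invert_cs])
      (by simp only [map_sub, map_ofNat, invert_cs])
      energy_cons_Dv energy_cons_Dy (energy_cons_Jv s) (energy_cons_Jy s) (hz t ht)) ht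
  simpa [symForm_energy] using h1

theorem virForm_eq_initial {s h T : ℝ} {z : ℝ → State E}
    (hz : ∀ t ∈ Icc (0 : ℝ) T, HasDerivWithinAt z (h⁻¹ • gen E s (z t)) (Icc 0 T) t)
    {t : ℝ} (ht : t ∈ Icc (0 : ℝ) T) : virForm s (z t) = virForm s (z 0) :=
  eq_initial_of_deriv_zero (fun t ht => symForm_deriv (invert_virDD s) (invert_virJJ s)
    (invert_virVV s) (invert_virYY s) (virial_cons_Dv s) (virial_cons_Dy s)
    (virial_cons_Jv s) (virial_cons_Jy s) (hz t ht)) ht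

omit [InnerProductSpace ℝ E] in
theorem norm_sq_state (z : State E) :
    ‖z‖ ^ 2 = ‖z 0‖ ^ 2 + ‖z 1‖ ^ 2 + ‖z 2‖ ^ 2 + ‖z 3‖ ^ 2 := by
  rw [PiLp.norm_sq_eq_of_L2, Fin.sum_univ_four]

section
omit [InnerProductSpace ℝ E]
theorem seq_add_apply (f g : Seq E) (j : ℤ) : (f + g) j = f j + g j := rfl
theorem seq_sub_apply (f g : Seq E) (j : ℤ) : (f - g) j = f j - g j := rfl
theorem seq_smul_apply [NormedSpace ℝ E] (r : ℝ) (f : Seq E) (j : ℤ) : (r • f) j = r • f j := rfl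
end

/-- The pointwise density of the energy on the cells. -/
noncomputable def cellDensity (s : ℝ) (z : State E) (j : ℤ) : ℝ :=
  ‖z 0 j‖ ^ 2 + (s - 1) / 2 * (‖z 1 j‖ ^ 2 + ‖z 1 (j + 1)‖ ^ 2)
    + 1 / 4 * ‖z 1 j - z 1 (j + 1)‖ ^ 2
    + 1 / 6 * (‖z 2 j - (1 / 2 : ℝ) • z 3 j‖ ^ 2
      + ‖z 2 (j + 1) + (1 / 2 : ℝ) • z 3 (j + 1)‖ ^ 2
      + ‖z 2 j - (1 / 2 : ℝ) • z 3 j + (z 2 (j + 1) + (1 / 2 : ℝ) • z 3 (j + 1))‖ ^ 2)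

theorem hasSum_cellForm (s : ℝ) (w : ℤ → ℝ) (K : ℝ) (hw : ∀ i, |w i| ≤ K) (z : State E) :
    HasSum (fun j => w j * cellDensity s z j) (cellForm s (mulWeight w K hw) z z) := by
  have key : ∀ f : Seq E, HasSum (fun j => w j * ‖f j‖ ^ 2) ⟪mulWeight w K hw f, f⟫ := fun f => by
    have := lp.hasSum_inner (𝕜 := ℝ) (mulWeight w K hw f) f
    simpa [real_inner_smul_left] using this
  have main := ((((key (z 0)).add (((key (z 1)).add (key (shift 1 (z 1)))).mul_left
    ((s - 1) / 2))).add ((key (z 1 - shift 1 (z 1))).mul_left (1 / 4))).add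
    ((((key (z 2 - (1 / 2 : ℝ) • z 3)).add (key (shift 1 (z 2 + (1 / 2 : ℝ) • z 3)))).add
      (key (z 2 - (1 / 2 : ℝ) • z 3 + shift 1 (z 2 + (1 / 2 : ℝ) • z 3)))).mul_left (1 / 6)))
  convert main using 1
  · funext j
    simp only [cellDensity, seq_add_apply, seq_sub_apply, seq_smul_apply, shift_apply]
    ring
  · rfl

/-- Here `s > 1` enters: it makes the coefficient `(s - 1) / 2` of the squared jumps positive. -/
theorem cellDensity_nonneg {s : ℝ} (hs : 1 < s) (z : State E) (j : ℤ) : 0 ≤ cellDensity s z j := by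
  have : 0 < s - 1 := by linarith
  unfold cellDensity
  positivity

/-- Recovering both `v` and `y` at a node takes the traces from its two sides, hence two cells. Each
squared trace costs a factor 6, so `v` contributes 3 and `y` 12; with 1 for `D` this gives 16. The
jump contributes `2 / (s - 1)`. -/
theorem site_le_cellDensity {s : ℝ} (hs : 1 < s) (z : State E) (j : ℤ) :
    ‖z 0 j‖ ^ 2 + ‖z 1 j‖ ^ 2 + ‖z 2 j‖ ^ 2 + ‖z 3 j‖ ^ 2 ≤
      (16 + 2 / (s - 1)) * (cellDensity s z j + cellDensity s z (j - 1)) := by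
  have hb : 0 < s - 1 := by linarith
  have parts : ∀ i, ‖z 0 i‖ ^ 2 ≤ cellDensity s z i ∧
      (s - 1) / 2 * ‖z 1 i‖ ^ 2 ≤ cellDensity s z i ∧
      1 / 6 * ‖z 2 i - (1 / 2 : ℝ) • z 3 i‖ ^ 2 ≤ cellDensity s z i ∧
      1 / 6 * ‖z 2 (i + 1) + (1 / 2 : ℝ) • z 3 (i + 1)‖ ^ 2 ≤ cellDensity s z i := by
    intro i
    have h1 : 0 ≤ (s - 1) / 2 * ‖z 1 i‖ ^ 2 := by positivity
    have h2 : 0 ≤ (s - 1) / 2 * ‖z 1 (i + 1)‖ ^ 2 := by positivity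
    unfold cellDensity
    refine ⟨?_, ?_, ?_, ?_⟩ <;>
    linarith [sq_nonneg ‖z 0 i‖, sq_nonneg ‖z 1 i - z 1 (i + 1)‖,
      sq_nonneg ‖z 2 i - (1 / 2 : ℝ) • z 3 i‖, sq_nonneg ‖z 2 (i + 1) + (1 / 2 : ℝ) • z 3 (i + 1)‖,
      sq_nonneg ‖z 2 i - (1 / 2 : ℝ) • z 3 i + (z 2 (i + 1) + (1 / 2 : ℝ) • z 3 (i + 1))‖]
  obtain ⟨hD, hJ, hl, -⟩ := parts j
  have hr := (parts (j - 1)).2.2.2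
  rw [sub_add_cancel] at hr
  have hv : ‖z 2 j‖ ^ 2 ≤ 1 / 2 * (‖z 2 j - (1 / 2 : ℝ) • z 3 j‖ ^ 2
      + ‖z 2 j + (1 / 2 : ℝ) • z 3 j‖ ^ 2) := by
    rw [@norm_sub_sq_real, @norm_add_sq_real]
    nlinarith [sq_nonneg ‖(1 / 2 : ℝ) • z 3 j‖]
  have hy : ‖z 3 j‖ ^ 2 ≤ 2 * (‖z 2 j - (1 / 2 : ℝ) • z 3 j‖ ^ 2
      + ‖z 2 j + (1 / 2 : ℝ) • z 3 j‖ ^ 2) := by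
    rw [@norm_sub_sq_real, @norm_add_sq_real, norm_smul, mul_pow]
    norm_num
    nlinarith [sq_nonneg ‖z 2 j‖]
  have hJ' : ‖z 1 j‖ ^ 2 ≤ 2 / (s - 1) * cellDensity s z j := by
    rw [div_mul_eq_mul_div, le_div_iff₀ hb]
    linarith
  have := cellDensity_nonneg hs z (j - 1)
  have : 0 ≤ 2 / (s - 1) * cellDensity s z (j - 1) := by positivity
  linarith

/-- Extension of a set of cells to an indicator weight. -/
noncomputable def cellWeight (P : ℤ → Prop) : Seq E →L[ℝ] Seq E :=
  open Classical in
  mulWeight (fun j => if P j then 1 else 0) 1 fun j => by split_ifs <;> simp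

theorem hasSum_cellForm_cellWeight (s : ℝ) (P : ℤ → Prop) [DecidablePred P] (z : State E) :
    HasSum (fun j => if P j then cellDensity s z j else 0) (cellForm s (cellWeight P) z z) := by
  have := hasSum_cellForm s (fun j => if P j then 1 else 0) 1 (fun j => by split_ifs <;> simp) z
  simp only [ite_mul, one_mul, zero_mul] at this
  convert this
  ext f j
  simp [cellWeight]

/-- Summing the sitewise bound uses every cell at most twice, as left and as right neighbour of a
node; this is the extra factor 2. -/
theorem extSum_le_cellForm {s : ℝ} (hs : 1 < s) {P : ℤ → Prop} {n : ℤ}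
    (hP : ∀ j, n ≤ |j| → P j ∧ P (j - 1)) (z : State E) :
    extSum n (z 0) (z 1) (z 2) (z 3) ≤
      (2 * (16 + 2 / (s - 1))) * cellForm s (cellWeight P) z z := by
  classical
  have hb : 0 < s - 1 := by linarith
  have h1 := hasSum_cellForm_cellWeight s P z
  have h2 : HasSum (fun j => if P (j - 1) then cellDensity s z (j - 1) else 0)
      (cellForm s (cellWeight P) z z) := (Equiv.subRight (1 : ℤ)).hasSum_iff.2 h1
  have h3 := (h1.add h2).mul_left (16 + 2 / (s - 1))
  have e := (((summable_ite_norm_sq (fun j => n ≤ |j|) (z 0)).hasSum.add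
    (summable_ite_norm_sq (fun j => n ≤ |j|) (z 1)).hasSum).add
    (summable_ite_norm_sq (fun j => n ≤ |j|) (z 2)).hasSum).add
    (summable_ite_norm_sq (fun j => n ≤ |j|) (z 3)).hasSum
  rw [mul_comm 2, mul_assoc, two_mul]
  refine hasSum_le (fun j => ?_) e h3
  beta_reduce
  have p1 := cellDensity_nonneg hs z j
  have p2 := cellDensity_nonneg hs z (j - 1)
  by_cases h : n ≤ |j|
  · rw [if_pos h, if_pos h, if_pos h, if_pos h, if_pos (hP j h).1, if_pos (hP j h).2]
    exact site_le_cellDensity hs z j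
  · simp only [if_neg h, add_zero]
    split_ifs <;> positivity

theorem cellForm_cellWeight_nonneg {s : ℝ} (hs : 1 < s) (P : ℤ → Prop) (z : State E) :
    0 ≤ cellForm s (cellWeight P) z z := by
  classical
  refine (hasSum_cellForm_cellWeight s P z).nonneg fun j => ?_
  have := cellDensity_nonneg hs z j
  split_ifs <;> simp [this]

theorem cellWeight_true : cellWeight (E := E) (fun _ => True) = 1 := by
  ext f j
  simp [cellWeight]

/-- In the variables `(D, J, v, y)` the scaled energy is coercive with a constant independent of
`h`; this is the reason for using differences of averages and scaled velocities. -/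
theorem norm_sq_le_energy {s : ℝ} (hs : 1 < s) (z : State E) :
    ‖z‖ ^ 2 ≤ (2 * (16 + 2 / (s - 1))) * energy s z := by
  have h := extSum_le_cellForm hs (P := fun _ => True) (n := 0) (fun _ _ => ⟨trivial, trivial⟩) z
  rw [cellWeight_true] at h
  refine le_of_eq_of_le ?_ h
  rw [norm_sq_state, extSum]
  simp [extNormSq, norm_sq_eq_tsum]

end State
end DGWave
namespace DGWave

open Set MeasureTheory LaurentPolynomial
open scoped RealInnerProductSpace

/-! ### The virial form and the observability inequality -/

section Virial

variable {E : Type*} [NormedAddCommGroup E] [InnerProductSpace ℝ E]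

/-- The time derivative of this form is, up to exterior terms, the virial form. -/
noncomputable def virWeight (s : ℝ) (N : ℕ) (z : State E) : ℝ :=
  4 * (⟪posMul N (z 2), ev E (symK₁ s) (z 0) + ev E (symK₂ s) (z 1)⟫
      + ⟪posMul N (z 3), ev E (symK₃ s) (z 0) + ev E (symK₄ s) (z 1)⟫)
    + (⟪z 2, ev E (symN₁ s) (z 0) + ev E (symN₂ s) (z 1)⟫
      + ⟪z 3, ev E (symN₃ s) (z 0) + ev E (symN₄ s) (z 1)⟫)

/-- Only the linear growth in `N` matters: `N` will be of size `1/h`, and the factor `h⁻¹` in the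
derivative of `virWeight` compensates for it. -/
theorem exists_abs_virWeight_le (s : ℝ) :
    ∃ K : ℝ, 0 ≤ K ∧ ∀ (N : ℕ) (z : State E), |virWeight s N z| ≤ (N + 1) * K * ‖z‖ ^ 2 := by
  have key : ∀ p q : ℝ[T;T⁻¹], ∃ K : ℝ, 0 ≤ K ∧ ∀ z : State E,
      ‖ev E p (z 0) + ev E q (z 1)‖ ≤ K * ‖z‖ := fun p q =>
    ⟨‖ev E p ∘L comp E 0 + ev E q ∘L comp E 1‖, by positivity,
      (ev E p ∘L comp E 0 + ev E q ∘L comp E 1).le_opNorm⟩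
  obtain ⟨A₁, hA₁, h₁⟩ := key (symK₁ s) (symK₂ s)
  obtain ⟨A₂, hA₂, h₂⟩ := key (symK₃ s) (symK₄ s)
  obtain ⟨A₃, hA₃, h₃⟩ := key (symN₁ s) (symN₂ s)
  obtain ⟨A₄, hA₄, h₄⟩ := key (symN₃ s) (symN₄ s)
  refine ⟨4 * (A₁ + A₂) + (A₃ + A₄), by positivity, fun N z => ?_⟩
  have n2 : ‖z 2‖ ≤ ‖z‖ := PiLp.norm_apply_le z 2
  have n3 : ‖z 3‖ ≤ ‖z‖ := PiLp.norm_apply_le z 3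
  have hp : ∀ f g : Seq E, ∀ A : ℝ, ‖f‖ ≤ ‖z‖ → ‖g‖ ≤ A * ‖z‖ → |⟪f, g⟫| ≤ A * ‖z‖ ^ 2 := by
    intro f g A hf hg
    calc |⟪f, g⟫| ≤ ‖f‖ * ‖g‖ := abs_real_inner_le_norm _ _
      _ ≤ ‖z‖ * (A * ‖z‖) := by gcongr
      _ = _ := by ring
  have hq : ∀ f g : Seq E, ∀ A : ℝ, ‖f‖ ≤ ‖z‖ → ‖g‖ ≤ A * ‖z‖ →
      |⟪posMul N f, g⟫| ≤ N * (A * ‖z‖ ^ 2) := by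
    intro f g A hf hg
    calc |⟪posMul N f, g⟫| ≤ ‖posMul N f‖ * ‖g‖ := abs_real_inner_le_norm _ _
      _ ≤ (N * ‖z‖) * (A * ‖z‖) := by
        gcongr
        exact (norm_posMul_le N f).trans (by gcongr)
      _ = _ := by ring
  have b1 := hq _ _ _ n2 (h₁ z)
  have b2 := hq _ _ _ n3 (h₂ z)
  have b3 := hp _ _ _ n2 (h₃ z)
  have b4 := hp _ _ _ n3 (h₄ z)
  have e1 : 0 ≤ (N : ℝ) * ((A₃ + A₄) * ‖z‖ ^ 2) := by positivity
  have e2 : 0 ≤ (A₁ + A₂) * ‖z‖ ^ 2 := by positivity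
  unfold virWeight
  rw [abs_le] at b1 b2 b3 b4 ⊢
  constructor <;> linarith [b1.1, b1.2, b2.1, b2.2, b3.1, b3.2, b4.1, b4.2]

/-- The product rule gives `h⁻¹` times the expression in `virial_identity`. Only the lower bound on
the derivative is kept. -/
theorem exists_virWeight_deriv (s : ℝ) : ∃ (K : ℝ) (ρ : ℤ), 0 ≤ K ∧ 0 ≤ ρ ∧
    ∀ (N : ℕ) {h : ℝ} {I : Set ℝ} {t : ℝ} {z : ℝ → State E}, 0 < h →
      HasDerivWithinAt z (h⁻¹ • gen E s (z t)) I t →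
      ∃ d : ℝ, HasDerivWithinAt (fun t => virWeight s N (z t)) d I t ∧
        h⁻¹ * (virForm s (z t) - K * extSum (N - ρ) (z t 0) (z t 1) (z t 2) (z t 3)) ≤ d := by
  have neg : ∀ p : ℝ[T;T⁻¹], invert p + p = 0 → invert p = -p := fun p hp =>
    eq_neg_of_add_eq_zero_left hp
  obtain ⟨K, ρ, hK, hρ, H⟩ := virial_identity (E := E) (neg _ (virial_weight_DD s))
    (neg _ (virial_weight_JJ s)) (virial_weight_DJ s) (neg _ (virial_weight_VV s))
    (neg _ (virial_weight_YY s)) (virial_weight_VY s)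
    (fun q hq => by rw [hq]; exact virial_symbol_DD s)
    (fun q hq => by rw [hq]; exact virial_symbol_JJ s) (virial_symbol_DJ s)
    (fun q hq => by rw [hq]; exact virial_symbol_VV s)
    (fun q hq => by rw [hq]; exact virial_symbol_YY s) (virial_symbol_VY s)
  refine ⟨K, ρ, hK, hρ, fun N h I t z hh hz => ?_⟩
  have hc := fun i => hz.mapCLM (comp E i)
  have h0 := hc 0
  have h1 := hc 1
  have h2 := hc 2
  have h3 := hc 3
  simp only [comp_apply, PiLp.smul_apply, gen_zero, gen_one, gen_two, gen_three] at h0 h1 h2 h3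
  have m : ∀ p q, HasDerivWithinAt (fun t => ev E p (z t 0) + ev E q (z t 1))
      (ev E p (h⁻¹ • ev E symDelta (z t 2)) + ev E q (h⁻¹ • z t 3)) I t := fun p q =>
    (h0.mapCLM (ev E p)).add (h1.mapCLM (ev E q))
  have main := ((((h2.mapCLM (posMul N)).inner ℝ (m (symK₁ s) (symK₂ s))).add
    ((h3.mapCLM (posMul N)).inner ℝ (m (symK₃ s) (symK₄ s)))).const_mul 4).add
    ((h2.inner ℝ (m (symN₁ s) (symN₂ s))).add (h3.inner ℝ (m (symN₃ s) (symN₄ s))))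
  refine ⟨_, main, ?_⟩
  have hb := (abs_le.1 (H N (z t 0) (z t 1) (z t 2) (z t 3))).1
  have hb' := mul_le_mul_of_nonneg_left hb (inv_nonneg.2 hh.le)
  simp only [map_add, map_smul, smul_add, inner_add_left, inner_add_right,
    real_inner_smul_left, real_inner_smul_right] at hb' ⊢
  unfold virForm symForm
  clear main m h0 h1 h2 h3 hc hb H
  linarith

theorem continuous_cellForm (s : ℝ) (W : Seq E →L[ℝ] Seq E) :
    Continuous fun z : State E => cellForm s W z z := by
  have h : ∀ i, Continuous fun z : State E => z i := fun i => (comp E i).continuous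
  have h0 := h 0
  have h1 := h 1
  have h2 := h 2
  have h3 := h 3
  unfold cellForm
  fun_prop

/-- The observability inequality, for solutions which at some time lie in the cone where the virial
form controls the energy. -/
theorem observability {s : ℝ} (hs : 1 < s) : ∃ K₁ K₂ : ℝ, 0 < K₁ ∧ 0 < K₂ ∧
    ∀ {h T : ℝ} {P : ℤ → Prop} {z : ℝ → State E}, 0 < h → h ≤ 1 → 0 ≤ T →
      (∀ j : ℤ, (1 / h + 1 : ℝ) ≤ |(j : ℝ)| → P j ∧ P (j - 1)) →
      (∀ t ∈ Icc (0 : ℝ) T, HasDerivWithinAt z (h⁻¹ • gen E s (z t)) (Icc 0 T) t) →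
      (∃ t ∈ Icc (0 : ℝ) T, 48 * (s - 1) ^ 2 * energy s (z t) ≤ virForm s (z t)) →
      (T - K₁) * energy s (z 0) ≤ K₂ * ∫ t in (0 : ℝ)..T, cellForm s (cellWeight P) (z t) (z t) := by
  obtain ⟨A, hA, hΦ⟩ := exists_abs_virWeight_le (E := E) s
  obtain ⟨K, ρ, hK, hρ, hd⟩ := exists_virWeight_deriv (E := E) s
  have hb : 0 < s - 1 := by linarith
  set κ : ℝ := 2 * (16 + 2 / (s - 1)) with hκ
  have hκ0 : 0 < κ := by positivity
  set B : ℝ := 48 * (s - 1) ^ 2 with hB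
  have hB0 : 0 < B := by positivity
  have hρ' : (0 : ℝ) ≤ ρ := by exact_mod_cast hρ
  -- The summands `+ 1` serve only to make both constants positive.
  refine ⟨2 * (ρ + 4) * A * κ / B + 1, (K * κ + 1) / B, by positivity, by positivity, ?_⟩
  intro h T P z hh hh1 hT hP hz ⟨t₀, ht₀, hvir⟩
  -- The truncation is just far enough out: sites beyond `N - ρ` touch only cells in `P`, and `h (N
  -- + 1)` is still bounded uniformly in `h ≤ 1`.
  obtain ⟨N, hN1, hN2⟩ : ∃ N : ℕ, 1 / h + 1 + ρ ≤ N ∧ h * (N + 1) ≤ ρ + 4 := by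
    refine ⟨⌈1 / h + 1 + ρ⌉₊, Nat.le_ceil _, ?_⟩
    have := (Nat.ceil_lt_add_one (show 0 ≤ 1 / h + 1 + ρ by positivity)).le
    calc h * (⌈1 / h + 1 + ρ⌉₊ + 1) ≤ h * (1 / h + 1 + ρ + 1 + 1) := by gcongr
      _ = 1 + h * (ρ + 3) := by field_simp; ring
      _ ≤ 1 + 1 * (ρ + 3) := by gcongr
      _ = _ := by ring
  have hE : ∀ t ∈ Icc (0 : ℝ) T, energy s (z t) = energy s (z 0) := fun t ht =>
    energy_eq_initial hz ht
  -- Both sides are conserved, so domination at the single time `t₀` spreads to all of `[0, T]`.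
  have hV : ∀ t ∈ Icc (0 : ℝ) T, B * energy s (z 0) ≤ virForm s (z t) := fun t ht => by
    rw [virForm_eq_initial hz ht, ← virForm_eq_initial hz ht₀, ← hE t₀ ht₀]
    exact hvir
  have hcont : ContinuousOn z (Icc 0 T) := fun t ht => (hz t ht).continuousWithinAt
  have hΦ' : ∀ t ∈ Icc (0 : ℝ) T,
      |virWeight s N (z t)| ≤ (N + 1) * A * (κ * energy s (z 0)) := fun t ht => by
    refine (hΦ N _).trans ?_
    rw [← hE t ht]
    gcongr
    exact norm_sq_le_energy hs _
  have hext : ∀ t, extSum (N - ρ) (z t 0) (z t 1) (z t 2) (z t 3) ≤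
      κ * cellForm s (cellWeight P) (z t) (z t) := fun t => by
    refine extSum_le_cellForm hs (fun j hj => hP j ?_) (z t)
    have : ((N - ρ : ℤ) : ℝ) ≤ |(j : ℝ)| := by exact_mod_cast hj
    push_cast at this
    linarith
  choose! d hd1 hd2 using fun t (ht : t ∈ Icc (0 : ℝ) T) => hd N hh (hz t ht)
  have hq : ContinuousOn (fun t => cellForm s (cellWeight P) (z t) (z t)) (Icc 0 T) :=
    (continuous_cellForm s _).comp_continuousOn hcont
  -- Integrate the lower bound on the derivative of `virWeight`; the exterior terms have been
  -- replaced by the energy in the cells of `P`.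
  have main := intervalIntegral.integral_le_sub_of_hasDeriv_right_of_le
    (φ := fun t => h⁻¹ * (B * energy s (z 0) - K * (κ * cellForm s (cellWeight P) (z t) (z t)))) hT
    (fun t ht => (hd1 t ht).continuousWithinAt)
    (fun t ht => (hd1 t ⟨ht.1.le, ht.2.le⟩).mono_of_mem_nhdsWithin
      (Icc_mem_nhdsGT_of_mem ⟨ht.1.le, ht.2⟩))
    (ContinuousOn.integrableOn_Icc (by fun_prop))
    (fun t ht => by
      refine le_trans ?_ (hd2 t ⟨ht.1.le, ht.2.le⟩)
      have := hV t ⟨ht.1.le, ht.2.le⟩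
      have := hext t
      gcongr)
  have hq' : IntervalIntegrable (fun t => cellForm s (cellWeight P) (z t) (z t)) volume 0 T :=
    hq.intervalIntegrable_of_Icc hT
  rw [intervalIntegral.integral_const_mul, intervalIntegral.integral_sub (by simp)
    ((hq'.const_mul κ).const_mul K), intervalIntegral.integral_const,
    intervalIntegral.integral_const_mul, intervalIntegral.integral_const_mul] at main
  have i0 : 0 ≤ ∫ t in (0 : ℝ)..T, cellForm s (cellWeight P) (z t) (z t) :=
    intervalIntegral.integral_nonneg hT fun t _ => cellForm_cellWeight_nonneg hs P _
  generalize (∫ t in (0 : ℝ)..T, cellForm s (cellWeight P) (z t) (z t)) = Q at main i0 ⊢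
  have e0 : 0 ≤ energy s (z 0) := by
    have := norm_sq_le_energy hs (z 0)
    by_contra! hneg
    have : κ * energy s (z 0) < 0 := mul_neg_of_pos_of_neg hκ0 hneg
    nlinarith [sq_nonneg ‖z 0‖]
  have t1 := (abs_le.1 (hΦ' T ⟨hT, le_rfl⟩)).2
  have t2 := (abs_le.1 (hΦ' 0 ⟨le_rfl, hT⟩)).1
  have m2 : h⁻¹ * ((T - 0) • (B * energy s (z 0)) - K * (κ * Q)) ≤
      2 * ((N + 1) * A * (κ * energy s (z 0))) := by linarith
  rw [inv_mul_le_iff₀ hh, sub_zero, smul_eq_mul] at m2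
  -- The boundary terms at `0` and `T` cost a multiple of the energy that depends neither on `h` nor
  -- on `T`; it becomes the waiting time.
  have m3 : h * (2 * ((N + 1) * A * (κ * energy s (z 0)))) ≤
      2 * (ρ + 4) * A * κ * energy s (z 0) := by
    have : 0 ≤ 2 * A * κ * energy s (z 0) := by positivity
    nlinarith [mul_le_mul_of_nonneg_right hN2 this]
  have m4 : (T * B - 2 * (ρ + 4) * A * κ) * energy s (z 0) ≤ K * κ * Q := by linarith
  have e : (T - (2 * (ρ + 4) * A * κ / B + 1)) * energy s (z 0) =
      (T * B - 2 * (ρ + 4) * A * κ) * energy s (z 0) / B - energy s (z 0) := by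
    field_simp
    ring
  rw [e, div_mul_eq_mul_div]
  have : (T * B - 2 * (ρ + 4) * A * κ) * energy s (z 0) / B ≤ (K * κ + 1) * Q / B :=
    div_le_div_of_nonneg_right (by linarith) hB0.le
  linarith

end Virial
end DGWave
namespace DGWave

open Set MeasureTheory LaurentPolynomial
open scoped RealInnerProductSpace

/-! ### Bi-grid states -/

section Bigrid

variable {E : Type*} [NormedAddCommGroup E] [InnerProductSpace ℝ E]

/-- The substitution `S ↦ -S` in symbols. -/
noncomputable def negS : ℝ[T;T⁻¹] →ₐ[ℝ] ℝ[T;T⁻¹] :=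
  AddMonoidAlgebra.lift ℝ ℝ[T;T⁻¹] ℤ
    { toFun := fun n => ((-1 : ℝ) ^ n.toAdd) • T n.toAdd
      map_one' := by simp
      map_mul' := fun m n => by
        rw [toAdd_mul, T_add, zpow_add₀ (by norm_num), smul_mul_smul_comm] }

theorem negS_T (n : ℤ) : negS (T n) = ((-1 : ℝ) ^ n) • T n := by
  rw [negS, T, AddMonoidAlgebra.lift_single, one_smul]
  rfl

@[simp] theorem negS_C (r : ℝ) : negS (C r) = C r := negS.commutes r

@[simp] theorem negS_cs : negS cs = -cs := by
  rw [cs, map_add, map_mul, map_mul, negS_C, negS_T, negS_T]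
  norm_num
  ring

/-- Multiplication by `(-1)^j`. -/
noncomputable def signMul : Seq E →L[ℝ] Seq E :=
  mulWeight (fun j => (-1 : ℝ) ^ j) 1 fun j => by rw [abs_zpow]; simp

/-- Translation by `n` picks up the sign `(-1)^n` when it is conjugated with multiplication by
`(-1)^j`. -/
theorem signMul_ev (p : ℝ[T;T⁻¹]) (f : Seq E) :
    signMul (ev E p f) = ev E (negS p) (signMul f) := by
  induction p using LaurentPolynomial.induction_on' generalizing f with
  | add p q hp hq => simp only [map_add, add_apply, hp, hq]
  | C_mul_T n a =>
    rw [map_mul negS, negS_C, negS_T, ev_mul_apply, ev_mul_apply, ev_C, map_smul, ev_T]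
    ext j
    simp only [smul_apply, one_apply_eq_self, map_smul, seq_smul_apply, shift_apply, signMul,
      mulWeight_apply, zpow_add₀ (show (-1 : ℝ) ≠ 0 by norm_num), smul_smul]
    rcases Int.even_or_odd n with hn | hn <;> simp [hn.neg_one_zpow]

theorem inner_signMul (f g : Seq E) : ⟪signMul f, signMul g⟫ = ⟪f, g⟫ := by
  rw [signMul, inner_mulWeight_comm]
  congr 1
  ext j
  simp only [mulWeight_apply, smul_smul]
  rcases Int.even_or_odd j with hn | hn <;> simp [hn.neg_one_zpow]

/-- The hypothesis on `g` means support on the odd sites. A symbol odd under `S ↦ -S` contains only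
odd translations and moves `g` to the even sites, so the two factors have disjoint supports. -/
theorem inner_ev_eq_zero_of_negS {p : ℝ[T;T⁻¹]} (hp : negS p = -p) {g : Seq E}
    (hg : signMul g = -g) : ⟪g, ev E p g⟫ = 0 := by
  have h := inner_signMul g (ev E p g)
  rw [signMul_ev, hp, hg, map_neg, map_neg, neg_apply, neg_neg, inner_neg_left] at h
  linarith

theorem inner_ev_sq (p : ℝ[T;T⁻¹]) (g : Seq E) : ⟪g, ev E (invert p * p) g⟫ = ‖ev E p g‖ ^ 2 := by
  rw [← inner_ev_ev, real_inner_self_eq_norm_sq]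

/-- States of bi-grid data: `A = (1 + c) g` and `h A' = (1 + c) f` with `f`, `g` supported on the
odd sites, no jumps. -/
def IsBigridState (z : State E) : Prop :=
  z 1 = 0 ∧ z 3 = 0 ∧ ∃ f g : Seq E, signMul f = -f ∧ signMul g = -g ∧
    z 0 = ev E (symDelta * (1 + cs)) g ∧ z 2 = ev E (1 + cs) f

section
variable (s : ℝ)

/-- The part of the position symbol for bi-grid data that is odd under `S ↦ -S`. -/
noncomputable def bigridOddD : ℝ[T;T⁻¹] :=
  cs * (-48 * cs ^ 6 + 240 * cs ^ 4 * C s - 96 * cs ^ 4 - 480 * cs ^ 2 * C s ^ 2 + 480 * cs ^ 2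
    * C s - 144 * cs ^ 2 + 480 * C s ^ 2 - 720 * C s + 288)

/-- The part of the velocity symbol for bi-grid data that is odd under `S ↦ -S`. -/
noncomputable def bigridOddV : ℝ[T;T⁻¹] :=
  cs * (-72 * cs ^ 4 * C s + 96 * cs ^ 4 + 224 * cs ^ 2 * C s ^ 2 - 544 * cs ^ 2 * C s + 272 *
    cs ^ 2 + 256 * C s ^ 2 - 344 * C s + 112)

theorem negS_bigridOddD : negS (bigridOddD s) = -bigridOddD s := by
  simp only [bigridOddD, map_mul, map_add, map_sub, map_neg, map_pow, map_ofNat, negS_cs, negS_C]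
  ring

theorem negS_bigridOddV : negS (bigridOddV s) = -bigridOddV s := by
  simp only [bigridOddV, map_mul, map_add, map_sub, map_neg, map_pow, map_ofNat, negS_cs, negS_C]
  ring

/-- A sum-of-squares certificate. After substituting bi-grid data, what exceeds `4 (s - 1)²` times
the energy symbol is a combination of terms `invert p * p`, with coefficients nonnegative for `s >
1`, plus a part that is invisible on odd sites. -/
theorem bigrid_symbol_D :
    invert (symDelta * (1 + cs)) * ((virDD s - C (4 * (s - 1) ^ 2) * 12) * (symDelta * (1 + cs)))
      = C (192 * (s - 1) ^ 2) * (invert sn * sn)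
        + C (288 * (s - 1) ^ 2) * (invert (sn * cs) * (sn * cs))
        + C (144 * (s - 1)) * (invert (sn * sn) * (sn * sn))
        + C (96 * (s - 1)) * (invert (sn * sn * cs) * (sn * sn * cs)) + bigridOddD s := by
  have h := cs_sq_sub_sn_sq
  simp only [bigridOddD, virDD, symP₀, symP₁, symDelta, map_mul, map_pow, map_add, map_sub, map_one,
    map_ofNat, invert_cs, invert_sn]
  generalize cs = c at *
  generalize sn = d at *
  generalize (C s : ℝ[T;T⁻¹]) = k at *
  linear_combination (
    24 * c ^ 6 - 48 * c ^ 5 * k + 72 * c ^ 5 - 72 * c ^ 4 * k + 24 * c ^ 4 + 144 * c ^ 3 * k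
      ^ 2 - 432 * c ^ 3 * k + 240 * c ^ 3 + 96 * c ^ 2 * d ^ 2 * k - 96 * c ^ 2 * d ^ 2 + 96 *
      c ^ 2 * k ^ 2 - 48 * c ^ 2 * k - 24 * c ^ 2 + 336 * c * k ^ 2 - 480 * c * k + 168 * c +
      144 * d ^ 2 * k - 144 * d ^ 2 - 96 * k ^ 2 + 120 * k - 24) * h

theorem bigrid_symbol_V :
    invert (1 + cs) * ((virVV s - C (4 * (s - 1) ^ 2) * (4 * (2 + cs))) * (1 + cs))
      = C (64 * (s - 1) ^ 2) + C (368 * (s - 1) ^ 2) * (invert cs * cs)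
        + C (48 * (s - 1) ^ 2) * (invert (cs * cs) * (cs * cs))
        + C (56 * (s - 1)) * (invert sn * sn) + C (176 * (s - 1)) * (invert (sn * cs) * (sn * cs))
        + C (8 * (s - 1)) * (invert (sn * cs * cs) * (sn * cs * cs))
        + C 8 * (invert (sn * sn) * (sn * sn))
        + C 16 * (invert (sn * sn * cs) * (sn * sn * cs)) + bigridOddV s := by
  have h := cs_sq_sub_sn_sq
  simp only [bigridOddV, virVV, symP₀, symP₁, map_mul, map_pow, map_add, map_sub, map_one,
    map_ofNat, invert_cs, invert_sn]
  generalize cs = c at *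
  generalize sn = d at *
  generalize (C s : ℝ[T;T⁻¹]) = k at *
  linear_combination (
    -8 * c ^ 4 * k + 24 * c ^ 4 + 16 * c ^ 2 * d ^ 2 - 176 * c ^ 2 * k + 168 * c ^ 2 + 8 * d
      ^ 2 - 56 * k + 48) * h

end

theorem IsBigridState.energy_le_virForm {s : ℝ} (hs : 1 < s) {z : State E} (hz : IsBigridState z) :
    48 * (s - 1) ^ 2 * energy s z ≤ virForm s z := by
  obtain ⟨h1, h3, f, g, hf, hg, h0, h2⟩ := hz
  have hb : 0 < s - 1 := by linarith
  have hC : ∀ (r : ℝ) (p : ℝ[T;T⁻¹]) (f : Seq E), ev E (C r * p) f = r • ev E p f := fun r p f => by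
    rw [ev_mul_apply, ev_C]; rfl
  have hC' : ∀ (r : ℝ) (f : Seq E), ev E (C r) f = r • f := fun r f => by
    rw [ev_C]; rfl
  have pD : 0 ≤ ⟪z 0, ev E (virDD s - C (4 * (s - 1) ^ 2) * 12) (z 0)⟫ := by
    rw [h0, ← ev_mul_apply, inner_ev_ev, bigrid_symbol_D]
    simp only [map_add, add_apply, hC, inner_add_right, real_inner_smul_right, inner_ev_sq,
      inner_ev_eq_zero_of_negS (negS_bigridOddD s) hg]
    positivity
  have pV : 0 ≤ ⟪z 2, ev E (virVV s - C (4 * (s - 1) ^ 2) * (4 * (2 + cs))) (z 2)⟫ := by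
    rw [h2, ← ev_mul_apply, inner_ev_ev, bigrid_symbol_V]
    simp only [map_add, add_apply, hC, hC', inner_add_right, real_inner_smul_right, inner_ev_sq,
      inner_ev_eq_zero_of_negS (negS_bigridOddV s) hf, real_inner_self_eq_norm_sq]
    positivity
  have e := symForm_energy s z
  rw [map_sub, sub_apply, hC, inner_sub_right, real_inner_smul_right] at pD pV
  simp only [symForm, h1, h3, map_zero, inner_zero_left, inner_zero_right, add_zero] at e
  simp only [virForm, symForm, h1, h3, map_zero, inner_zero_left, inner_zero_right, add_zero]
  -- The energy symbols represent `12 * energy`, so the margin `4 (s - 1)²` becomes `48 (s - 1)²`.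
  have e' := congrArg (fun x => 4 * (s - 1) ^ 2 * x) e
  beta_reduce at e'
  linarith

end Bigrid
end DGWave
namespace DGWave

open Set MeasureTheory LaurentPolynomial
open scoped RealInnerProductSpace

/-! ### Coefficient vectors as pairs of sequences -/

section Coefficients

variable {𝕜 : Type*} [RCLike 𝕜]

/-- The real inner product of scalars. -/
noncomputable scoped instance : InnerProductSpace ℝ 𝕜 where
  inner x y := RCLike.re (y * star x)
  norm_sq_eq_re_inner x := by
    change _ = RCLike.re (x * star x)
    rw [RCLike.star_def, RCLike.mul_conj, ← RCLike.ofReal_pow, RCLike.ofReal_re]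
  conj_inner_symm x y := by
    simp [RCLike.mul_re]; ring
  add_left x y z := by simp [mul_add]
  smul_left x y r := by simp [RCLike.real_smul_eq_coe_mul, RCLike.mul_re]; ring

theorem real_inner_def (x y : 𝕜) : ⟪x, y⟫ = RCLike.re (y * star x) := rfl

/-- The sequence of averages. -/
noncomputable def avg : EllTwo 𝕜 →L[ℝ] Seq 𝕜 :=
  pull (fun j => (j, 0)) fun _ _ h => congrArg Prod.fst h

/-- The sequence of jumps. -/
noncomputable def jmp : EllTwo 𝕜 →L[ℝ] Seq 𝕜 :=
  pull (fun j => (j, 1)) fun _ _ h => congrArg Prod.fst h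

@[simp] theorem avg_apply (u : EllTwo 𝕜) (j : ℤ) : avg u j = u (j, 0) := rfl
@[simp] theorem jmp_apply (u : EllTwo 𝕜) (j : ℤ) : jmp u j = u (j, 1) := rfl

theorem inner_avg_add_inner_jmp (u v : EllTwo 𝕜) : ⟪avg u, avg v⟫ + ⟪jmp u, jmp v⟫ = ⟪u, v⟫ := by
  rw [lp.inner_eq_tsum, lp.inner_eq_tsum, lp.inner_eq_tsum,
    (lp.summable_inner (𝕜 := ℝ) u v).tsum_prod, ← Summable.tsum_add
      (lp.summable_inner (𝕜 := ℝ) (avg u) (avg v)) (lp.summable_inner (𝕜 := ℝ) (jmp u) (jmp v))]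
  refine tsum_congr fun j => ?_
  rw [tsum_fintype, Fin.sum_univ_two]
  rfl

theorem norm_sq_eq_avg_add_jmp (u : EllTwo 𝕜) : ‖u‖ ^ 2 = ‖avg u‖ ^ 2 + ‖jmp u‖ ^ 2 := by
  simp only [← real_inner_self_eq_norm_sq, inner_avg_add_inner_jmp]

theorem memℓp_glue (f g : Seq 𝕜) :
    Memℓp (fun k : ℤ × Fin 2 => if k.2 = 0 then f k.1 else g k.1) 2 := by
  rw [memℓp_two_iff, ← (Equiv.prodComm (Fin 2) ℤ).summable_iff]
  change Summable fun p : Fin 2 × ℤ => ‖if p.1 = 0 then f p.2 else g p.2‖ ^ 2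
  refine (summable_prod_of_nonneg fun _ => sq_nonneg _).2 ⟨fun i => ?_, Summable.of_finite⟩
  fin_cases i
  · simpa using summable_norm_sq f
  · simpa using summable_norm_sq g

/-- The coefficient vector with given averages and jumps. -/
noncomputable def glue (f g : Seq 𝕜) : EllTwo 𝕜 := ⟨_, memℓp_glue f g⟩

@[simp] theorem glue_zero (f g : Seq 𝕜) (j : ℤ) : glue f g (j, 0) = f j := by simp [glue]
@[simp] theorem glue_one (f g : Seq 𝕜) (j : ℤ) : glue f g (j, 1) = g j := by simp [glue]
@[simp] theorem avg_glue (f g : Seq 𝕜) : avg (glue f g) = f := by ext j; simp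
@[simp] theorem jmp_glue (f g : Seq 𝕜) : jmp (glue f g) = g := by ext j; simp

theorem glue_avg_jmp (u : EllTwo 𝕜) : glue (avg u) (jmp u) = u := by
  ext ⟨j, i⟩
  fin_cases i
  · exact glue_zero _ _ j
  · exact glue_one _ _ j

theorem ext_avg_jmp {u v : EllTwo 𝕜} (h₀ : avg u = avg v) (h₁ : jmp u = jmp v) : u = v := by
  rw [← glue_avg_jmp u, ← glue_avg_jmp v, h₀, h₁]

variable (𝕜) in
/-- The coefficient vector with given averages and jumps, as an operator on pairs of components of a
state. -/
noncomputable def glueCLM (i j : Fin 4) : State 𝕜 →L[ℝ] EllTwo 𝕜 :=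
  LinearMap.mkContinuous
    { toFun := fun z => glue (z i) (z j)
      map_add' := fun z w => ext_avg_jmp (by simp) (by simp)
      map_smul' := fun r z => ext_avg_jmp (by simp) (by simp) } 2 fun z => by
    refine le_of_sq_le_sq ?_ (by positivity)
    change ‖glue (z i) (z j)‖ ^ 2 ≤ _
    rw [norm_sq_eq_avg_add_jmp, avg_glue, jmp_glue, mul_pow]
    have h1 := PiLp.norm_apply_le z i
    have h2 := PiLp.norm_apply_le z j
    nlinarith [norm_nonneg (z i), norm_nonneg (z j), norm_nonneg z]

@[simp] theorem glueCLM_apply (i j : Fin 4) (z : State 𝕜) : glueCLM 𝕜 i j z = glue (z i) (z j) := rfl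

theorem re_pairing_eq_inner (u v : EllTwo 𝕜) :
    RCLike.re (pairing (u : Coeffs 𝕜) v) = ⟪avg v, avg u⟫ + ⟪jmp v, jmp u⟫ := by
  rw [inner_avg_add_inner_jmp, lp.inner_eq_tsum]
  have h := lp.summable_inner (𝕜 := 𝕜) v u
  exact RCLike.reCLM.map_tsum h

/-- The mass form, scaled. -/
noncomputable def massForm (a b a' b' : Seq 𝕜) : ℝ :=
  ⟪ev 𝕜 (4 * (2 + cs)) a + ev 𝕜 (2 * sn) b, a'⟫ + ⟪ev 𝕜 (2 - cs) b - ev 𝕜 (2 * sn) a, b'⟫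

theorem ev_cs_apply (f : Seq 𝕜) (j : ℤ) :
    ev 𝕜 cs f j = (1 / 2 : ℝ) • f (j + 1) + (1 / 2 : ℝ) • f (j - 1) := by
  rw [cs, ev_add_apply, ev_mul_apply, ev_mul_apply, ev_C, ev_T, ev_T]
  rfl

theorem ev_sn_apply (f : Seq 𝕜) (j : ℤ) :
    ev 𝕜 sn f j = (1 / 2 : ℝ) • f (j + 1) - (1 / 2 : ℝ) • f (j - 1) := by
  rw [sn, map_sub, sub_apply, ev_mul_apply, ev_mul_apply, ev_C, ev_T, ev_T]
  rfl

theorem ev_ofNat_mul (k : ℕ) [k.AtLeastTwo] (p : ℝ[T;T⁻¹]) (f : Seq 𝕜) :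
    ev 𝕜 (ofNat(k) * p) f = (ofNat(k) : ℝ) • ev 𝕜 p f := by
  rw [show (ofNat(k) : ℝ[T;T⁻¹]) = LaurentPolynomial.C ofNat(k) by rw [map_ofNat], ev_mul_apply,
    ev_C]; rfl

theorem ev_ofNat (k : ℕ) [k.AtLeastTwo] (f : Seq 𝕜) :
    ev 𝕜 (ofNat(k)) f = (ofNat(k) : ℝ) • f := by
  simpa using ev_ofNat_mul k 1 f

theorem massOp_eq (h : ℝ) (u : EllTwo 𝕜) :
    massOp h (u : Coeffs 𝕜) = glue
      ((h / 12) • (ev 𝕜 (4 * (2 + cs)) (avg u) + ev 𝕜 (2 * sn) (jmp u)))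
      ((h / 12) • (ev 𝕜 (2 - cs) (jmp u) - ev 𝕜 (2 * sn) (avg u))) := by
  ext ⟨j, i⟩
  fin_cases i
  · change massOp h (u : Coeffs 𝕜) (j, 0) = glue _ _ (j, 0)
    rw [glue_zero, massOp]
    simp only [seq_smul_apply, seq_add_apply, seq_sub_apply, ev_ofNat_mul, map_add, map_sub, add_apply,
      sub_apply, ev_ofNat, ev_cs_apply, ev_sn_apply, avg_apply, jmp_apply, mul_add]
    module
  · change massOp h (u : Coeffs 𝕜) (j, 1) = glue _ _ (j, 1)
    rw [glue_one, massOp]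
    simp only [seq_smul_apply, seq_add_apply, seq_sub_apply, ev_ofNat_mul, map_add, map_sub, add_apply,
      sub_apply, ev_ofNat, ev_cs_apply, ev_sn_apply, avg_apply, jmp_apply]
    module

theorem stiffOp_eq (s h : ℝ) (u : EllTwo 𝕜) :
    stiffOp s h (u : Coeffs 𝕜) = glue
      ((1 / h) • ev 𝕜 (2 - 2 * cs) (avg u)) ((1 / (2 * h)) • ev 𝕜 (symR s) (jmp u)) := by
  ext ⟨j, i⟩
  fin_cases i
  · change stiffOp s h (u : Coeffs 𝕜) (j, 0) = glue _ _ (j, 0)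
    rw [glue_zero, stiffOp]
    simp only [seq_smul_apply, seq_add_apply, seq_sub_apply, ev_ofNat_mul, map_add, map_sub, add_apply,
      sub_apply, ev_ofNat, ev_cs_apply, ev_sn_apply, avg_apply, jmp_apply]
    module
  · change stiffOp s h (u : Coeffs 𝕜) (j, 1) = glue _ _ (j, 1)
    rw [glue_one, stiffOp]
    simp only [seq_smul_apply, seq_add_apply, seq_sub_apply, ev_ofNat_mul, map_add, map_sub, add_apply,
      sub_apply, ev_ofNat, ev_cs_apply, ev_sn_apply, avg_apply, jmp_apply, symR, ev_C, smul_apply,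
      one_apply_eq_self, map_one]
    match_scalars <;> ring

end Coefficients
end DGWave
namespace DGWave

open Set MeasureTheory LaurentPolynomial
open scoped RealInnerProductSpace

/-! ### The equation in terms of averages and jumps -/

section Pairs

variable {𝕜 : Type*} [RCLike 𝕜]

/-- The first component of the scaled mass operator. -/
noncomputable def massA (a b : Seq 𝕜) : Seq 𝕜 := ev 𝕜 (4 * (2 + cs)) a + ev 𝕜 (2 * sn) b

/-- The second component of the scaled mass operator. -/
noncomputable def massB (a b : Seq 𝕜) : Seq 𝕜 := ev 𝕜 (2 - cs) b - ev 𝕜 (2 * sn) a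

theorem massForm_eq (a b a' b' : Seq 𝕜) :
    massForm a b a' b' = ⟪massA a b, a'⟫ + ⟪massB a b, b'⟫ := rfl

/-- The adjugate inverts the 2 × 2 mass symbol up to its determinant `4 (2 + cs)(2 - cs) + 4 sn² =
12`. Because this is a constant, no division by a symbol occurs. -/
theorem massInv_massA (a b : Seq 𝕜) :
    ev 𝕜 (2 - cs) (massA a b) - ev 𝕜 (2 * sn) (massB a b) = (12 : ℝ) • a := by
  have e : (2 - cs) * (4 * (2 + cs)) + 2 * sn * (2 * sn) = 12 := by
    linear_combination -4 * cs_sq_sub_sn_sq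
  have e' : (2 - cs) * (2 * sn) = 2 * sn * (2 - cs) := mul_comm _ _
  rw [← ev_ofNat, ← e]
  simp only [massA, massB]
  generalize 4 * (2 + cs) = p at *
  generalize 2 * sn = q at *
  generalize 2 - cs = r at *
  simp only [map_add, map_sub, ← ev_mul_apply, e', add_apply]
  abel

theorem massInv_massB (a b : Seq 𝕜) :
    ev 𝕜 (2 * sn) (massA a b) + ev 𝕜 (4 * (2 + cs)) (massB a b) = (12 : ℝ) • b := by
  have e : 4 * (2 + cs) * (2 - cs) + 2 * sn * (2 * sn) = 12 := by
    linear_combination -4 * cs_sq_sub_sn_sq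
  have e' : 4 * (2 + cs) * (2 * sn) = 2 * sn * (4 * (2 + cs)) := mul_comm _ _
  rw [← ev_ofNat, ← e]
  simp only [massA, massB]
  generalize 4 * (2 + cs) = p at *
  generalize 2 * sn = q at *
  generalize 2 - cs = r at *
  simp only [map_add, map_sub, ← ev_mul_apply, e', add_apply]
  abel

theorem massA_massInv (x y : Seq 𝕜) :
    massA (ev 𝕜 (2 - cs) x - ev 𝕜 (2 * sn) y) (ev 𝕜 (2 * sn) x + ev 𝕜 (4 * (2 + cs)) y)
      = (12 : ℝ) • x := by
  have e : 4 * (2 + cs) * (2 - cs) + 2 * sn * (2 * sn) = 12 := by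
    linear_combination -4 * cs_sq_sub_sn_sq
  have e' : 4 * (2 + cs) * (2 * sn) = 2 * sn * (4 * (2 + cs)) := mul_comm _ _
  rw [← ev_ofNat, ← e]
  simp only [massA, massB]
  generalize 4 * (2 + cs) = p at *
  generalize 2 * sn = q at *
  generalize 2 - cs = r at *
  simp only [map_add, map_sub, ← ev_mul_apply, e', add_apply]
  abel

theorem massB_massInv (x y : Seq 𝕜) :
    massB (ev 𝕜 (2 - cs) x - ev 𝕜 (2 * sn) y) (ev 𝕜 (2 * sn) x + ev 𝕜 (4 * (2 + cs)) y)
      = (12 : ℝ) • y := by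
  have e : (2 - cs) * (4 * (2 + cs)) + 2 * sn * (2 * sn) = 12 := by
    linear_combination -4 * cs_sq_sub_sn_sq
  have e' : (2 - cs) * (2 * sn) = 2 * sn * (2 - cs) := mul_comm _ _
  rw [← ev_ofNat, ← e]
  simp only [massA, massB]
  generalize 4 * (2 + cs) = p at *
  generalize 2 * sn = q at *
  generalize 2 - cs = r at *
  simp only [map_add, map_sub, ← ev_mul_apply, e', add_apply]
  abel

theorem mass_injective {a b a' b' : Seq 𝕜} (hA : massA a b = massA a' b')
    (hB : massB a b = massB a' b') : a = a' ∧ b = b' := by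
  have h12 : (12 : ℝ) ≠ 0 := by norm_num
  constructor
  · refine smul_right_injective _ h12 ?_
    beta_reduce
    rw [← massInv_massA a b, ← massInv_massA a' b', hA, hB]
  · refine smul_right_injective _ h12 ?_
    beta_reduce
    rw [← massInv_massB a b, ← massInv_massB a' b', hA, hB]

theorem massA_smul (r : ℝ) (a b : Seq 𝕜) : massA (r • a) (r • b) = r • massA a b := by
  simp [massA]

theorem massB_smul (r : ℝ) (a b : Seq 𝕜) : massB (r • a) (r • b) = r • massB a b := by
  simp [massB, smul_sub]

variable (𝕜) in
/-- The generator of the equation in terms of the averages, the jumps and their scaled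
velocities. -/
noncomputable def genP (s : ℝ) : State 𝕜 →L[ℝ] State 𝕜 :=
  mkState (comp 𝕜 2) (comp 𝕜 3)
    (ev 𝕜 (symAlpha * symDelta) ∘L comp 𝕜 0 + ev 𝕜 (symGamma s) ∘L comp 𝕜 1)
    (ev 𝕜 (symPhi * symDelta) ∘L comp 𝕜 0 + ev 𝕜 (symPsi s) ∘L comp 𝕜 1)

@[simp] theorem genP_zero (s : ℝ) (p : State 𝕜) : genP 𝕜 s p 0 = p 2 := rfl
@[simp] theorem genP_one (s : ℝ) (p : State 𝕜) : genP 𝕜 s p 1 = p 3 := rfl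
@[simp] theorem genP_two (s : ℝ) (p : State 𝕜) :
    genP 𝕜 s p 2 = ev 𝕜 (symAlpha * symDelta) (p 0) + ev 𝕜 (symGamma s) (p 1) := rfl
@[simp] theorem genP_three (s : ℝ) (p : State 𝕜) :
    genP 𝕜 s p 3 = ev 𝕜 (symPhi * symDelta) (p 0) + ev 𝕜 (symPsi s) (p 1) := rfl

variable (𝕜) in
/-- Passage from averages to their differences. -/
noncomputable def toDiff : State 𝕜 →L[ℝ] State 𝕜 :=
  mkState (ev 𝕜 symDelta ∘L comp 𝕜 0) (comp 𝕜 1) (comp 𝕜 2) (comp 𝕜 3)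

@[simp] theorem toDiff_zero (p : State 𝕜) : toDiff 𝕜 p 0 = ev 𝕜 symDelta (p 0) := rfl
@[simp] theorem toDiff_one (p : State 𝕜) : toDiff 𝕜 p 1 = p 1 := rfl
@[simp] theorem toDiff_two (p : State 𝕜) : toDiff 𝕜 p 2 = p 2 := rfl
@[simp] theorem toDiff_three (p : State 𝕜) : toDiff 𝕜 p 3 = p 3 := rfl

theorem state_ext {p q : State 𝕜} (h0 : p 0 = q 0) (h1 : p 1 = q 1) (h2 : p 2 = q 2)
    (h3 : p 3 = q 3) : p = q := by
  refine PiLp.ext fun i => ?_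
  fin_cases i <;> assumption

/-- The equation is posed for the averages, while the energy sees only their differences. This
intertwining lets both descriptions be used side by side. -/
theorem toDiff_genP (s : ℝ) (p : State 𝕜) : toDiff 𝕜 (genP 𝕜 s p) = gen 𝕜 s (toDiff 𝕜 p) :=
  state_ext (by simp) (by simp) (by simp [ev_mul_apply]) (by simp [ev_mul_apply])

theorem massA_genP (s : ℝ) (p : State 𝕜) :
    massA (genP 𝕜 s p 2) (genP 𝕜 s p 3) = -((12 : ℝ) • ev 𝕜 (2 - 2 * cs) (p 0)) := by
  have h := cs_sq_sub_sn_sq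
  have e1 : 4 * (2 + cs) * (symAlpha * symDelta) + 2 * sn * (symPhi * symDelta)
      = -(12 * (2 - 2 * cs)) := by
    simp only [symAlpha, symPhi, symDelta]
    linear_combination (-4 - 8 * cs + 4 * (cs ^ 2 - sn ^ 2 - 1)) * h
  have e2 : 4 * (2 + cs) * symGamma s + 2 * sn * symPsi s = 0 := by
    simp only [symGamma, symPsi]; ring
  simp only [massA, genP_two, genP_three, map_add, ← ev_mul_apply]
  have e1' := congrArg (fun q => ev 𝕜 q (p 0)) e1
  have e2' := congrArg (fun q => ev 𝕜 q (p 1)) e2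
  simp only [map_add, map_neg, add_apply, neg_apply, map_zero, zero_apply, ev_ofNat_mul 12] at e1' e2'
  rw [add_add_add_comm, e1', e2', add_zero]

theorem massB_genP (s : ℝ) (p : State 𝕜) :
    massB (genP 𝕜 s p 2) (genP 𝕜 s p 3) = -((6 : ℝ) • ev 𝕜 (symR s) (p 1)) := by
  have h := cs_sq_sub_sn_sq
  have e1 : (2 - cs) * (symPhi * symDelta) - 2 * sn * (symAlpha * symDelta) = 0 := by
    simp only [symAlpha, symPhi, symDelta]
    ring
  have e2 : (2 - cs) * symPsi s - 2 * sn * symGamma s = -(6 * symR s) := by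
    simp only [symGamma, symPsi]
    linear_combination (2 * symR s) * h
  simp only [massB, genP_two, genP_three, map_add, ← ev_mul_apply]
  have e1' := congrArg (fun q => ev 𝕜 q (p 0)) e1
  have e2' := congrArg (fun q => ev 𝕜 q (p 1)) e2
  simp only [map_sub, map_neg, sub_apply, neg_apply, map_zero, zero_apply, ev_ofNat_mul 6] at e1' e2'
  rw [add_sub_add_comm, e1', e2', zero_add]

theorem symDelta_sq : invert symDelta * symDelta = 2 - 2 * cs := by
  have h := cs_sq_sub_sn_sq
  simp only [symDelta, map_add, map_sub, map_one, invert_cs, invert_sn]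
  linear_combination h

theorem energy_toDiff (s : ℝ) (p : State 𝕜) :
    energy s (toDiff 𝕜 p) = ⟪ev 𝕜 (2 - 2 * cs) (p 0), p 0⟫ + 1 / 2 * ⟪ev 𝕜 (symR s) (p 1), p 1⟫
      + 1 / 12 * massForm (p 2) (p 3) (p 2) (p 3) := by
  have e := symForm_energy s (toDiff 𝕜 p)
  have c0 : ⟪ev 𝕜 symDelta (p 0), ev 𝕜 symDelta (p 0)⟫ = ⟪ev 𝕜 (2 - 2 * cs) (p 0), p 0⟫ := by
    rw [inner_ev_ev, symDelta_sq, real_inner_comm]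
  have c1 : ⟪p 3, ev 𝕜 sn (p 2)⟫ = -⟪p 2, ev 𝕜 sn (p 3)⟫ := by
    rw [inner_ev_swap, invert_sn, map_neg, neg_apply, inner_neg_right]
  simp only [symForm, toDiff_zero, toDiff_one, toDiff_two, toDiff_three, ev_ofNat, ev_ofNat_mul,
    real_inner_smul_right, c0, map_zero, zero_apply, inner_zero_right, add_zero] at e
  rw [massForm_eq, massA, massB]
  simp only [ev_ofNat_mul, inner_add_left, inner_sub_left, real_inner_smul_left]
  simp only [real_inner_comm (p 1), real_inner_comm (p 2), real_inner_comm (p 3)] at e ⊢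
  linarith

end Pairs
end DGWave
namespace DGWave

open Set MeasureTheory LaurentPolynomial
open scoped RealInnerProductSpace

/-! ### Energies and solutions in terms of states -/

section Translation

variable {𝕜 : Type*} [RCLike 𝕜]

variable (𝕜) in
/-- The state with given displacement and zero velocity. -/
noncomputable def posState : EllTwo 𝕜 →L[ℝ] State 𝕜 := mkState avg jmp 0 0

variable (𝕜) in
/-- The state with zero displacement and given velocity. -/
noncomputable def velState : EllTwo 𝕜 →L[ℝ] State 𝕜 := mkState 0 0 avg jmp

/-- The state of a displacement and a velocity. -/
noncomputable def pairState (h : ℝ) (u v : EllTwo 𝕜) : State 𝕜 := posState 𝕜 u + h • velState 𝕜 v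

section
variable (h : ℝ) (u v : EllTwo 𝕜)
@[simp] theorem pairState_zero : pairState h u v 0 = avg u := by simp [pairState, posState, velState]
@[simp] theorem pairState_one : pairState h u v 1 = jmp u := by simp [pairState, posState, velState]
@[simp] theorem pairState_two : pairState h u v 2 = h • avg v := by
  simp [pairState, posState, velState]
@[simp] theorem pairState_three : pairState h u v 3 = h • jmp v := by
  simp [pairState, posState, velState]
end

theorem re_pairing_massOp (h : ℝ) (u v : EllTwo 𝕜) :
    RCLike.re (pairing (massOp h (u : Coeffs 𝕜)) v) =
      h / 12 * massForm (avg u) (jmp u) (avg v) (jmp v) := by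
  rw [massOp_eq, re_pairing_eq_inner, avg_glue, jmp_glue, massForm_eq, massA, massB,
    real_inner_comm, real_inner_comm _ (jmp v), real_inner_smul_left, real_inner_smul_left]
  ring

theorem re_pairing_stiffOp (s h : ℝ) (u v : EllTwo 𝕜) :
    RCLike.re (pairing (stiffOp s h (u : Coeffs 𝕜)) v) =
      h⁻¹ * (⟪ev 𝕜 (2 - 2 * cs) (avg u), avg v⟫ + 1 / 2 * ⟪ev 𝕜 (symR s) (jmp u), jmp v⟫) := by
  rw [stiffOp_eq, re_pairing_eq_inner, avg_glue, jmp_glue,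
    real_inner_comm, real_inner_comm _ (jmp v), real_inner_smul_left, real_inner_smul_left]
  ring

theorem massForm_smul_smul (h : ℝ) (a b a' b' : Seq 𝕜) :
    massForm (h • a) (h • b) (h • a') (h • b') = h ^ 2 * massForm a b a' b' := by
  rw [massForm_eq, massForm_eq, massA_smul, massB_smul]
  simp only [real_inner_smul_left, real_inner_smul_right]
  ring

theorem energy_pairState {s h : ℝ} (hh : h ≠ 0) (u v : EllTwo 𝕜) :
    energy s (toDiff 𝕜 (pairState h u v)) =
      h * (RCLike.re (pairing (stiffOp s h (u : Coeffs 𝕜)) u)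
        + RCLike.re (pairing (massOp h (v : Coeffs 𝕜)) v)) := by
  rw [energy_toDiff, re_pairing_massOp, re_pairing_stiffOp]
  simp only [pairState_zero, pairState_one, pairState_two, pairState_three, massForm_smul_smul]
  field_simp

theorem totalEnergy_eq {s h : ℝ} (hh : h ≠ 0) (u v : EllTwo 𝕜) :
    totalEnergy s h (u : Coeffs 𝕜) v = (2 * h)⁻¹ * energy s (toDiff 𝕜 (pairState h u v)) := by
  rw [energy_pairState hh, totalEnergy, map_add]
  field_simp

/-- With `m` the mean of the two jumps, the slope is `(D + m) / h`, and the volume and flux terms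
combine to `(|D|² - |m|²) / h`: the products of `D` with jumps cancel. Writing `-|m|²` as minus half
the sum of the squared jumps plus a quarter of their squared difference, the penalty leaves the
weight `(s - 1) / 2`, so the density is a sum of squares. -/
theorem cellEnergy_eq {s h : ℝ} (hh : h ≠ 0) {u v : Coeffs 𝕜} {z : State 𝕜} {j : ℤ}
    (h0 : z 0 j = u (j + 1, 0) - u (j, 0)) (h1 : ∀ i, z 1 i = u (i, 1))
    (h2 : ∀ i, z 2 i = h • v (i, 0)) (h3 : ∀ i, z 3 i = h • v (i, 1)) :
    cellEnergy s h j u v = (2 * h)⁻¹ * cellDensity s z j := by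
  have hsl : slope h (star u) j = star (slope h u j) := by
    simp [slope, leftTrace, rightTrace, RCLike.real_smul_eq_coe_mul, RCLike.star_def]
  have hl : leftTrace (star v) j = star (leftTrace v j) := by
    simp [leftTrace]
  have hr : rightTrace (star v) j = star (rightTrace v j) := by
    simp [rightTrace]
  have es : slope h u j = h⁻¹ • (z 0 j + (1 / 2 : ℝ) • (z 1 j + z 1 (j + 1))) := by
    rw [h0, h1, h1, slope, leftTrace, rightTrace]
    simp only [RCLike.real_smul_eq_coe_mul]
    push_cast
    ring
  have el : leftTrace v j = h⁻¹ • (z 2 j - (1 / 2 : ℝ) • z 3 j) := by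
    have : (h : 𝕜) ≠ 0 := by exact_mod_cast hh
    rw [h2, h3, leftTrace]
    simp only [RCLike.real_smul_eq_coe_mul]
    push_cast
    field_simp
  have er : rightTrace v j = h⁻¹ • (z 2 (j + 1) + (1 / 2 : ℝ) • z 3 (j + 1)) := by
    have : (h : 𝕜) ≠ 0 := by exact_mod_cast hh
    rw [h2, h3, rightTrace]
    simp only [RCLike.real_smul_eq_coe_mul]
    push_cast
    field_simp
  have key : cellEnergy s h j u v = 1 / 2 * (h * ⟪slope h u j, slope h u j⟫
      - 1 / 2 * (⟪slope h u j, z 1 j + z 1 (j + 1)⟫ + ⟪z 1 j + z 1 (j + 1), slope h u j⟫)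
      + s / (2 * h) * (⟪z 1 j, z 1 j⟫ + ⟪z 1 (j + 1), z 1 (j + 1)⟫)
      + h / 6 * (2 * ⟪leftTrace v j, leftTrace v j⟫ + ⟪rightTrace v j, leftTrace v j⟫
        + ⟪leftTrace v j, rightTrace v j⟫ + 2 * ⟪rightTrace v j, rightTrace v j⟫)) := by
    rw [cellEnergy, cellStiff, cellMass, hsl, hl, hr, h1, h1]
    simp only [Pi.star_apply, real_inner_def, map_add, map_sub, RCLike.smul_re, star_add, mul_add,
      add_mul]
    have two : ∀ x : 𝕜, RCLike.re (2 * x) = 2 * RCLike.re x := fun x => by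
      rw [two_mul, map_add, two_mul]
    simp only [two, map_add, mul_comm (star (u (j, 1))), mul_comm (star (u (j + 1, 1)))]
  rw [key, es, el, er, cellDensity]
  simp only [← real_inner_self_eq_norm_sq]
  generalize z 0 j = D
  generalize z 1 j = J
  generalize z 1 (j + 1) = J'
  generalize z 2 j = v
  generalize z 2 (j + 1) = v'
  generalize z 3 j = y
  generalize z 3 (j + 1) = y'
  simp only [inner_add_left, inner_add_right, inner_sub_left, inner_sub_right,
    real_inner_smul_left, real_inner_smul_right]
  simp only [real_inner_comm D J, real_inner_comm D J', real_inner_comm J J',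
    real_inner_comm v v', real_inner_comm v y, real_inner_comm v y', real_inner_comm v' y,
    real_inner_comm v' y', real_inner_comm y y']
  field_simp
  ring

theorem isBigridState_pairState (h : ℝ) {u v : EllTwo 𝕜} (hu : IsBigrid (u : Coeffs 𝕜))
    (hv : IsBigrid (v : Coeffs 𝕜)) : IsBigridState (toDiff 𝕜 (pairState h u v)) := by
  have sgn : ∀ f : Seq 𝕜, signMul (signMul f) = f := fun f => by
    ext j
    simp only [signMul, mulWeight_apply, smul_smul]
    rcases Int.even_or_odd j with hn | hn <;> simp [hn.neg_one_zpow]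
  have key : ∀ w : EllTwo 𝕜, IsBigrid (w : Coeffs 𝕜) → jmp w = 0 ∧
      ∃ f : Seq 𝕜, signMul f = -f ∧ avg w = ev 𝕜 (1 + cs) f := by
    intro w hw
    -- The generating sequence is the restriction of the averages to the odd sites; applying `1 +
    -- cs` restores the interpolated even values.
    refine ⟨by ext j; exact hw.1 j, (1 / 2 : ℝ) • (avg w - signMul (avg w)), ?_, ?_⟩
    · rw [map_smul, map_sub, sgn, ← smul_neg, neg_sub]
    · ext j
      rw [ev_add_apply, map_one, seq_add_apply, ev_cs_apply]
      simp only [one_apply_eq_self, seq_smul_apply, seq_sub_apply, signMul, mulWeight_apply,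
        avg_apply, zpow_add₀ (show (-1 : ℝ) ≠ 0 by norm_num),
        zpow_sub₀ (show (-1 : ℝ) ≠ 0 by norm_num), zpow_one]
      rcases Int.even_or_odd j with hn | hn
      · obtain ⟨k, rfl⟩ := hn
        have e := hw.2 k
        rw [two_mul] at e
        simp only [Even.neg_one_zpow ⟨k, rfl⟩, RCLike.real_smul_eq_coe_mul]
        push_cast
        rw [e]
        ring
      · simp only [hn.neg_one_zpow, RCLike.real_smul_eq_coe_mul]
        push_cast
        ring
  obtain ⟨hu1, g, hg, hu0⟩ := key u hu
  obtain ⟨hv1, f, hf, hv0⟩ := key v hv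
  refine ⟨by simp [hu1], by simp [hv1], h • f, g, by rw [map_smul, hf, smul_neg], hg, ?_, ?_⟩
  · rw [toDiff_zero, pairState_zero, hu0, ev_mul_apply]
  · rw [toDiff_two, pairState_two, hv0, map_smul]

/-- The velocity of a solution satisfies the equation in first-order form. -/
theorem pairState_deriv {s h : ℝ} (hh : h ≠ 0) {U V W : EllTwo 𝕜}
    (hW : ∀ k, massOp h (W : Coeffs 𝕜) k + stiffOp s h (U : Coeffs 𝕜) k = 0) :
    pairState h V W = h⁻¹ • genP 𝕜 s (pairState h U V) := by
  have h0 : (h / 12) • massA (avg W) (jmp W) + (1 / h) • ev 𝕜 (2 - 2 * cs) (avg U) = 0 := by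
    ext j
    have := hW (j, 0)
    rwa [massOp_eq, stiffOp_eq, glue_zero, glue_zero] at this
  have h1 : (h / 12) • massB (avg W) (jmp W) + (1 / (2 * h)) • ev 𝕜 (symR s) (jmp U) = 0 := by
    ext j
    have := hW (j, 1)
    rwa [massOp_eq, stiffOp_eq, glue_one, glue_one] at this
  have m := mass_injective (a := h ^ 2 • avg W) (b := h ^ 2 • jmp W)
    (a' := genP 𝕜 s (pairState h U V) 2) (b' := genP 𝕜 s (pairState h U V) 3)
    (by
      rw [massA_genP, massA_smul, pairState_zero]
      -- Multiplying by `12 h` turns the scalings `h / 12` and `1 / h` into `h²` and `12`, as in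
      -- `massA_genP`.
      have e := congrArg (fun x => (12 * h) • x) (eq_neg_of_add_eq_zero_left h0)
      beta_reduce at e
      rw [smul_smul, smul_neg, smul_smul] at e
      rw [show 12 * h * (h / 12) = h ^ 2 by ring, show 12 * h * (1 / h) = 12 by field_simp] at e
      exact e)
    (by
      rw [massB_genP, massB_smul, pairState_one]
      have e := congrArg (fun x => (12 * h) • x) (eq_neg_of_add_eq_zero_left h1)
      beta_reduce at e
      rw [smul_smul, smul_neg, smul_smul] at e
      rw [show 12 * h * (h / 12) = h ^ 2 by ring,
        show 12 * h * (1 / (2 * h)) = 6 by field_simp; norm_num] at e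
      exact e)
  refine state_ext ?_ ?_ ?_ ?_
  · simp [hh]
  · simp [hh]
  · rw [PiLp.smul_apply, ← m.1, pairState_two, smul_smul]
    congr 1
    field_simp
  · rw [PiLp.smul_apply, ← m.2, pairState_three, smul_smul]
    congr 1
    field_simp

theorem localEnergy_eq {s h : ℝ} (hh : h ≠ 0) (u v : EllTwo 𝕜) :
    localEnergy s h (u : Coeffs 𝕜) v = (2 * h)⁻¹ * cellForm s (cellWeight (CellInOmega h))
      (toDiff 𝕜 (pairState h u v)) (toDiff 𝕜 (pairState h u v)) := by
  classical
  rw [← (hasSum_cellForm_cellWeight s (CellInOmega h) _).tsum_eq, ← tsum_mul_left, localEnergy]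
  refine tsum_congr fun j => ?_
  have e : ev 𝕜 symDelta (avg u) j = u (j + 1, 0) - u (j, 0) := by
    rw [show symDelta = T 1 - 1 by rw [symDelta, cs_add_sn], map_sub, map_one, ev_T]
    rfl
  split_ifs
  · exact cellEnergy_eq hh (by rw [toDiff_zero, pairState_zero, e]) (fun i => by simp)
      (fun i => by rw [toDiff_two, pairState_two]; rfl)
      (fun i => by rw [toDiff_three, pairState_three]; rfl)
  · simp

/-- The extra 1 in the hypothesis leaves room for the second cell meeting at the node. -/
theorem cellInOmega_of_le {h : ℝ} (hh : 0 < h) (j : ℤ) (hj : (1 / h + 1 : ℝ) ≤ |(j : ℝ)|) :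
    CellInOmega h j ∧ CellInOmega h (j - 1) := by
  have e : h * (1 / h + 1) = 1 + h := by field_simp
  have := mul_le_mul_of_nonneg_left hj hh.le
  rw [e] at this
  rcases abs_cases (j : ℝ) with ⟨h1, h2⟩ | ⟨h1, h2⟩ <;> rw [h1] at this
  · constructor <;> left <;> push_cast <;> nlinarith
  · constructor <;> right <;> push_cast <;> nlinarith

/-- Uniform observability of solutions with bi-grid data. -/
theorem observability_bigrid (𝕜 : Type*) [RCLike 𝕜] {s : ℝ} (hs : 1 < s) :
    ∃ K₁ K₂ : ℝ, 0 < K₁ ∧ 0 < K₂ ∧ ∀ {h T : ℝ} {U V : ℝ → EllTwo 𝕜}, 0 < h → h ≤ 1 → 0 ≤ T →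
      IsSolution s h U V → IsBigrid (U 0 : Coeffs 𝕜) → IsBigrid (V 0 : Coeffs 𝕜) →
      (T - K₁) * totalEnergy s h (U 0 : Coeffs 𝕜) (V 0) ≤
        K₂ * ∫ t in (0 : ℝ)..T, localEnergy s h (U t : Coeffs 𝕜) (V t) := by
  obtain ⟨K₁, K₂, hK₁, hK₂, H⟩ := observability (E := 𝕜) hs
  refine ⟨K₁, K₂, hK₁, hK₂, fun {h T U V} hh hh1 hT hsol hU hV => ?_⟩
  obtain ⟨hU', W, hW⟩ := hsol
  have hz : ∀ t ∈ Icc (0 : ℝ) T, HasDerivWithinAt (fun t => toDiff 𝕜 (pairState h (U t) (V t)))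
      (h⁻¹ • gen 𝕜 s (toDiff 𝕜 (pairState h (U t) (V t)))) (Icc 0 T) t := by
    intro t ht
    have hsub : Icc (0 : ℝ) T ⊆ Ici 0 := Icc_subset_Ici_self
    have h1 := ((hU' t ht.1).mono hsub).mapCLM (posState 𝕜)
    have h2 := (((hW t ht.1).1.mono hsub).mapCLM (velState 𝕜)).const_smul h
    have h3 := (h1.add h2).mapCLM (toDiff 𝕜)
    rw [← toDiff_genP, ← map_smul, ← pairState_deriv hh.ne' (hW t ht.1).2]
    exact h3
  have key := H hh hh1 hT (cellInOmega_of_le hh) hz ⟨0, ⟨le_rfl, hT⟩,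
    (isBigridState_pairState h hU hV).energy_le_virForm hs⟩
  simp only [totalEnergy_eq hh.ne', localEnergy_eq hh.ne', intervalIntegral.integral_const_mul]
  have := mul_le_mul_of_nonneg_left key (show 0 ≤ (2 * h)⁻¹ by positivity)
  linarith

end Translation
end DGWave
namespace DGWave

open Set MeasureTheory LaurentPolynomial
open scoped RealInnerProductSpace

/-! ### Linear flows -/

section Flow

variable {H H' : Type*} [NormedAddCommGroup H] [NormedSpace ℝ H] [CompleteSpace H]
  [NormedAddCommGroup H'] [NormedSpace ℝ H'] [CompleteSpace H']

/-- The flow of the equation `z' = A z`. -/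
noncomputable def flow (A : H →L[ℝ] H) (t : ℝ) : H →L[ℝ] H := NormedSpace.exp (t • A)

omit [CompleteSpace H] in
@[simp] theorem flow_zero (A : H →L[ℝ] H) : flow A 0 = 1 := by
  simp [flow]

theorem hasDerivAt_flow (A : H →L[ℝ] H) (t : ℝ) : HasDerivAt (flow A) (A * flow A t) t :=
  hasDerivAt_exp_smul_const' A t

theorem hasDerivAt_flow' (A : H →L[ℝ] H) (t : ℝ) : HasDerivAt (flow A) (flow A t * A) t :=
  hasDerivAt_exp_smul_const A t

theorem continuous_flow (A : H →L[ℝ] H) : Continuous (flow A) :=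
  continuous_iff_continuousAt.2 fun t => (hasDerivAt_flow A t).continuousAt

theorem flow_add (A : H →L[ℝ] H) (t r : ℝ) : flow A (t + r) = flow A t * flow A r := by
  let _ := NormedAlgebra.restrictScalars ℚ ℝ (H →L[ℝ] H)
  rw [flow, add_smul]
  exact NormedSpace.exp_add_of_commute ((Commute.refl A).smul_left t |>.smul_right r)

theorem flow_neg_apply (A : H →L[ℝ] H) (t : ℝ) (x : H) : flow A (-t) (flow A t x) = x := by
  change (flow A (-t) * flow A t) x = x
  rw [← flow_add, neg_add_cancel, flow_zero]
  rfl

theorem flow_neg_apply' (A : H →L[ℝ] H) (t : ℝ) (x : H) : flow A t (flow A (-t) x) = x := by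
  simpa using flow_neg_apply A (-t) x

theorem hasDerivAt_flow_sub_apply (A : H →L[ℝ] H) (r : ℝ) (x : H) (t : ℝ) :
    HasDerivAt (fun t => flow A (t - r) x) (A (flow A (t - r) x)) t := by
  have h := (hasDerivAt_flow A (t - r)).comp_sub_const t r
  exact h.clm_apply (hasDerivAt_const t x) |>.congr_deriv (by simp)

/-- Going forward with `A`, across by `L`, and back with `B` is constant in time. -/
theorem map_flow {A : H →L[ℝ] H} {B : H' →L[ℝ] H'} {L : H →L[ℝ] H'}
    (hL : ∀ x, L (A x) = B (L x)) (t : ℝ) (x : H) : L (flow A t x) = flow B t (L x) := by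
  have key : ∀ t, HasDerivAt (fun t => flow B (-t) (L (flow A t x))) 0 t := fun t => by
    have h1 := (hasDerivAt_flow' B (-t)).scomp t (hasDerivAt_neg t)
    have h2 := L.hasFDerivAt.comp_hasDerivAt t
      ((hasDerivAt_flow A t).clm_apply (hasDerivAt_const t x))
    refine (h1.clm_apply h2).congr_deriv ?_
    simp [hL]
  have h := is_const_of_deriv_eq_zero (fun t => (key t).differentiableAt) (fun t => (key t).deriv)
    t 0
  simp only [neg_zero, flow_zero, one_apply_eq_self] at h
  rw [← h, flow_neg_apply']

/-- Variation of constants. -/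
theorem hasDerivAt_duhamel (A : H →L[ℝ] H) {b : ℝ → H} (hb : Continuous b) (x : H) (t : ℝ) :
    HasDerivAt (fun t => flow A t (x + ∫ τ in (0 : ℝ)..t, flow A (-τ) (b τ)))
      (A (flow A t (x + ∫ τ in (0 : ℝ)..t, flow A (-τ) (b τ))) + b t) t := by
  have hc : Continuous fun τ => flow A (-τ) (b τ) :=
    ((continuous_flow A).comp continuous_neg).clm_apply hb
  have h1 := (hc.integral_hasStrictDerivAt 0 t).hasDerivAt.const_add x
  refine ((hasDerivAt_flow A t).clm_apply h1).congr_deriv ?_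
  rw [flow_neg_apply']
  rfl

end Flow

/-! ### Observability Gramians -/

section Gramian

variable {H : Type*} [NormedAddCommGroup H] [InnerProductSpace ℝ H] [CompleteSpace H]

/-- The bound by `M` makes `ℓ` a bounded functional on the range of `ι`; it is extended by
Hahn–Banach, and Lax–Milgram applies on the closed span. The separate bound by `N` passes to the
closure by continuity, and tested on `ψ` itself it yields a cost estimate that involves neither `c`
nor `M`. -/
theorem exists_of_coercive_on_closure {X : Type*} [AddCommGroup X] [Module ℝ X] (ι : X →ₗ[ℝ] H)
    (G : H →L[ℝ] H) {c : ℝ} (hc : 0 < c)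
    (hG : ∀ x ∈ closure (range ι), c * ‖x‖ ^ 2 ≤ ⟪G x, x⟫) (ℓ : X →ₗ[ℝ] ℝ) {M : ℝ}
    (hℓ : ∀ x, |ℓ x| ≤ M * ‖ι x‖) {N : H → ℝ} (hN : Continuous N)
    (hℓN : ∀ x, ℓ x ^ 2 ≤ N (ι x)) :
    ∃ ψ ∈ closure (range ι), (∀ x, ⟪G ψ, ι x⟫ = ℓ x) ∧ ⟪G ψ, ψ⟫ ^ 2 ≤ N ψ := by
  obtain ⟨g, hg⟩ := LinearMap.exists_rightInverse_of_surjective ι.rangeRestrict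
    ι.range_rangeRestrict
  have hg' : ∀ y : ι.range, ι (g y) = y := fun y =>
    congrArg Subtype.val (LinearMap.congr_fun hg y)
  have hker : ∀ x y, ι x = ι y → ℓ x = ℓ y := fun x y h => by
    have := hℓ (x - y)
    rw [map_sub, map_sub, h, sub_self, norm_zero, mul_zero] at this
    exact sub_eq_zero.1 (abs_nonpos_iff.1 this)
  obtain ⟨φ, hφ, -⟩ := exists_extension_norm_eq ι.range
    (LinearMap.mkContinuous (ℓ ∘ₗ g) M fun y => by
      have := hℓ (g y)
      rwa [hg'] at this)
  have hφι : ∀ x, φ (ι x) = ℓ x := fun x => by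
    refine (hφ ⟨ι x, LinearMap.mem_range_self ι x⟩).trans ?_
    exact hker _ _ (hg' _)
  have hφN : ∀ y ∈ closure (range ι), φ y ^ 2 ≤ N y := by
    refine fun y hy => closure_minimal (t := {y | φ y ^ 2 ≤ N y}) ?_
      (isClosed_le (by fun_prop) hN) hy
    rintro _ ⟨x, rfl⟩
    rw [mem_ofPred_eq, hφι]
    exact hℓN x
  let S : Submodule ℝ H := ι.range.topologicalClosure
  have hS : (S : Set H) = closure (range ι) := by
    rw [Submodule.topologicalClosure_coe, LinearMap.coe_range]
  have hS' : ∀ x, x ∈ S ↔ x ∈ closure (range ι) := fun x => by rw [← hS]; rfl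
  have : CompleteSpace S := (Submodule.isClosed_topologicalClosure _).completeSpace_coe
  let B : S →L[ℝ] S →L[ℝ] ℝ := ((innerSL ℝ).comp G).bilinearComp S.subtypeL S.subtypeL
  have hB : IsCoercive B := ⟨c, hc, fun u => by
    have := hG u ((hS' _).1 u.2)
    rw [mul_assoc, ← sq]
    exact this⟩
  let r : S := (InnerProductSpace.toDual ℝ S).symm (φ.comp S.subtypeL)
  let ψ : S := hB.continuousLinearEquivOfBilin.symm r
  have hψ : ∀ w : S, ⟪G ψ, w⟫ = φ w := fun w => by
    have h1 := hB.continuousLinearEquivOfBilin_apply ψ w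
    rw [ContinuousLinearEquiv.apply_symm_apply, InnerProductSpace.toDual_symm_apply] at h1
    exact h1.symm
  refine ⟨ψ, (hS' _).1 ψ.2, fun x => ?_, ?_⟩
  · rw [← hφι]
    exact hψ ⟨ι x, (hS' _).2 (subset_closure (mem_range_self x))⟩
  · rw [hψ]
    exact hφN _ ((hS' _).1 ψ.2)

/-- The Gramian of the flow of `A`, run backwards from the time `T`, for the form of `Q`. -/
noncomputable def gramian (A Q : H →L[ℝ] H) (T : ℝ) : H →L[ℝ] H :=
  ∫ t in (0 : ℝ)..T, (flow A (t - T)).adjoint * (Q * flow A (t - T))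

theorem inner_gramian (A Q : H →L[ℝ] H) (T : ℝ) (x y : H) :
    ⟪gramian A Q T x, y⟫ = ∫ t in (0 : ℝ)..T, ⟪Q (flow A (t - T) x), flow A (t - T) y⟫ := by
  have hf : Continuous fun t => flow A (t - T) :=
    (continuous_flow A).comp (continuous_id.sub continuous_const)
  have hc : Continuous fun t => (flow A (t - T)).adjoint * (Q * flow A (t - T)) :=
    (ContinuousLinearMap.adjoint.continuous.comp hf).mul (continuous_const.mul hf)
  let L : (H →L[ℝ] H) →L[ℝ] ℝ := (innerSL ℝ y).comp (ContinuousLinearMap.apply ℝ H x)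
  have h := L.intervalIntegral_comp_comm (hc.intervalIntegrable (μ := volume) 0 T)
  rw [real_inner_comm]
  refine h.symm.trans (intervalIntegral.integral_congr fun t _ => ?_)
  change ⟪y, (flow A (t - T)).adjoint (Q (flow A (t - T) x))⟫ = _
  rw [ContinuousLinearMap.adjoint_inner_right, real_inner_comm]

end Gramian
end DGWave
namespace DGWave

open Set MeasureTheory LaurentPolynomial
open scoped RealInnerProductSpace

/-! ### Loads and the duality of controlled and free states -/

section CellOp

variable {E : Type*} [NormedAddCommGroup E] [InnerProductSpace ℝ E]

/-- The jump component of the operator of the cell form. -/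
noncomputable def loadJ (s : ℝ) (W : Seq E →L[ℝ] Seq E) : State E →L[ℝ] Seq E :=
  (((s - 1) / 2) • (W + shift (-1) ∘L W ∘L shift 1)
    + (1 / 4 : ℝ) • ((1 - shift (-1)) ∘L W ∘L (1 - shift 1))) ∘L comp E 1

/-- The trace of the velocity at the left end of the cells. -/
noncomputable def traceL : State E →L[ℝ] Seq E := comp E 2 - (1 / 2 : ℝ) • comp E 3

/-- The trace of the velocity at the right end of the cells. -/
noncomputable def traceR : State E →L[ℝ] Seq E := shift 1 ∘L (comp E 2 + (1 / 2 : ℝ) • comp E 3)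

/-- The average component of the velocity part of the operator of the cell form. -/
noncomputable def loadV (W : Seq E →L[ℝ] Seq E) : State E →L[ℝ] Seq E :=
  (1 / 6 : ℝ) • (W ∘L traceL + shift (-1) ∘L W ∘L traceR
    + (1 + shift (-1)) ∘L W ∘L (traceL + traceR))

/-- The jump component of the velocity part of the operator of the cell form. -/
noncomputable def loadY (W : Seq E →L[ℝ] Seq E) : State E →L[ℝ] Seq E :=
  (1 / 12 : ℝ) • (-(W ∘L traceL) + shift (-1) ∘L W ∘L traceR
    + (shift (-1) - 1) ∘L W ∘L (traceL + traceR))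

/-- The operator of the cell form. -/
noncomputable def cellOp (s : ℝ) (W : Seq E →L[ℝ] Seq E) : State E →L[ℝ] State E :=
  mkState (W ∘L comp E 0) (loadJ s W) (loadV W) (loadY W)

theorem inner_state (z w : State E) :
    ⟪z, w⟫ = ⟪z 0, w 0⟫ + ⟪z 1, w 1⟫ + ⟪z 2, w 2⟫ + ⟪z 3, w 3⟫ := by
  rw [PiLp.inner_apply, Fin.sum_univ_four]

theorem inner_shift_neg (f g : Seq E) : ⟪shift (-1) f, g⟫ = ⟪f, shift 1 g⟫ := by
  rw [inner_shift, neg_neg]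

theorem inner_cellOp (s : ℝ) (W : Seq E →L[ℝ] Seq E) (z w : State E) :
    ⟪cellOp s W z, w⟫ = cellForm s W z w := by
  rw [inner_state, cellForm]
  simp only [cellOp, mkState_apply_zero, mkState_apply_one, mkState_apply_two, mkState_apply_three,
    loadJ, loadV, loadY, traceL, traceR, ContinuousLinearMap.comp_apply, add_apply, sub_apply,
    neg_apply, smul_apply, one_apply_eq_self, comp_apply, map_add, map_sub, map_smul,
    inner_add_left, inner_sub_left, inner_neg_left, inner_add_right, inner_sub_right,
    real_inner_smul_left, real_inner_smul_right, inner_shift_neg]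
  ring

theorem continuous_energy (s : ℝ) : Continuous (energy (E := E) s) := by
  unfold energy
  exact continuous_cellForm s 1

theorem continuous_virForm (s : ℝ) : Continuous (virForm (E := E) s) := by
  have c : ∀ i, Continuous fun z : State E => z i := fun i => (comp E i).continuous
  have := c 0
  have := c 1
  have := c 2
  have := c 3
  unfold virForm symForm
  fun_prop

theorem energy_nonneg {s : ℝ} (hs : 1 < s) (z : State E) : 0 ≤ energy s z := by
  rw [energy, ← cellWeight_true]
  exact cellForm_cellWeight_nonneg hs _ z

end CellOp

section Duality

variable {𝕜 : Type*} [RCLike 𝕜]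

variable (𝕜) in
/-- The operator of the symplectic form of the equation. -/
noncomputable def sympOp : State 𝕜 →L[ℝ] State 𝕜 :=
  mkState (ev 𝕜 (4 * (2 + cs)) ∘L comp 𝕜 2 + ev 𝕜 (2 * sn) ∘L comp 𝕜 3)
    (ev 𝕜 (2 - cs) ∘L comp 𝕜 3 - ev 𝕜 (2 * sn) ∘L comp 𝕜 2)
    (-(ev 𝕜 (4 * (2 + cs)) ∘L comp 𝕜 0 + ev 𝕜 (2 * sn) ∘L comp 𝕜 1))
    (-(ev 𝕜 (2 - cs) ∘L comp 𝕜 1 - ev 𝕜 (2 * sn) ∘L comp 𝕜 0))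

theorem inner_sympOp (X p : State 𝕜) : ⟪sympOp 𝕜 X, p⟫ =
    massForm (X 2) (X 3) (p 0) (p 1) - massForm (X 0) (X 1) (p 2) (p 3) := by
  rw [inner_state]
  change ⟪massA (X 2) (X 3), p 0⟫ + ⟪massB (X 2) (X 3), p 1⟫
    + ⟪-massA (X 0) (X 1), p 2⟫ + ⟪-massB (X 0) (X 1), p 3⟫ = _
  rw [massForm_eq, massForm_eq, inner_neg_left, inner_neg_left]
  ring

theorem massForm_comm (a b a' b' : Seq 𝕜) : massForm a b a' b' = massForm a' b' a b := by
  have h1 : ⟪ev 𝕜 (4 * (2 + cs)) a, a'⟫ = ⟪ev 𝕜 (4 * (2 + cs)) a', a⟫ := by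
    rw [inner_ev, real_inner_comm]
    simp only [map_mul, map_add, map_ofNat, invert_cs]
  have h2 : ⟪ev 𝕜 (2 - cs) b, b'⟫ = ⟪ev 𝕜 (2 - cs) b', b⟫ := by
    rw [inner_ev, real_inner_comm]
    simp only [map_sub, map_ofNat, invert_cs]
  have h3 : ∀ f g : Seq 𝕜, ⟪ev 𝕜 (2 * sn) f, g⟫ = -⟪ev 𝕜 (2 * sn) g, f⟫ := fun f g => by
    rw [inner_ev, real_inner_comm]
    simp only [map_mul, map_ofNat, invert_sn, mul_neg, map_neg, neg_apply, inner_neg_left]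
  simp only [massForm, inner_add_left, inner_sub_left, h1, h2, h3 b a', h3 b' a]
  ring

/-- The mass and stiffness operators are symmetric, so the generator is skew for the symplectic form
and the pairing of two free solutions is constant. -/
theorem sympOp_genP (s : ℝ) (X p : State 𝕜) :
    ⟪sympOp 𝕜 (genP 𝕜 s X), p⟫ + ⟪sympOp 𝕜 X, genP 𝕜 s p⟫ = 0 := by
  have h1 : ⟪ev 𝕜 (2 - 2 * cs) (p 0), X 0⟫ = ⟪ev 𝕜 (2 - 2 * cs) (X 0), p 0⟫ := by
    rw [inner_ev, real_inner_comm]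
    simp only [map_mul, map_sub, map_ofNat, invert_cs]
  have h2 : ⟪ev 𝕜 (symR s) (p 1), X 1⟫ = ⟪ev 𝕜 (symR s) (X 1), p 1⟫ := by
    rw [inner_ev, real_inner_comm]
    simp only [symR, map_mul, map_sub, map_ofNat, map_one, invert_C, invert_cs]
  rw [inner_sympOp, inner_sympOp, massForm_comm (X 0) (X 1), massForm_eq (genP 𝕜 s X 2),
    massForm_eq (genP 𝕜 s p 2), massA_genP, massB_genP, massA_genP, massB_genP]
  simp only [genP_zero, genP_one, inner_neg_left, real_inner_smul_left, h1, h2]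
  ring

variable (𝕜) in
/-- The inverse of the scaled mass operator, in both pairs of components. -/
noncomputable def massInv : State 𝕜 →L[ℝ] State 𝕜 :=
  mkState (ev 𝕜 (2 - cs) ∘L comp 𝕜 0 - ev 𝕜 (2 * sn) ∘L comp 𝕜 1)
    (ev 𝕜 (2 * sn) ∘L comp 𝕜 0 + ev 𝕜 (4 * (2 + cs)) ∘L comp 𝕜 1)
    (ev 𝕜 (2 - cs) ∘L comp 𝕜 2 - ev 𝕜 (2 * sn) ∘L comp 𝕜 3)
    (ev 𝕜 (2 * sn) ∘L comp 𝕜 2 + ev 𝕜 (4 * (2 + cs)) ∘L comp 𝕜 3)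

theorem massA_massInv_fst (X : State 𝕜) : massA (massInv 𝕜 X 0) (massInv 𝕜 X 1) = (12 : ℝ) • X 0 :=
  massA_massInv _ _
theorem massB_massInv_fst (X : State 𝕜) : massB (massInv 𝕜 X 0) (massInv 𝕜 X 1) = (12 : ℝ) • X 1 :=
  massB_massInv _ _
theorem massA_massInv_snd (X : State 𝕜) : massA (massInv 𝕜 X 2) (massInv 𝕜 X 3) = (12 : ℝ) • X 2 :=
  massA_massInv _ _
theorem massB_massInv_snd (X : State 𝕜) : massB (massInv 𝕜 X 2) (massInv 𝕜 X 3) = (12 : ℝ) • X 3 :=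
  massB_massInv _ _

/-- The scaled loads produced by a control. -/
noncomputable def loadOp (s : ℝ) (W : Seq 𝕜 →L[ℝ] Seq 𝕜) : State 𝕜 →L[ℝ] State 𝕜 :=
  mkState (-loadV W) (-loadY W) (ev 𝕜 (invert symDelta) ∘L W ∘L comp 𝕜 0) (loadJ s W)

/-- The effect of a control on the state. -/
noncomputable def controlOp (s : ℝ) (W : Seq 𝕜 →L[ℝ] Seq 𝕜) : State 𝕜 →L[ℝ] State 𝕜 :=
  massInv 𝕜 ∘L loadOp s W

/-- `controlOp` is designed for this identity: under the symplectic pairing a control acts as the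
local energy form. The 12 is the determinant of the mass symbol. -/
theorem sympOp_controlOp (s : ℝ) (W : Seq 𝕜 →L[ℝ] Seq 𝕜) (ψ p : State 𝕜) :
    ⟪sympOp 𝕜 (controlOp s W ψ), p⟫ = 12 * cellForm s W ψ (toDiff 𝕜 p) := by
  have hδ : ⟪ev 𝕜 (invert symDelta) (W (ψ 0)), p 0⟫ = ⟪W (ψ 0), ev 𝕜 symDelta (p 0)⟫ := by
    rw [inner_ev, invert_invert]
  rw [inner_sympOp, massForm_eq, massForm_eq]
  simp only [controlOp, ContinuousLinearMap.comp_apply, massA_massInv_fst, massB_massInv_fst,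
    massA_massInv_snd, massB_massInv_snd, real_inner_smul_left]
  rw [← inner_cellOp, inner_state]
  simp only [loadOp, cellOp, mkState_apply_zero, mkState_apply_one, mkState_apply_two,
    mkState_apply_three, toDiff_zero, toDiff_one, toDiff_two, toDiff_three, neg_apply,
    inner_neg_left, ContinuousLinearMap.comp_apply, comp_apply, hδ]
  ring

/-- The state steered by `b` from `X₀`. -/
noncomputable def steer (s h : ℝ) (X₀ : State 𝕜) (b : ℝ → State 𝕜) (t : ℝ) : State 𝕜 :=
  flow (h⁻¹ • genP 𝕜 s) t (X₀ + ∫ τ in (0 : ℝ)..t, flow (h⁻¹ • genP 𝕜 s) (-τ) (b τ))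

theorem hasDerivAt_steer (s h : ℝ) (X₀ : State 𝕜) {b : ℝ → State 𝕜} (hb : Continuous b) (t : ℝ) :
    HasDerivAt (steer s h X₀ b) (h⁻¹ • genP 𝕜 s (steer s h X₀ b t) + b t) t :=
  hasDerivAt_duhamel (h⁻¹ • genP 𝕜 s) hb X₀ t

@[simp] theorem steer_zero (s h : ℝ) (X₀ : State 𝕜) (b : ℝ → State 𝕜) : steer s h X₀ b 0 = X₀ := by
  simp [steer]

/-- Against a free solution the homogeneous dynamics drop out by skewness, and only the work of the
control remains. -/
theorem sympOp_steer_sub (s h T : ℝ) (X₀ : State 𝕜) {b : ℝ → State 𝕜} (hb : Continuous b)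
    (p : State 𝕜) :
    ⟪sympOp 𝕜 (steer s h X₀ b T), p⟫ - ⟪sympOp 𝕜 X₀, flow (h⁻¹ • genP 𝕜 s) (-T) p⟫ =
      ∫ t in (0 : ℝ)..T, ⟪sympOp 𝕜 (b t), flow (h⁻¹ • genP 𝕜 s) (t - T) p⟫ := by
  have hd : ∀ t, HasDerivAt
      (fun t => ⟪sympOp 𝕜 (steer s h X₀ b t), flow (h⁻¹ • genP 𝕜 s) (t - T) p⟫)
      ⟪sympOp 𝕜 (b t), flow (h⁻¹ • genP 𝕜 s) (t - T) p⟫ t := fun t => by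
    have h1 := (sympOp 𝕜).hasFDerivAt.comp_hasDerivAt t (hasDerivAt_steer s h X₀ hb t)
    have h2 := hasDerivAt_flow_sub_apply (h⁻¹ • genP 𝕜 s) T p t
    refine (h1.inner ℝ h2).congr_deriv ?_
    have := sympOp_genP s (steer s h X₀ b t) (flow (h⁻¹ • genP 𝕜 s) (t - T) p)
    simp only [Function.comp_apply, smul_apply, map_add, map_smul, inner_add_left, real_inner_smul_left,
      real_inner_smul_right]
    linear_combination h⁻¹ * this
  have hc : Continuous fun t => flow (h⁻¹ • genP 𝕜 s) (t - T) p :=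
    ((continuous_flow _).comp (continuous_id.sub continuous_const)).clm_apply continuous_const
  have h := intervalIntegral.integral_eq_sub_of_hasDerivAt (fun t _ => hd t)
    (Continuous.intervalIntegrable (by fun_prop) 0 T)
  rw [h]
  simp

end Duality
end DGWave
namespace DGWave

open Set MeasureTheory LaurentPolynomial
open scoped RealInnerProductSpace

/-! ### Controllability of states -/

section Control

variable {𝕜 : Type*} [RCLike 𝕜]

theorem massForm_self_nonneg (a b : Seq 𝕜) : 0 ≤ massForm a b a b := by
  -- The mass form is the energy of a state at rest position; any penalty parameter above 1 would
  -- do.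
  have h := energy_nonneg (s := 2) (by norm_num) (toDiff 𝕜 (pairState 1 0 (glue a b)))
  rw [energy_toDiff] at h
  simpa using h

theorem massForm_sq_le (a b a' b' : Seq 𝕜) :
    massForm a b a' b' ^ 2 ≤ massForm a b a b * massForm a' b' a' b' := by
  have h : ∀ t : ℝ, 0 ≤ massForm a' b' a' b' * (t * t) + 2 * massForm a b a' b' * t
      + massForm a b a b := fun t => by
    refine (massForm_self_nonneg (a + t • a') (b + t • b')).trans_eq ?_
    have := massForm_comm a b a' b'
    simp only [massForm, map_add, map_smul, inner_add_left, inner_add_right, inner_sub_left,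
      inner_sub_right, real_inner_smul_left, real_inner_smul_right] at this ⊢
    linear_combination (-t) * this
  have := discrim_le_zero h
  rw [discrim] at this
  linarith

/-- The dual norm is tested with the displacement of `p` to bound the `Z` part, and Cauchy–Schwarz
for the mass form bounds the `Y` part. The 2 comes from squaring a difference. -/
theorem sympOp_sq_le {s h K : ℝ} (hh : 0 < h) {Y Z : EllTwo 𝕜} (hYZ : DualNormLe s h K Y Z)
    (p : State 𝕜) :
    (h / 12 * ⟪sympOp 𝕜 (pairState h Y Z), p⟫) ^ 2 ≤ 2 * h * K ^ 2 * energy s (toDiff 𝕜 p) := by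
  obtain ⟨hY, hZ⟩ := hYZ
  let u := glue (p 0) (p 1)
  have hZu := hZ u
  have hre : RCLike.re (pairing (massOp h (Z : Coeffs 𝕜)) u) ^ 2 ≤
      K ^ 2 * RCLike.re (pairing (stiffOp s h (u : Coeffs 𝕜)) u) := by
    refine le_trans ?_ hZu
    rw [← sq_abs]
    gcongr
    exact RCLike.abs_re_le_norm _
  rw [re_pairing_massOp, re_pairing_stiffOp, avg_glue, jmp_glue] at hre
  rw [re_pairing_massOp] at hY
  have hm := massForm_sq_le (avg Y) (jmp Y) (p 2) (p 3)
  have hn := massForm_self_nonneg (p 2) (p 3)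
  have hw : (h / 12 * massForm (avg Y) (jmp Y) (p 2) (p 3)) ^ 2 ≤
      h / 12 * K ^ 2 * massForm (p 2) (p 3) (p 2) (p 3) := by
    have h1 := mul_le_mul_of_nonneg_left hm (sq_nonneg (h / 12))
    have h2 := mul_le_mul_of_nonneg_right hY (mul_nonneg (show 0 ≤ h / 12 by positivity) hn)
    linarith
  have hz : (h * (h / 12 * massForm (avg Z) (jmp Z) (p 0) (p 1))) ^ 2 ≤
      h * K ^ 2 * (⟪ev 𝕜 (2 - 2 * cs) (p 0), p 0⟫ + 1 / 2 * ⟪ev 𝕜 (symR s) (p 1), p 1⟫) := by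
    have h1 := mul_le_mul_of_nonneg_left hre (sq_nonneg h)
    rw [mul_pow]
    refine h1.trans_eq ?_
    field_simp
  have hl : massForm (h • avg Z) (h • jmp Z) (p 0) (p 1) =
      h * massForm (avg Z) (jmp Z) (p 0) (p 1) := by
    rw [massForm_eq, massForm_eq, massA_smul, massB_smul, real_inner_smul_left,
      real_inner_smul_left]
    ring
  rw [inner_sympOp, energy_toDiff, pairState_zero, pairState_one, pairState_two, pairState_three,
    hl]
  generalize massForm (avg Y) (jmp Y) (p 2) (p 3) = m₁ at *
  generalize massForm (avg Z) (jmp Z) (p 0) (p 1) = m₂ at *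
  nlinarith [sq_nonneg (h / 12 * (h * m₂) + h / 12 * m₁)]

/-- Pairs of bi-grid coefficient vectors. -/
def bigridPairs (𝕜 : Type*) [RCLike 𝕜] : Submodule ℝ (EllTwo 𝕜 × EllTwo 𝕜) where
  carrier := {q | IsBigrid (q.1 : Coeffs 𝕜) ∧ IsBigrid (q.2 : Coeffs 𝕜)}
  add_mem' := by
    have key : ∀ u v : EllTwo 𝕜, IsBigrid (u : Coeffs 𝕜) → IsBigrid (v : Coeffs 𝕜) →
        IsBigrid ((u + v : EllTwo 𝕜) : Coeffs 𝕜) := fun u v hu hv =>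
      ⟨fun j => by simp [hu.1, hv.1], fun j => by simp [hu.2, hv.2]; ring⟩
    exact fun {q q'} hq hq' => ⟨key _ _ hq.1 hq'.1, key _ _ hq.2 hq'.2⟩
  zero_mem' := by simp [IsBigrid]
  smul_mem' := by
    have key : ∀ (r : ℝ) (u : EllTwo 𝕜), IsBigrid (u : Coeffs 𝕜) →
        IsBigrid ((r • u : EllTwo 𝕜) : Coeffs 𝕜) := fun r u hu =>
      ⟨fun j => by simp [hu.1], fun j => by
        simp [hu.2, RCLike.real_smul_eq_coe_mul]; ring⟩
    exact fun r {q} hq => ⟨key _ _ hq.1, key _ _ hq.2⟩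

variable (𝕜) in
/-- The state of a pair, as an operator. -/
noncomputable def pairCLM (h : ℝ) : EllTwo 𝕜 × EllTwo 𝕜 →L[ℝ] State 𝕜 :=
  posState 𝕜 ∘L ContinuousLinearMap.fst ℝ _ _ + h • (velState 𝕜 ∘L ContinuousLinearMap.snd ℝ _ _)

theorem pairCLM_apply (h : ℝ) (q : EllTwo 𝕜 × EllTwo 𝕜) :
    pairCLM 𝕜 h q = pairState h q.1 q.2 := rfl

/-- The free solution which takes the value `ψ` at the time `T`. -/
noncomputable def freeState (s h T : ℝ) (ψ : State 𝕜) (t : ℝ) : State 𝕜 :=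
  flow (h⁻¹ • gen 𝕜 s) (t - T) ψ

theorem continuous_freeState (s h T : ℝ) (ψ : State 𝕜) : Continuous (freeState s h T ψ) :=
  ((continuous_flow _).comp (continuous_id.sub continuous_const)).clm_apply continuous_const

theorem hasDerivAt_freeState (s h T : ℝ) (ψ : State 𝕜) (t : ℝ) :
    HasDerivAt (freeState s h T ψ) (h⁻¹ • gen 𝕜 s (freeState s h T ψ t)) t :=
  hasDerivAt_flow_sub_apply (h⁻¹ • gen 𝕜 s) T ψ t

theorem freeState_self (s h T : ℝ) (ψ : State 𝕜) : freeState s h T ψ T = ψ := by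
  simp [freeState]

/-- Uniform controllability, tested with bi-grid states. -/
theorem exists_steering (𝕜 : Type*) [RCLike 𝕜] {s : ℝ} (hs : 1 < s) :
    ∃ K₁ K₂ : ℝ, 0 < K₁ ∧ 0 < K₂ ∧ ∀ {h T : ℝ}, 0 < h → h ≤ 1 → K₁ < T →
      ∀ {Y₀ Z₀ Y₁ Z₁ : EllTwo 𝕜} {K : ℝ}, DualNormLe s h K Y₀ Z₀ → DualNormLe s h K Y₁ Z₁ →
      ∃ ψ : State 𝕜,
        h⁻¹ * (∫ t in (0 : ℝ)..T, cellForm s (cellWeight (CellInOmega h)) (freeState s h T ψ t)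
          (freeState s h T ψ t)) ≤ 8 * K₂ / (T - K₁) * K ^ 2 ∧
        ∀ u v : EllTwo 𝕜, IsBigrid (u : Coeffs 𝕜) → IsBigrid (v : Coeffs 𝕜) →
          ⟪sympOp 𝕜 (steer s h (pairState h Y₀ Z₀) (fun t => h⁻¹ • controlOp s
            (cellWeight (CellInOmega h)) (freeState s h T ψ t)) T), pairState h u v⟫ =
          ⟪sympOp 𝕜 (pairState h Y₁ Z₁), pairState h u v⟫ := by
  obtain ⟨K₁, K₂, hK₁, hK₂, H⟩ := observability (E := 𝕜) hs
  refine ⟨K₁, K₂, hK₁, hK₂, fun {h T} hh hh1 hT {Y₀ Z₀ Y₁ Z₁ K} h₀ h₁ => ?_⟩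
  have hT0 : 0 ≤ T := (hK₁.trans hT).le
  have hTK : 0 < T - K₁ := sub_pos.2 hT
  set W : Seq 𝕜 →L[ℝ] Seq 𝕜 := cellWeight (CellInOmega h)
  let P := h⁻¹ • genP 𝕜 s
  let A := h⁻¹ • gen 𝕜 s
  let ι : bigridPairs 𝕜 →ₗ[ℝ] State 𝕜 :=
    (toDiff 𝕜 ∘L pairCLM 𝕜 h).toLinearMap ∘ₗ (bigridPairs 𝕜).subtype
  let G := gramian A (cellOp s W) T
  have hGi : ∀ x y, ⟪G x, y⟫ =
      ∫ t in (0 : ℝ)..T, cellForm s W (freeState s h T x t) (freeState s h T y t) := fun x y => by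
    simp only [G, inner_gramian, inner_cellOp]
    rfl
  have hfree : ∀ x : State 𝕜, ∀ t ∈ Icc (0 : ℝ) T, HasDerivWithinAt (freeState s h T x)
      (h⁻¹ • gen 𝕜 s (freeState s h T x t)) (Icc 0 T) t := fun x t _ =>
    (hasDerivAt_freeState s h T x t).hasDerivWithinAt
  have hen : ∀ x, energy s (freeState s h T x 0) = energy s x := fun x => by
    rw [← energy_eq_initial (hfree x) ⟨hT0, le_rfl⟩, freeState_self]
  -- Both sides of the domination by the virial form are continuous, so it survives on the closure.
  -- It holds at the final time `T`, where the free solution equals `x`.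
  have hobs : ∀ x ∈ closure (range ι), (T - K₁) * energy s x ≤ K₂ * ⟪G x, x⟫ := fun x hx => by
    have hvir : 48 * (s - 1) ^ 2 * energy s x ≤ virForm s x := by
      refine closure_minimal (t := {x | 48 * (s - 1) ^ 2 * energy s x ≤ virForm s x}) ?_
        (isClosed_le (continuous_const.mul (continuous_energy s)) (continuous_virForm s)) hx
      rintro _ ⟨q, rfl⟩
      exact (isBigridState_pairState h q.2.1 q.2.2).energy_le_virForm hs
    have := H hh hh1 hT0 (cellInOmega_of_le hh) (hfree x)
      ⟨T, ⟨hT0, le_rfl⟩, by rwa [freeState_self]⟩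
    rwa [hen, ← hGi] at this
  let κ := 2 * (16 + 2 / (s - 1))
  have hκ : 0 < κ := by
    have : 0 < s - 1 := by linarith
    positivity
  have hcoer : ∀ x ∈ closure (range ι), (T - K₁) / (K₂ * κ) * ‖x‖ ^ 2 ≤ ⟪G x, x⟫ := fun x hx => by
    rw [div_mul_eq_mul_div, div_le_iff₀ (by positivity)]
    have h1 := mul_le_mul_of_nonneg_left (norm_sq_le_energy hs x) hTK.le
    have h2 := mul_le_mul_of_nonneg_left (hobs x hx) hκ.le
    change (T - K₁) * ‖x‖ ^ 2 ≤ (T - K₁) * (κ * energy s x) at h1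
    linarith
  let X₀ := pairState h Y₀ Z₀
  let X₁ := pairState h Y₁ Z₁
  let ℓ' : State 𝕜 →L[ℝ] ℝ :=
    (h / 12) • (innerSL ℝ (sympOp 𝕜 X₁) - innerSL ℝ (sympOp 𝕜 X₀) ∘L flow P (-T))
  let ℓ : bigridPairs 𝕜 →ₗ[ℝ] ℝ := (ℓ' ∘L pairCLM 𝕜 h).toLinearMap ∘ₗ (bigridPairs 𝕜).subtype
  have hℓ : ∀ q, ℓ q = h / 12 * ⟪sympOp 𝕜 X₁, pairCLM 𝕜 h q⟫
      - h / 12 * ⟪sympOp 𝕜 X₀, flow P (-T) (pairCLM 𝕜 h q)⟫ := fun q => by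
    rw [← mul_sub]; rfl
  have hflow : ∀ t p, toDiff 𝕜 (flow P t p) = flow A t (toDiff 𝕜 p) := fun t p =>
    map_flow (fun x => by simp [P, A, toDiff_genP]) t p
  -- The 8 arises as `2 · 2 + 2 · 2` from the target and the initial state; the energy of the free
  -- solution carried back to time 0 is unchanged.
  have hℓN : ∀ q, ℓ q ^ 2 ≤ 8 * h * K ^ 2 * energy s (ι q) := fun q => by
    have e1 := sympOp_sq_le hh h₁ (pairCLM 𝕜 h q)
    have e0 := sympOp_sq_le hh h₀ (flow P (-T) (pairCLM 𝕜 h q))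
    have e2 := hen (ι q)
    rw [freeState, zero_sub] at e2
    rw [hflow, show flow A (-T) (toDiff 𝕜 (pairCLM 𝕜 h q)) = flow A (-T) (ι q) from rfl, e2] at e0
    change _ ≤ 2 * h * K ^ 2 * energy s (ι q) at e1
    rw [hℓ]
    nlinarith [sq_nonneg (h / 12 * ⟪sympOp 𝕜 X₁, pairCLM 𝕜 h q⟫
      + h / 12 * ⟪sympOp 𝕜 X₀, flow P (-T) (pairCLM 𝕜 h q)⟫)]
  have hen_le : ∃ M : ℝ, 0 ≤ M ∧ ∀ z : State 𝕜, energy s z ≤ M * ‖z‖ ^ 2 := by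
    refine ⟨‖cellOp s (1 : Seq 𝕜 →L[ℝ] Seq 𝕜)‖, ContinuousLinearMap.opNorm_nonneg _, fun z => ?_⟩
    rw [energy, ← inner_cellOp, sq, ← mul_assoc]
    refine (real_inner_le_norm _ _).trans ?_
    gcongr
    exact ContinuousLinearMap.le_opNorm _ _
  obtain ⟨M, hM0, hM⟩ := hen_le
  -- The continuity constant is needed only for existence; the uniform cost comes from the bound by
  -- the energy, through `hψN`.
  obtain ⟨ψ, hψ, hψι, hψN⟩ := exists_of_coercive_on_closure ι G (by positivity) hcoer ℓ
    (M := √(8 * h * K ^ 2 * M))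
    (fun q => by
      refine abs_le_of_sq_le_sq ?_ (by positivity)
      rw [mul_pow, Real.sq_sqrt (by positivity), mul_assoc _ M]
      exact (hℓN q).trans (mul_le_mul_of_nonneg_left (hM _) (by positivity)))
    (N := fun z => 8 * h * K ^ 2 * energy s z) (continuous_const.mul (continuous_energy s)) hℓN
  refine ⟨ψ, ?_, fun u v hu hv => ?_⟩
  · rw [← hGi]
    have h1 := hobs ψ hψ
    have h2 : 0 ≤ ⟪G ψ, ψ⟫ := le_trans (by positivity) (hcoer ψ hψ)
    generalize ⟪G ψ, ψ⟫ = g at h1 h2 hψN ⊢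
    have h3 : energy s ψ ≤ K₂ * g / (T - K₁) := by
      rw [le_div_iff₀ hTK]
      linarith
    -- The cost `g` satisfies `g² ≤ 8 h K² energy(ψ)`, and observability bounds `energy(ψ)` by a
    -- multiple of `g`; one factor `g` cancels.
    have h4 : g * g ≤ 8 * h * K ^ 2 * K₂ / (T - K₁) * g := by
      calc g * g = g ^ 2 := (sq g).symm
        _ ≤ 8 * h * K ^ 2 * energy s ψ := hψN
        _ ≤ 8 * h * K ^ 2 * (K₂ * g / (T - K₁)) := by gcongr
        _ = _ := by ring
    have h5 : g ≤ 8 * h * K ^ 2 * K₂ / (T - K₁) := by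
      rcases h2.eq_or_lt with h0 | h0
      · rw [← h0]; positivity
      · exact le_of_mul_le_mul_right h4 h0
    rw [inv_mul_le_iff₀ hh]
    refine h5.trans_eq ?_
    ring
  · have hb : Continuous fun t => h⁻¹ • controlOp s W (freeState s h T ψ t) := by
      have := continuous_freeState s h T ψ
      fun_prop
    have d := sympOp_steer_sub s h T X₀ hb (pairState h u v)
    have e : ℓ ⟨(u, v), hu, hv⟩ = _ := (hψι ⟨(u, v), hu, hv⟩).symm
    have i : ∀ t, ⟪sympOp 𝕜 (h⁻¹ • controlOp s W (freeState s h T ψ t)),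
        flow P (t - T) (pairState h u v)⟫ = 12 / h * cellForm s W (freeState s h T ψ t)
          (freeState s h T (ι ⟨(u, v), hu, hv⟩) t) := fun t => by
      rw [map_smul, real_inner_smul_left, sympOp_controlOp, hflow, ← mul_assoc]
      congr 1
      ring
    simp only [P] at i
    simp only [i] at d
    rw [intervalIntegral.integral_const_mul, ← hGi, ← e, hℓ, pairCLM_apply] at d
    have e2 : 12 / h * (h / 12 * ⟪sympOp 𝕜 X₁, pairState h u v⟫
        - h / 12 * ⟪sympOp 𝕜 X₀, flow P (-T) (pairState h u v)⟫) =
        ⟪sympOp 𝕜 X₁, pairState h u v⟫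
        - ⟪sympOp 𝕜 X₀, flow P (-T) (pairState h u v)⟫ := by
      field_simp
    exact sub_left_inj.1 (d.trans e2)

end Control
end DGWave
namespace DGWave

open Set MeasureTheory LaurentPolynomial
open scoped RealInnerProductSpace

/-! ### Controls -/

section Loads

variable {𝕜 : Type*} [RCLike 𝕜]

/-- The sequence vanishing at `0` with given differences. -/
noncomputable def cumSum (f : ℤ → 𝕜) (j : ℤ) : 𝕜 :=
  ∑ i ∈ Finset.Ico 0 j, f i - ∑ i ∈ Finset.Ico j 0, f i

theorem cumSum_add_one_sub (f : ℤ → 𝕜) (j : ℤ) : cumSum f (j + 1) - cumSum f j = f j := by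
  rcases le_or_gt 0 j with h | h
  · have e1 : Finset.Ico 0 (j + 1) = insert j (Finset.Ico 0 j) := by ext; simp; omega
    have e2 : Finset.Ico j 0 = ∅ := Finset.Ico_eq_empty (by omega)
    have e3 : Finset.Ico (j + 1) 0 = ∅ := Finset.Ico_eq_empty (by omega)
    rw [cumSum, cumSum, e1, e2, e3, Finset.sum_insert (by simp)]
    simp
  · have e1 : Finset.Ico j 0 = insert j (Finset.Ico (j + 1) 0) := by ext; simp; omega
    have e2 : Finset.Ico 0 j = ∅ := Finset.Ico_eq_empty (by omega)
    have e3 : Finset.Ico 0 (j + 1) = ∅ := Finset.Ico_eq_empty (by omega)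
    rw [cumSum, cumSum, e1, e2, e3, Finset.sum_insert (by simp)]
    simp

/-- The control in the displacement. -/
noncomputable def dispControl (ψ : State 𝕜) : Coeffs 𝕜 :=
  fun k => if k.2 = 0 then cumSum (fun i => ψ 0 i) k.1 else ψ 1 k.1

/-- The control in the velocity. -/
noncomputable def velControl (h : ℝ) (ψ : State 𝕜) : Coeffs 𝕜 :=
  -((h⁻¹ • glueCLM 𝕜 2 3 ψ : EllTwo 𝕜) : Coeffs 𝕜)

@[simp] theorem dispControl_zero (ψ : State 𝕜) (j : ℤ) :
    dispControl ψ (j, 0) = cumSum (fun i => ψ 0 i) j := rfl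
@[simp] theorem dispControl_one (ψ : State 𝕜) (j : ℤ) : dispControl ψ (j, 1) = ψ 1 j := rfl
@[simp] theorem velControl_zero (h : ℝ) (ψ : State 𝕜) (j : ℤ) :
    velControl h ψ (j, 0) = -(h⁻¹ • ψ 2 j) := by simp [velControl]
@[simp] theorem velControl_one (h : ℝ) (ψ : State 𝕜) (j : ℤ) :
    velControl h ψ (j, 1) = -(h⁻¹ • ψ 3 j) := by simp [velControl]

/-- As `ψ` lies only in a closure, its `D` component need not be the difference of a square-summable
sequence. The displacement control is therefore summed up from `0` as a plain coefficient vector,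
which is enough because cell energies see only differences. The sign of the velocity control is
immaterial in a quadratic expression. -/
theorem cellEnergy_control {s h : ℝ} (hh : h ≠ 0) (ψ : State 𝕜) (j : ℤ) :
    cellEnergy s h j (dispControl ψ) (velControl h ψ) = (2 * h)⁻¹ * cellDensity s ψ j := by
  rw [← cellEnergy_eq (u := dispControl ψ) (v := -velControl h ψ) hh]
  · simp only [cellEnergy, cellMass, leftTrace, rightTrace, Pi.star_apply, Pi.neg_apply, star_neg]
    congr 4
    ring
  · rw [dispControl_zero, dispControl_zero, cumSum_add_one_sub]
  · simp
  · simp [hh]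
  · simp [hh]

open Classical in
theorem cellWeight_apply (P : ℤ → Prop) (f : Seq 𝕜) (j : ℤ) :
    cellWeight P f j = if P j then f j else 0 := by
  simp [cellWeight]

theorem sum_cells {f : ℤ → 𝕜} (j : ℤ) : ∑ i ∈ ({j - 1, j} : Finset ℤ), f i = f (j - 1) + f j :=
  Finset.sum_pair (by omega)

section
variable (j : ℤ)
theorem leftTrace_single_zero : leftTrace (Pi.single (j, 0) 1 : Coeffs 𝕜) j = 1 := by
  simp [leftTrace, Pi.single_apply]
theorem rightTrace_single_zero : rightTrace (Pi.single (j, 0) 1 : Coeffs 𝕜) j = 0 := by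
  simp [rightTrace, Pi.single_apply]
theorem leftTrace_sub_one_single_zero : leftTrace (Pi.single (j, 0) 1 : Coeffs 𝕜) (j - 1) = 0 := by
  simp [leftTrace, Pi.single_apply]
theorem rightTrace_sub_one_single_zero :
    rightTrace (Pi.single (j, 0) 1 : Coeffs 𝕜) (j - 1) = 1 := by
  simp [rightTrace, Pi.single_apply]
theorem leftTrace_single_one : leftTrace (Pi.single (j, 1) 1 : Coeffs 𝕜) j = -(1 / 2) := by
  simp [leftTrace, Pi.single_apply]
theorem rightTrace_single_one : rightTrace (Pi.single (j, 1) 1 : Coeffs 𝕜) j = 0 := by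
  simp [rightTrace, Pi.single_apply]
theorem leftTrace_sub_one_single_one : leftTrace (Pi.single (j, 1) 1 : Coeffs 𝕜) (j - 1) = 0 := by
  simp [leftTrace, Pi.single_apply]
theorem rightTrace_sub_one_single_one :
    rightTrace (Pi.single (j, 1) 1 : Coeffs 𝕜) (j - 1) = 1 / 2 := by
  simp [rightTrace, Pi.single_apply]
end

theorem leftTrace_velControl (h : ℝ) (ψ : State 𝕜) (j : ℤ) :
    leftTrace (velControl h ψ) j = -(h⁻¹ • traceL ψ j) := by
  have e : traceL ψ j = ψ 2 j - (1 / 2 : ℝ) • ψ 3 j := rfl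
  rw [e, leftTrace, velControl_zero, velControl_one]
  simp only [RCLike.real_smul_eq_coe_mul]
  push_cast
  ring

theorem rightTrace_velControl (h : ℝ) (ψ : State 𝕜) (j : ℤ) :
    rightTrace (velControl h ψ) j = -(h⁻¹ • traceR ψ j) := by
  have e : traceR ψ j = ψ 2 (j + 1) + (1 / 2 : ℝ) • ψ 3 (j + 1) := rfl
  rw [e, rightTrace, velControl_zero, velControl_one]
  simp only [RCLike.real_smul_eq_coe_mul]
  push_cast
  ring

theorem slope_dispControl (h : ℝ) (ψ : State 𝕜) (j : ℤ) :
    slope h (dispControl ψ) j = (1 / h) • (ψ 0 j + (ψ 1 j + ψ 1 (j + 1)) / 2) := by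
  have := cumSum_add_one_sub (fun i => ψ 0 i) j
  rw [slope, leftTrace, rightTrace]
  simp only [dispControl_zero, dispControl_one]
  congr 1
  linear_combination this

open Classical in
theorem loadV_apply (P : ℤ → Prop) (ψ : State 𝕜) (j : ℤ) :
    loadV (cellWeight P) ψ j = (1 / 6 : ℝ) • ((if P j then traceL ψ j else 0)
      + (if P (j - 1) then traceR ψ (j - 1) else 0)
      + ((if P j then traceL ψ j + traceR ψ j else 0)
        + if P (j - 1) then traceL ψ (j - 1) + traceR ψ (j - 1) else 0)) := by
  simp only [← seq_add_apply (traceL ψ), ← cellWeight_apply]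
  rfl

open Classical in
theorem loadY_apply (P : ℤ → Prop) (ψ : State 𝕜) (j : ℤ) :
    loadY (cellWeight P) ψ j = (1 / 12 : ℝ) • (-(if P j then traceL ψ j else 0)
      + (if P (j - 1) then traceR ψ (j - 1) else 0)
      + ((if P (j - 1) then traceL ψ (j - 1) + traceR ψ (j - 1) else 0)
        - if P j then traceL ψ j + traceR ψ j else 0)) := by
  simp only [← seq_add_apply (traceL ψ), ← cellWeight_apply]
  rfl

open Classical in
theorem loadJ_apply (s : ℝ) (P : ℤ → Prop) (ψ : State 𝕜) (j : ℤ) :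
    loadJ s (cellWeight P) ψ j = ((s - 1) / 2) •
      ((if P j then ψ 1 j else 0) + if P (j - 1) then ψ 1 j else 0)
      + (1 / 4 : ℝ) • ((if P j then ψ 1 j - ψ 1 (j + 1) else 0)
        - if P (j - 1) then ψ 1 (j - 1) - ψ 1 j else 0) := by
  have e1 : ∀ i, shift 1 (ψ 1) i = ψ 1 (i + 1) := fun _ => rfl
  have e : loadJ s (cellWeight P) ψ j = ((s - 1) / 2) •
      (cellWeight P (ψ 1) j + cellWeight P (shift 1 (ψ 1)) (j - 1))
      + (1 / 4 : ℝ) • (cellWeight P (ψ 1 - shift 1 (ψ 1)) j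
        - cellWeight P (ψ 1 - shift 1 (ψ 1)) (j - 1)) := rfl
  rw [e]
  simp only [cellWeight_apply, seq_sub_apply, e1, sub_add_cancel]

open Classical in
theorem ev_invert_symDelta_cellWeight (P : ℤ → Prop) (f : Seq 𝕜) (j : ℤ) :
    ev 𝕜 (invert symDelta) (cellWeight P f) j =
      (if P (j - 1) then f (j - 1) else 0) - if P j then f j else 0 := by
  rw [symDelta, cs_add_sn]
  simp only [map_sub, map_one, invert_T, ev_T, ← cellWeight_apply]
  rfl

/-- The minus sign built into `velControl` is the one with which the mass load enters `loadOp`, and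
it comes from the symplectic form. -/
theorem massLoad_velControl {h : ℝ} (hh : h ≠ 0) (ψ : State 𝕜) :
    massLoad h (velControl h ψ) = glue (-loadV (cellWeight (CellInOmega h)) ψ)
      (-loadY (cellWeight (CellInOmega h)) ψ) := by
  classical
  have hh' : (h : 𝕜) ≠ 0 := by exact_mod_cast hh
  ext ⟨j, i⟩
  fin_cases i
  · change massLoad h (velControl h ψ) (j, 0) = glue _ _ (j, 0)
    rw [glue_zero, lp.coeFn_neg, Pi.neg_apply, loadV_apply, massLoad, sum_cells]
    simp only [cellMass, leftTrace_velControl, rightTrace_velControl, leftTrace_single_zero,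
      rightTrace_single_zero, leftTrace_sub_one_single_zero, rightTrace_sub_one_single_zero]
    split_ifs <;> simp only [RCLike.real_smul_eq_coe_mul] <;> push_cast <;> field_simp <;> ring
  · change massLoad h (velControl h ψ) (j, 1) = glue _ _ (j, 1)
    rw [glue_one, lp.coeFn_neg, Pi.neg_apply, loadY_apply, massLoad, sum_cells]
    simp only [cellMass, leftTrace_velControl, rightTrace_velControl, leftTrace_single_one,
      rightTrace_single_one, leftTrace_sub_one_single_one, rightTrace_sub_one_single_one]
    split_ifs <;> simp only [RCLike.real_smul_eq_coe_mul] <;> push_cast <;> field_simp <;> ring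

theorem stiffLoad_dispControl {s h : ℝ} (hh : h ≠ 0) (ψ : State 𝕜) :
    stiffLoad s h (dispControl ψ) = glue
      (h⁻¹ • ev 𝕜 (invert symDelta) (cellWeight (CellInOmega h) (ψ 0)))
      (h⁻¹ • loadJ s (cellWeight (CellInOmega h)) ψ) := by
  classical
  have hh' : (h : 𝕜) ≠ 0 := by exact_mod_cast hh
  have p0 : ∀ i k : ℤ, (Pi.single (i, 0) 1 : Coeffs 𝕜) (k, 1) = 0 := fun i k => by
    simp [Pi.single_apply]
  have p1 : ∀ i : ℤ, (Pi.single (i, 1) 1 : Coeffs 𝕜) (i, 1) = 1 := fun i => by simp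
  have p2 : ∀ i : ℤ, (Pi.single (i, 1) 1 : Coeffs 𝕜) (i + 1, 1) = 0 := fun i => by
    simp [Pi.single_apply]
  have p3 : ∀ i : ℤ, (Pi.single (i, 1) 1 : Coeffs 𝕜) (i - 1, 1) = 0 := fun i => by
    simp [Pi.single_apply]
  ext ⟨j, i⟩
  fin_cases i
  · change stiffLoad s h (dispControl ψ) (j, 0) = glue _ _ (j, 0)
    rw [glue_zero, seq_smul_apply, ev_invert_symDelta_cellWeight, stiffLoad, sum_cells]
    simp only [cellStiff, slope_dispControl]
    simp only [slope, leftTrace_single_zero, rightTrace_single_zero, dispControl_one, p0,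
      leftTrace_sub_one_single_zero, rightTrace_sub_one_single_zero, sub_add_cancel]
    split_ifs <;> simp only [RCLike.real_smul_eq_coe_mul] <;> push_cast <;> field_simp <;> ring
  · change stiffLoad s h (dispControl ψ) (j, 1) = glue _ _ (j, 1)
    rw [glue_one, seq_smul_apply, loadJ_apply, stiffLoad, sum_cells]
    simp only [cellStiff, slope_dispControl]
    simp only [slope, leftTrace_single_one, rightTrace_single_one, dispControl_one, p1, p2, p3,
      leftTrace_sub_one_single_one, rightTrace_sub_one_single_one, sub_add_cancel]
    split_ifs <;> simp only [RCLike.real_smul_eq_coe_mul] <;> push_cast <;> field_simp <;> ring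

end Loads
end DGWave
namespace DGWave

open Set MeasureTheory LaurentPolynomial
open scoped RealInnerProductSpace

/-! ### The controlled solution -/

section Controlled

variable {𝕜 : Type*} [RCLike 𝕜]

/-- The value of a coefficient vector at an index. -/
noncomputable def evalAt (k : ℤ × Fin 2) : EllTwo 𝕜 →L[ℝ] 𝕜 :=
  lp.evalCLM ℝ (fun _ : ℤ × Fin 2 => 𝕜) 2 k

theorem evalAt_apply (k : ℤ × Fin 2) (u : EllTwo 𝕜) : evalAt k u = u k := rfl

theorem massOp_glue_fst (h : ℝ) (X : State 𝕜) :
    massOp h (glue (X 0) (X 1) : EllTwo 𝕜) =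
      (-(h / 12) • glueCLM 𝕜 2 3 (sympOp 𝕜 X) : EllTwo 𝕜) := by
  rw [massOp_eq, avg_glue, jmp_glue]
  congr 1
  have e2 : sympOp 𝕜 X 2 = -massA (X 0) (X 1) := rfl
  have e3 : sympOp 𝕜 X 3 = -massB (X 0) (X 1) := rfl
  exact ext_avg_jmp (by simp [e2, massA]) (by simp [e3, massB]; module)

theorem massOp_glue_snd {h : ℝ} (hh : h ≠ 0) (X : State 𝕜) :
    massOp h ((h⁻¹ • glueCLM 𝕜 2 3 X : EllTwo 𝕜) : Coeffs 𝕜) =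
      ((1 / 12 : ℝ) • glueCLM 𝕜 0 1 (sympOp 𝕜 X) : EllTwo 𝕜) := by
  have e0 : sympOp 𝕜 X 0 = massA (X 2) (X 3) := rfl
  have e1 : sympOp 𝕜 X 1 = massB (X 2) (X 3) := rfl
  have e : h / 12 * h⁻¹ = 1 / 12 := by field_simp
  have a : avg (h⁻¹ • glueCLM 𝕜 2 3 X) = h⁻¹ • X 2 := by simp
  have b : jmp (h⁻¹ • glueCLM 𝕜 2 3 X) = h⁻¹ • X 3 := by simp
  rw [massOp_eq, a, b]
  congr 1
  refine ext_avg_jmp ?_ ?_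
  · rw [avg_glue, map_smul avg, glueCLM_apply, avg_glue, e0, ← e, mul_smul, ← massA_smul]
    rfl
  · rw [jmp_glue, map_smul jmp, glueCLM_apply, jmp_glue, e1, ← e, mul_smul, ← massB_smul]
    rfl

variable {s h : ℝ} {ψ : State 𝕜}

/-- Up to scaling, the components 2 and 3 of `sympOp` are minus the mass operator on the
displacement. Applying it to the equation for the state recovers the first line of the controlled
system; `massOp_deriv'` does the same for the second line. -/
theorem massOp_deriv (hh : h ≠ 0) (X : State 𝕜) (k : ℤ × Fin 2) :
    evalAt k (-(h / 12) • glueCLM 𝕜 2 3 (sympOp 𝕜 (h⁻¹ • genP 𝕜 s X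
      + h⁻¹ • controlOp s (cellWeight (CellInOmega h)) ψ))) =
      massOp h ((h⁻¹ • glueCLM 𝕜 2 3 X : EllTwo 𝕜) : Coeffs 𝕜) k
        + massLoad h (velControl h ψ) k := by
  rw [massOp_glue_snd hh, massLoad_velControl hh, evalAt_apply, ← Pi.add_apply, ← lp.coeFn_add]
  refine congrArg (fun w : EllTwo 𝕜 => (w : Coeffs 𝕜) k) ?_
  set W : Seq 𝕜 →L[ℝ] Seq 𝕜 := cellWeight (CellInOmega h)
  have e0 : sympOp 𝕜 X 0 = massA (X 2) (X 3) := rfl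
  have e1 : sympOp 𝕜 X 1 = massB (X 2) (X 3) := rfl
  have g2 : sympOp 𝕜 (genP 𝕜 s X) 2 = -massA (X 2) (X 3) := rfl
  have g3 : sympOp 𝕜 (genP 𝕜 s X) 3 = -massB (X 2) (X 3) := rfl
  have c2 : sympOp 𝕜 (controlOp s W ψ) 2 = (12 : ℝ) • loadV W ψ :=
    (congrArg Neg.neg (massA_massInv_fst (loadOp s W ψ))).trans (by simp [loadOp])
  have c3 : sympOp 𝕜 (controlOp s W ψ) 3 = (12 : ℝ) • loadY W ψ :=
    (congrArg Neg.neg (massB_massInv_fst (loadOp s W ψ))).trans (by simp [loadOp])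
  rw [map_add, map_smul, map_smul]
  refine ext_avg_jmp ?_ ?_
  · simp only [map_smul, map_add, glueCLM_apply, avg_glue, e0, g2, c2]
    match_scalars <;> field_simp
  · simp only [map_smul, map_add, glueCLM_apply, jmp_glue, e1, g3, c3]
    match_scalars <;> field_simp

theorem massOp_deriv' (hh : h ≠ 0) (X : State 𝕜) (k : ℤ × Fin 2) :
    evalAt k ((1 / 12 : ℝ) • glueCLM 𝕜 0 1 (sympOp 𝕜 (h⁻¹ • genP 𝕜 s X
      + h⁻¹ • controlOp s (cellWeight (CellInOmega h)) ψ))) =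
      -stiffOp s h (glue (X 0) (X 1) : EllTwo 𝕜) k + stiffLoad s h (dispControl ψ) k := by
  rw [stiffOp_eq, stiffLoad_dispControl hh, evalAt_apply, ← Pi.neg_apply, ← lp.coeFn_neg,
    ← Pi.add_apply, ← lp.coeFn_add]
  refine congrArg (fun w : EllTwo 𝕜 => (w : Coeffs 𝕜) k) ?_
  set W : Seq 𝕜 →L[ℝ] Seq 𝕜 := cellWeight (CellInOmega h)
  have g0 : sympOp 𝕜 (genP 𝕜 s X) 0 = -((12 : ℝ) • ev 𝕜 (2 - 2 * cs) (X 0)) := massA_genP s X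
  have g1 : sympOp 𝕜 (genP 𝕜 s X) 1 = -((6 : ℝ) • ev 𝕜 (symR s) (X 1)) := massB_genP s X
  have c0 : sympOp 𝕜 (controlOp s W ψ) 0 = (12 : ℝ) • ev 𝕜 (invert symDelta) (W (ψ 0)) :=
    massA_massInv_snd (loadOp s W ψ)
  have c1 : sympOp 𝕜 (controlOp s W ψ) 1 = (12 : ℝ) • loadJ s W ψ :=
    massB_massInv_snd (loadOp s W ψ)
  rw [map_add, map_smul, map_smul]
  refine ext_avg_jmp ?_ ?_
  · simp only [map_smul, map_add, map_neg, glueCLM_apply, avg_glue, jmp_glue, g0, c0]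
    match_scalars <;> field_simp
  · simp only [map_smul, map_add, map_neg, glueCLM_apply, avg_glue, jmp_glue, g1, c1]
    match_scalars <;> field_simp
    norm_num

/-- Each tested equation is the fundamental theorem of calculus for a bounded linear functional of
the steered state. -/
theorem isControlled_steer (hh : h ≠ 0) (T : ℝ) (X₀ : State 𝕜) {ψ : ℝ → State 𝕜}
    (hψ : Continuous ψ) {X : ℝ → State 𝕜}
    (hX : X = steer s h X₀ fun t => h⁻¹ • controlOp s (cellWeight (CellInOmega h)) (ψ t)) :
    IsControlled s h T (fun t => velControl h (ψ t)) (fun t => dispControl (ψ t))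
      (fun t => glueCLM 𝕜 0 1 (X t)) (fun t => h⁻¹ • glueCLM 𝕜 2 3 (X t)) := by
  have hb : Continuous fun t => h⁻¹ • controlOp s (cellWeight (CellInOmega h)) (ψ t) := by fun_prop
  have hX' : ∀ t, HasDerivAt X (h⁻¹ • genP 𝕜 s (X t)
      + h⁻¹ • controlOp s (cellWeight (CellInOmega h)) (ψ t)) t := fun t => by
    rw [hX]; exact hasDerivAt_steer s h X₀ hb t
  have hc : Continuous X := continuous_iff_continuousAt.2 fun t => (hX' t).continuousAt
  refine ⟨by fun_prop, by fun_prop, fun t _ k => ⟨?_, ?_⟩⟩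
  · simp only [glueCLM_apply 0 1, massOp_glue_fst, ← massOp_deriv (s := s) hh (X _) k]
    let L : State 𝕜 →L[ℝ] 𝕜 := evalAt k ∘L (-(h / 12) • (glueCLM 𝕜 2 3 ∘L sympOp 𝕜))
    have := intervalIntegral.integral_eq_sub_of_hasDerivAt (a := 0) (b := t)
      (fun τ _ => L.hasFDerivAt.comp_hasDerivAt τ (hX' τ))
      (Continuous.intervalIntegrable (by fun_prop) 0 t)
    exact (eq_add_of_sub_eq' this.symm)
  · simp only [massOp_glue_snd hh, glueCLM_apply 0 1 (X _), ← massOp_deriv' (s := s) hh (X _) k]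
    let L : State 𝕜 →L[ℝ] 𝕜 := evalAt k ∘L ((1 / 12 : ℝ) • (glueCLM 𝕜 0 1 ∘L sympOp 𝕜))
    have := intervalIntegral.integral_eq_sub_of_hasDerivAt (a := 0) (b := t)
      (fun τ _ => L.hasFDerivAt.comp_hasDerivAt τ (hX' τ))
      (Continuous.intervalIntegrable (by fun_prop) 0 t)
    exact (eq_add_of_sub_eq' this.symm)

theorem controlCost_eq (hs : 1 < s) (hh : 0 < h) {T : ℝ} (hT : 0 ≤ T) {ψ : ℝ → State 𝕜}
    (hψ : Continuous ψ) :
    controlCost s h T (fun t => velControl h (ψ t)) (fun t => dispControl (ψ t)) =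
      ENNReal.ofReal (h⁻¹ * ∫ t in (0 : ℝ)..T,
        cellForm s (cellWeight (CellInOmega h)) (ψ t) (ψ t)) := by
  classical
  have hc : Continuous fun t => cellForm s (cellWeight (CellInOmega h)) (ψ t) (ψ t) :=
    (continuous_cellForm s _).comp hψ
  rw [← intervalIntegral.integral_const_mul, intervalIntegral.integral_of_le hT,
    ← integral_Icc_eq_integral_Ioc, ofReal_integral_eq_lintegral_ofReal
      (hc.const_mul h⁻¹).continuousOn.integrableOn_Icc
      (Filter.Eventually.of_forall fun t => mul_nonneg (inv_nonneg.2 hh.le)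
        (cellForm_cellWeight_nonneg hs _ _)), controlCost]
  refine lintegral_congr fun t => ?_
  have hsum := (hasSum_cellForm_cellWeight s (CellInOmega h) (ψ t)).mul_left h⁻¹
  rw [← hsum.tsum_eq, ENNReal.ofReal_tsum_of_nonneg _ hsum.summable]
  · refine tsum_congr fun j => ?_
    split_ifs
    · rw [cellEnergy_control hh.ne']
      congr 1
      field_simp
    · simp
  · intro j
    have := cellDensity_nonneg hs (ψ t) j
    split_ifs <;> positivity

theorem stronglyMeasurable_velControl (h : ℝ) {ψ : ℝ → State 𝕜} (hψ : Continuous ψ)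
    (k : ℤ × Fin 2) : StronglyMeasurable fun t => velControl h (ψ t) k := by
  let L : State 𝕜 →L[ℝ] 𝕜 := evalAt k ∘L (h⁻¹ • glueCLM 𝕜 2 3)
  exact (L.continuous.comp hψ).neg.stronglyMeasurable

theorem stronglyMeasurable_dispControl {ψ : ℝ → State 𝕜} (hψ : Continuous ψ)
    (k : ℤ × Fin 2) : StronglyMeasurable fun t => dispControl (ψ t) k := by
  have c : ∀ i j, Continuous fun t => ψ t i j := fun i j =>
    ((lp.evalCLM ℝ (fun _ : ℤ => 𝕜) 2 j ∘L comp 𝕜 i).continuous.comp hψ)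
  unfold dispControl cumSum
  split_ifs
  · exact ((continuous_finsetSum _ fun i _ => c 0 i).sub
      (continuous_finsetSum _ fun i _ => c 0 i)).stronglyMeasurable
  · exact (c 1 _).stronglyMeasurable

/-- The bi-grid space is stable under multiplication by scalars of `𝕜`. Rotating the test vector by
the value `c` of the pairing turns the real part into `|c|²`. -/
theorem sameBigridProjection_of_re {Y Y' : EllTwo 𝕜}
    (H : ∀ u : EllTwo 𝕜, IsBigrid (u : Coeffs 𝕜) →
      RCLike.re (pairing (massOp h ((Y - Y' : EllTwo 𝕜) : Coeffs 𝕜)) u) = 0) :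
    SameBigridProjection h Y Y' := by
  intro Φ hΦ
  set c := pairing (massOp h ((Y - Y' : EllTwo 𝕜) : Coeffs 𝕜)) (Φ : Coeffs 𝕜) with hc
  have h1 := H (c • Φ) ⟨fun j => by simp [hΦ.1], fun j => by simp [hΦ.2]; ring⟩
  have h2 : pairing (massOp h ((Y - Y' : EllTwo 𝕜) : Coeffs 𝕜)) ((c • Φ : EllTwo 𝕜) : Coeffs 𝕜)
      = star c * pairing (massOp h ((Y - Y' : EllTwo 𝕜) : Coeffs 𝕜)) (Φ : Coeffs 𝕜) := by
    rw [pairing, pairing, ← tsum_mul_left]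
    refine tsum_congr fun k => ?_
    simp only [lp.coeFn_smul, Pi.smul_apply, smul_eq_mul, star_mul']
    ring
  rw [h2, ← hc, RCLike.star_def, RCLike.conj_mul, ← RCLike.ofReal_pow, RCLike.ofReal_re] at h1
  exact norm_eq_zero.1 (pow_eq_zero_iff two_ne_zero |>.1 h1)

/-- Test pairs with zero displacement isolate the `Y` component, those with zero velocity the `Z`
component. -/
theorem sameBigridProjection_of_sympOp (hh : h ≠ 0) {X : State 𝕜} {Y₁ Z₁ : EllTwo 𝕜}
    (H : ∀ u v : EllTwo 𝕜, IsBigrid (u : Coeffs 𝕜) → IsBigrid (v : Coeffs 𝕜) →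
      ⟪sympOp 𝕜 X, pairState h u v⟫ = ⟪sympOp 𝕜 (pairState h Y₁ Z₁), pairState h u v⟫) :
    SameBigridProjection h (glueCLM 𝕜 0 1 X) Y₁ ∧
      SameBigridProjection h (h⁻¹ • glueCLM 𝕜 2 3 X) Z₁ := by
  have hX : X = pairState h (glueCLM 𝕜 0 1 X) (h⁻¹ • glueCLM 𝕜 2 3 X) :=
    state_ext (by simp) (by simp) (by simp [hh]) (by simp [hh])
  have z : IsBigrid ((0 : EllTwo 𝕜) : Coeffs 𝕜) := by simp [IsBigrid]
  rw [hX] at H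
  generalize glueCLM 𝕜 0 1 X = Y at H ⊢
  generalize h⁻¹ • glueCLM 𝕜 2 3 X = Z at H ⊢
  simp only [inner_sympOp, pairState_zero, pairState_one, pairState_two, pairState_three,
    massForm_eq, massA_smul, massB_smul, real_inner_smul_left, real_inner_smul_right] at H
  constructor
  · refine sameBigridProjection_of_re fun v hv => ?_
    have e := H 0 v z hv
    rw [re_pairing_massOp, massForm]
    simp only [massA, massB, map_zero, inner_zero_right, map_sub, inner_add_left,
      inner_sub_left] at e ⊢
    linear_combination (-(1 / 12)) * e
  · refine sameBigridProjection_of_re fun u hu => ?_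
    have e := H u 0 hu z
    rw [re_pairing_massOp, massForm]
    simp only [massA, massB, map_zero, inner_zero_right, map_sub, inner_add_left,
      inner_sub_left] at e ⊢
    linarith

end Controlled
end DGWave
-- Uniform observability and controllability
theorem mainTheorem4 (𝕜 : Type*) [RCLike 𝕜] (s : ℝ) (hs : 1 < s) :
    ∃ T₀ : ℝ, 0 < T₀ ∧ ∀ T : ℝ, T₀ < T → ∃ C : ℝ, 0 < C ∧ ∀ h : ℝ, 0 < h → h ≤ 1 →
      -- uniform observability in the class of bi-grid data
      (∀ U V : ℝ → DGWave.EllTwo 𝕜, DGWave.IsSolution s h U V →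
        DGWave.IsBigrid (U 0 : DGWave.Coeffs 𝕜) → DGWave.IsBigrid (V 0 : DGWave.Coeffs 𝕜) →
        DGWave.totalEnergy s h (U 0 : DGWave.Coeffs 𝕜) (V 0 : DGWave.Coeffs 𝕜) ≤
          C * ∫ t in (0 : ℝ)..T,
            DGWave.localEnergy s h (U t : DGWave.Coeffs 𝕜) (V t : DGWave.Coeffs 𝕜)) ∧
      -- uniform controllability of the projection on the bi-grid space
      (∀ (Y₀ Z₀ Y₁ Z₁ : DGWave.EllTwo 𝕜) (K : ℝ),
        DGWave.DualNormLe s h K Y₀ Z₀ → DGWave.DualNormLe s h K Y₁ Z₁ →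
        ∃ F G : ℝ → DGWave.Coeffs 𝕜,
          (∀ k, MeasureTheory.StronglyMeasurable fun t => F t k) ∧
          (∀ k, MeasureTheory.StronglyMeasurable fun t => G t k) ∧
          DGWave.controlCost s h T F G ≤ ENNReal.ofReal (C * K ^ 2) ∧
          ∃ Y Z : ℝ → DGWave.EllTwo 𝕜,
            DGWave.IsControlled s h T F G Y Z ∧ Y 0 = Y₀ ∧ Z 0 = Z₀ ∧
            DGWave.SameBigridProjection h (Y T) Y₁ ∧
            DGWave.SameBigridProjection h (Z T) Z₁) := by
  obtain ⟨K₁, K₂, hK₁, hK₂, H⟩ := DGWave.observability_bigrid 𝕜 hs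
  obtain ⟨L₁, L₂, hL₁, hL₂, H'⟩ := DGWave.exists_steering 𝕜 hs
  -- The waiting time must exceed the thresholds of both halves; these depend only on `s` and the
  -- scalar field.
  refine ⟨max K₁ L₁, lt_max_of_lt_left hK₁, fun T hT => ?_⟩
  obtain ⟨hTK, hTL⟩ := max_lt_iff.1 hT
  have hT0 : 0 ≤ T := (hK₁.trans hTK).le
  have hTK' : 0 < T - K₁ := sub_pos.2 hTK
  refine ⟨max (K₂ / (T - K₁)) (8 * L₂ / (T - L₁)), lt_max_of_lt_left (by positivity),
    fun h hh hh1 => ⟨fun U V hUV hU hV => ?_, fun Y₀ Z₀ Y₁ Z₁ K h₀ h₁ => ?_⟩⟩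
  · have key := H hh hh1 hT0 hUV hU hV
    have hpos : 0 ≤ ∫ t in (0 : ℝ)..T, DGWave.localEnergy s h (U t : DGWave.Coeffs 𝕜) (V t) :=
      intervalIntegral.integral_nonneg hT0 fun t _ => by
        rw [DGWave.localEnergy_eq hh.ne']
        exact mul_nonneg (by positivity) (DGWave.cellForm_cellWeight_nonneg hs _ _)
    refine le_trans ?_ (mul_le_mul_of_nonneg_right (le_max_left _ _) hpos)
    rw [div_mul_eq_mul_div, le_div_iff₀ hTK']
    linarith
  · obtain ⟨ψ, hcost, hproj⟩ := H' hh hh1 hTL h₀ h₁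
    have hψ := DGWave.continuous_freeState s h T ψ
    obtain ⟨hY, hZ⟩ := DGWave.sameBigridProjection_of_sympOp hh.ne' hproj
    refine ⟨_, _, DGWave.stronglyMeasurable_velControl h hψ,
      DGWave.stronglyMeasurable_dispControl hψ, ?_, _, _,
      DGWave.isControlled_steer hh.ne' T (DGWave.pairState h Y₀ Z₀) hψ rfl, ?_, ?_, hY, hZ⟩
    · rw [DGWave.controlCost_eq hs hh hT0 hψ]
      exact ENNReal.ofReal_le_ofReal (hcost.trans
        (mul_le_mul_of_nonneg_right (le_max_right _ _) (sq_nonneg K)))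
    · simp [DGWave.glue_avg_jmp]
    · refine DGWave.ext_avg_jmp ?_ ?_ <;> simp [hh.ne']
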